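/- **Setting.** A finite set $\mathcal N$ of $N\ge 1$ agents plays a discounted Markov game with states $\mathcal S$, common action set $\mathcal A$, rewards $r_i$, transition probabilities $\mathcal P$, discount $\gamma\in(0,1)$ and an initial state (fixed or drawn from a fixed distribution $\rho$). Agent $n$ uses policies $\pi_{n,\theta}(\cdot\mid s)$ with positive densities that are differentiable in the joint parameter $\theta=(\theta_i)_{i\in\mathcal N}\in\mathbb R^M$; given $s$ the agents act independently. Let $u_i(\theta)=\mathbb E[\sum_{t\ge0}\gamma^t r_i(s_t,a_t)]$ under $\Pi_\theta$, assume that the $u_i$ are differentiable and that the game is a Markov potential game: there is a differentiable $u:\mathbb R^M\to\mathbb R$ with $\nabla_i u_i=\nabla_i u$ for all $i$. **Algorithm (networked policy gradient play).** Agent $i$ keeps beliefs $\hat\theta^i_{j,t}$ on the parameters $\theta_{j,t}$ of the agents $j$, with $\hat\theta^i_{i,t}=\theta_{i,t}$; put $\hat\theta^i_t=(\hat\theta^i_{j,t})_j$. In iteration $t=0,1,2,\dots$, given the past, an episode $(s_0,a_0),(s_1,a_1),\dots$ is played from the initial state, with actions drawn either jointly, each agent acting by its own belief ($a_n\sim\pi_{n,\hat\theta^n_t}$),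 or separately for each agent $i$ with all policies evaluated at its belief ($a_n\sim\pi_{n,\hat\theta^i_t}$). Horizons $\mathcal T_1\sim Geom(1-\gamma)$ and $\mathcal T_2\sim Geom(1-\sqrt\gamma)$ on $\{0,1,\dots\}$ are drawn independently, and agent $i$ forms $g_{i,t}=c\,\hat R_i\sum_n\nabla_i\log\pi_{n,\hat\theta^i_t}(a_{n,\mathcal T_1}\mid s_{\mathcal T_1})$ with a fixed constant $c>0$ (for example $c=1$, or $c=1/(1-\gamma)$, which makes the estimator unbiased when all beliefs are correct). Here $\hat R_i$ is one of $\hat Q_i=\sum_{t=0}^{\mathcal T_2}\gamma^{t/2}r_i(s_{\mathcal T_1+t},a_{\mathcal T_1+t})$, $\hat Q_i-\hat V_i(s_{\mathcal T_1})$, or $r_i(s_{\mathcal T_1},a_{\mathcal T_1})+\gamma\hat V_i(s_{\mathcal T_1+1})-\hat V_i(s_{\mathcal T_1})$, where $\hat V_i(s)$ is the sum $\sum_{t=0}^{\mathcal T}\gamma^{t/2}r_i$ along a play from $s$ up to a horizon $\mathcal T\sim Geom(1-\sqrt\gamma)$: for $s_{\mathcal T_1+1}$ the continuation of the episode with $\mathcal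 T=\mathcal T_2$, for $s_{\mathcal T_1}$ a fresh play and a fresh horizon. Then $\theta_{i,t+1}=\theta_{i,t}+\alpha_{t+1}g_{i,t}$, the agents exchange beliefs over an undirected graph $\mathcal G_{t+1}=(\mathcal N,\mathcal E_{t+1})$, and $\hat\theta^i_{j,t+1}=\sum_{l}w^i_{jl,t+1}\tilde\theta^l_j$, where $\tilde\theta^j_j=\theta_{j,t+1}$ and $\tilde\theta^l_j=\hat\theta^l_{j,t}$ for $l\ne j$. **Assumptions.** 1. The graph of the edges that are present infinitely often is connected, and there is $T_{\mathcal G}>0$ such that each of these edges is present at least once in every window $\{t,\dots,t+T_{\mathcal G}-1\}$, $t\ge1$. 2. There is $h\in(0,1)$ such that, for all $t\ge 1$: $w^i_{jl,t}\ge h$ if $i\neq j$ and $l$ is $i$ or a neighbour of $i$ in $\mathcal G_t$; $w^i_{jl,t}=0$ if $l$ is neither; $w^j_{jj,t}=1$ and $w^j_{jl,t}=0$ for $l\ne j$; and $\sum_l w^i_{jl,t}=1$. 3. $\mathbb E|\hat\theta^i_{j,0}(m)-\theta_{j,0}(m)|\le\kappa$ for some $\kappa\ge 0$, all $i\ne j$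 and all coordinates $m$. 4. $\alpha_t>0$ for $t\ge 1$ and $\alpha_t=\Theta(t^{-\beta})$ with $\beta\in(0,1)$. 5. $|r_i|\le R$ for all $i$, with some $R>0$. 6. There are $B,V,\mathcal L\ge 0$ such that, for all $i,n,\theta,s$ and $a\sim\pi_{n,\theta}(\cdot\mid s)$, $\mathbb E\|\nabla_i\log\pi_{n,\theta}(a\mid s)\|\le B$ and $\mathbb E\|\nabla_i\log\pi_{n,\theta}(a\mid s)\|^2\le V^2$, and $\theta\mapsto\nabla_i\log\pi_{n,\theta}(a\mid s)$ is $\mathcal L$-Lipschitz for all $s,a$. **Theorem.** For $\epsilon>0$ let $$T_\epsilon=\min\Big\{t\in\mathbb N:\ \inf_{0\le\tau\le t}\mathbb E\|\nabla u(\theta_\tau)\|^2\le\epsilon\Big\}.$$ Then the expectations $\mathbb E\|\nabla u(\theta_\tau)\|^2$ and $T_\epsilon$ are finite, and $T_\epsilon=O(\epsilon^{-1/\tilde\beta})$ as $\epsilon\to0^+$, where $\tilde\beta=\min\{1-\beta,\beta\}$. In particular, $T_\epsilon=O(\epsilon^{-2})$ if $\beta=1/2$. -/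

import Mathlib

open MeasureTheory ProbabilityTheory Filter Asymptotics Topology

noncomputable section

/-- Joint parameters `θ = (θ_i)_i ∈ ℝ^M`, `M = ∑ i, M i`, with the Euclidean norm. -/
abbrev Param {ι : Type*} (M : ι → ℕ) : Type _ := PiLp 2 (fun i => EuclideanSpace ℝ (Fin (M i)))

/-- A state together with a joint action. -/
abbrev StateAction (ι S A : Type*) : Type _ := S × (ι → A)

/-- An infinite play `(s₀, a₀), (s₁, a₁), …`. -/
abbrev Play (ι S A : Type*) : Type _ := ℕ → StateAction ι S A

/-- A discounted Markov game with agents `ι`, states `S` and common action set `A`.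
Every episode starts from `init` (a fixed initial state `s` is the case `init = dirac s`). -/
structure MarkovGame (ι S A : Type*) [MeasurableSpace S] [MeasurableSpace A] where
  reward : ι → StateAction ι S A → ℝ
  measurable_reward : ∀ i, Measurable (reward i)
  transition : Kernel (StateAction ι S A) S
  isMarkov_transition : IsMarkovKernel transition
  init : Measure S
  isProbability_init : IsProbabilityMeasure init
  discount : ℝ
  discount_pos : 0 < discount
  discount_lt_one : discount < 1

/-- Differentiable networked policies: agent `n` in state `s` draws its action from the
density `density n θ s` with respect to the reference measure `ν` (counting measure, Lebesgue
measure, …). The density may depend on the parameters of all agents. -/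
structure ParamPolicy (ι S A : Type*) [Fintype ι] [MeasurableSpace S] [MeasurableSpace A]
    (M : ι → ℕ) (ν : Measure A) where
  density : ι → Param M → S → A → ℝ
  density_pos : ∀ n θ s a, 0 < density n θ s a
  measurable_density : ∀ n, Measurable (fun x : (Param M × S) × A => density n x.1.1 x.1.2 x.2)
  lintegral_density : ∀ n θ s, ∫⁻ a, ENNReal.ofReal (density n θ s a) ∂ν = 1
  differentiable_density : ∀ n s a, Differentiable ℝ (fun θ => density n θ s a)

attribute [instance] MarkovGame.isMarkov_transition MarkovGame.isProbability_init

section Policy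

variable {ι S A : Type*} [Fintype ι] [MeasurableSpace S] [MeasurableSpace A] {M : ι → ℕ}
  {ν : Measure A} [SigmaFinite ν]

/-- The policy `π_{n,θ}(· | s)` of agent `n`. -/
def ParamPolicy.policy (π : ParamPolicy ι S A M ν) (n : ι) : Kernel (Param M × S) A :=
  (Kernel.const (Param M × S) ν).withDensity
    (fun x a => ENNReal.ofReal (π.density n x.1 x.2 a))

instance (π : ParamPolicy ι S A M ν) (n : ι) : IsMarkovKernel (π.policy n) := by
  refine ⟨fun x => ⟨?_⟩⟩
  have h : Measurable (Function.uncurry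
      (fun (x : Param M × S) a => ENNReal.ofReal (π.density n x.1 x.2 a))) :=
    (π.measurable_density n).ennreal_ofReal
  rw [ParamPolicy.policy, Kernel.withDensity_apply' _ h, setLIntegral_univ]
  exact π.lintegral_density n x.1 x.2

/-- The joint policy: given the state, the agents act independently, agent `n` with its policy
at the parameter `φ n`. The joint policy `Π_θ` is the case `φ n = θ` for all `n`. -/
def ParamPolicy.joint (π : ParamPolicy ι S A M ν) : Kernel ((ι → Param M) × S) (ι → A) where
  toFun x := Measure.pi (fun n => π.policy n (x.1 n, x.2))
  measurable' := by
    refine Measurable.measure_of_isPiSystem_of_isProbabilityMeasure generateFrom_pi.symm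
      isPiSystem_pi ?_
    rintro _ ⟨s, hs, rfl⟩
    simp only [Measure.pi_pi]
    refine Finset.measurable_prod _ fun n _ => ?_
    exact ((π.policy n).measurable_coe (hs n (Set.mem_univ n))).comp
      (((measurable_pi_apply n).comp measurable_fst).prodMk measurable_snd)

instance (π : ParamPolicy ι S A M ν) : IsMarkovKernel π.joint :=
  ⟨fun x => inferInstanceAs
    (IsProbabilityMeasure (Measure.pi (fun n => π.policy n (x.1 n, x.2))))⟩

/-- The score `∇_i log π_{n,θ}(a | s)`: the block of agent `i` of the gradient in `θ`. -/
def ParamPolicy.score (π : ParamPolicy ι S A M ν) (i n : ι) (θ : Param M) (s : S) (a : A) :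
    EuclideanSpace ℝ (Fin (M i)) :=
  (gradient (fun θ' => Real.log (π.density n θ' s a)) θ) i

end Policy

/-- The law of the time-homogeneous Markov chain with transition kernel `K`,
as a function of the starting point. -/
def chainLaw {Z : Type*} [MeasurableSpace Z] (K : Kernel Z Z) [IsMarkovKernel K] :
    Kernel Z (ℕ → Z) :=
  (Kernel.traj (X := fun _ => Z)
    (fun n => K.comap (fun h : Finset.Iic n → Z => h ⟨n, Finset.mem_Iic.2 le_rfl⟩)
      (measurable_pi_apply _)) 0).comap
    (fun z _ => z) (measurable_pi_lambda _ fun _ => measurable_id)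

section Game

variable {ι S A : Type*} [Fintype ι] [MeasurableSpace S] [MeasurableSpace A] {M : ι → ℕ}
  {ν : Measure A} [SigmaFinite ν]

/-- `(φ, s) ↦ (φ, s, a)` where `a` is drawn from the joint policy with parameters `φ`. -/
def actKernel (π : ParamPolicy ι S A M ν) :
    Kernel ((ι → Param M) × S) ((ι → Param M) × StateAction ι S A) :=
  (Kernel.deterministic Prod.fst measurable_fst) ×ₖ
    ((Kernel.deterministic Prod.snd measurable_snd) ×ₖ π.joint)

instance (π : ParamPolicy ι S A M ν) : IsMarkovKernel (actKernel π) := by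
  unfold actKernel; infer_instance

/-- One step of the game, with the policy parameters `φ` carried along unchanged: the next state
is drawn from the transition kernel, then the next joint action from the joint policy. -/
def stepKernel (Γ : MarkovGame ι S A) (π : ParamPolicy ι S A M ν) :
    Kernel ((ι → Param M) × StateAction ι S A) ((ι → Param M) × StateAction ι S A) :=
  actKernel π ∘ₖ ((Kernel.deterministic Prod.fst measurable_fst) ×ₖ
    (Γ.transition.comap Prod.snd measurable_snd))

instance (Γ : MarkovGame ι S A) (π : ParamPolicy ι S A M ν) :
    IsMarkovKernel (stepKernel Γ π) := by
  unfold stepKernel; infer_instance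

/-- The law of the play from the state `s` when agent `n` uses its policy at parameter `φ n`. -/
def pathLaw (Γ : MarkovGame ι S A) (π : ParamPolicy ι S A M ν) :
    Kernel ((ι → Param M) × S) (Play ι S A) :=
  (chainLaw (stepKernel Γ π) ∘ₖ actKernel π).map (fun z t => (z t).2)

/-- The value function `V_i^{Π_θ}(s)`. -/
def valueFn (Γ : MarkovGame ι S A) (π : ParamPolicy ι S A M ν) (i : ι) (θ : Param M) (s : S) : ℝ :=
  ∫ x, ∑' t : ℕ, Γ.discount ^ t * Γ.reward i (x t) ∂(pathLaw Γ π (fun _ => θ, s))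

/-- The utility function `u_i(θ)` of agent `i`. -/
def utility (Γ : MarkovGame ι S A) (π : ParamPolicy ι S A M ν) (i : ι) (θ : Param M) : ℝ :=
  ∫ s, valueFn Γ π i θ s ∂Γ.init

/-- `u` is a potential value function: `∇_i u_i(θ) = ∇_i u(θ)` for all agents `i` and all `θ`,
where the value functions are differentiable. -/
structure IsPotential (Γ : MarkovGame ι S A) (π : ParamPolicy ι S A M ν) (u : Param M → ℝ) :
    Prop where
  differentiable_utility : ∀ i, Differentiable ℝ (utility Γ π i)
  differentiable_potential : Differentiable ℝ u
  gradient_eq : ∀ i θ, (gradient (utility Γ π i) θ) i = (gradient u θ) i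

/-- The data of a gradient estimation `(((T₁, x), y), (T₂, T₂'))`: the first random horizon `T₁`
and the play `x`; a second play `y` restarted from the state of `x` at time `T₁`; the random
horizons `T₂` and `T₂'` over which rewards are collected along `x` and `y`. -/
abbrev Episode (ι S A : Type*) : Type _ := ((ℕ × Play ι S A) × Play ι S A) × (ℕ × ℕ)

/-- The law of an episode in which agent `n` acts by its policy at parameter `φ n`:
`T₁ ∼ Geom(1 - γ)` and `T₂, T₂' ∼ Geom(1 - γ^{1/2})` on `{0, 1, 2, …}`, independent of the rest. -/
def episodeLaw (Γ : MarkovGame ι S A) (π : ParamPolicy ι S A M ν) :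
    Kernel (ι → Param M) (Episode ι S A) :=
  let geom₁ : Measure ℕ := geometricMeasure
    ⟨1 - Γ.discount, by linarith [Γ.discount_lt_one], by linarith [Γ.discount_pos]⟩
  let geom₂ : Measure ℕ := geometricMeasure
    ⟨1 - √Γ.discount,
      sub_nonneg.2 (Real.sqrt_le_one.2 Γ.discount_lt_one.le),
      sub_le_self _ (Real.sqrt_nonneg _)⟩
  let first : Kernel (ι → Param M) (ℕ × Play ι S A) :=
    (Kernel.const _ geom₁) ×ₖ (pathLaw Γ π ∘ₖ (Kernel.id ×ₖ Kernel.const _ Γ.init))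
  let second : Kernel ((ι → Param M) × (ℕ × Play ι S A)) (Play ι S A) :=
    (pathLaw Γ π).comap (fun z => (z.1, (z.2.2 z.2.1).1))
      (measurable_fst.prodMk (measurable_fst.comp
        ((measurable_from_prod_countable_right
          (f := fun q : ℕ × Play ι S A => q.2 q.1) fun n => measurable_pi_apply n).comp
            measurable_snd)))
  (first ⊗ₖ second) ×ₖ (Kernel.const _ (geom₂.prod geom₂))

/-- The three choices for the reward part of the stochastic gradient: an estimate of the
`Q`-function, of the advantage function, or of the temporal difference. -/
inductive RewardEstimator
  | qFunction
  | advantage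
  | temporalDifference

/-- Rewards `∑_{t=0}^{T} γ^{t/2} r_i(x_{k+t})` collected along `x` from time `k` on. -/
def collected (Γ : MarkovGame ι S A) (i : ι) (x : Play ι S A) (k T : ℕ) : ℝ :=
  ∑ t ∈ Finset.range (T + 1), Γ.discount ^ ((t : ℝ) / 2) * Γ.reward i (x (k + t))

/-- The estimate `R̂_i` computed from an episode: `Q̂_i`, or `Â_i = Q̂_i - V̂_i(s_{T₁})`, or
`r_i(s_{T₁}, a_{T₁}) + γ V̂_i(s_{T₁+1}) - V̂_i(s_{T₁})`. -/
def rewardEstimate (Γ : MarkovGame ι S A) (i : ι) : RewardEstimator → Episode ι S A → ℝ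
  | .qFunction, (((T₁, x), _), (T₂, _)) => collected Γ i x T₁ T₂
  | .advantage, (((T₁, x), y), (T₂, T₂')) => collected Γ i x T₁ T₂ - collected Γ i y 0 T₂'
  | .temporalDifference, (((T₁, x), y), (T₂, T₂')) =>
      Γ.reward i (x T₁) + Γ.discount * collected Γ i x (T₁ + 1) T₂ - collected Γ i y 0 T₂'

/-- The stochastic gradient `c R̂_i ∑_n ∇_i log π_{n,θ}(a_{n,T₁} | s_{T₁})` of agent `i`, with the
scores evaluated at the parameter `θ` (the belief of agent `i`). -/
def stochGradient (Γ : MarkovGame ι S A) (π : ParamPolicy ι S A M ν) (c : ℝ)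
    (e : RewardEstimator) (i : ι) (θ : Param M) (d : Episode ι S A) :
    EuclideanSpace ℝ (Fin (M i)) :=
  (c * rewardEstimate Γ i e d) •
    ∑ n, π.score i n θ (d.1.1.2 d.1.1.1).1 ((d.1.1.2 d.1.1.1).2 n)

/-- How the plays for the gradient estimations are generated from the agents' beliefs: `joint`,
the agents play together and every agent acts by its own belief; `separate`, each agent runs the
gradient estimation with all policies evaluated at its own belief. -/
inductive PlayMode
  | joint
  | separate

/-- The parameters by which the actions in the episode of agent `i` are drawn
when the beliefs are `b`. -/
def PlayMode.acting : PlayMode → (ι → Param M) → ι → (ι → Param M)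
  | .joint, b, _ => b
  | .separate, b, i => fun _ => b i

/-- Bounded rewards. -/
def BoundedReward (Γ : MarkovGame ι S A) (R : ℝ) : Prop := ∀ i x, |Γ.reward i x| ≤ R

/-- First and second moments of the scores are bounded by `B` and `V ^ 2`, uniformly in the
parameter and the state, and the scores are Lipschitz in the parameter with constant `L`. -/
structure ScoreAssumption (π : ParamPolicy ι S A M ν) (B V L : ℝ) : Prop where
  first_moment : ∀ i n θ s,
    ∫⁻ a, ‖π.score i n θ s a‖ₑ ∂(π.policy n (θ, s)) ≤ ENNReal.ofReal B
  second_moment : ∀ i n θ s,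
    ∫⁻ a, ‖π.score i n θ s a‖ₑ ^ 2 ∂(π.policy n (θ, s)) ≤ ENNReal.ofReal (V ^ 2)
  lipschitz : ∀ i n θ₁ θ₂ s a,
    ‖π.score i n θ₁ s a - π.score i n θ₂ s a‖ ≤ L * ‖θ₁ - θ₂‖

end Game

/-- The graph of the edges that are present infinitely often. -/
def limitGraph {ι : Type*} (G : ℕ → SimpleGraph ι) : SimpleGraph ι where
  Adj i j := ∃ᶠ t in atTop, (G t).Adj i j
  symm := ⟨fun _ _ h => h.mono fun _ h' => h'.symm⟩
  loopless := ⟨fun _ h => h.exists.elim fun _ h' => h'.ne rfl⟩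

/-- The edges present infinitely often connect all agents, and each of them shows up in every
time window of some fixed length. -/
structure ConnectedNetwork {ι : Type*} (G : ℕ → SimpleGraph ι) : Prop where
  connected : (limitGraph G).Connected
  bounded_gaps : ∃ T : ℕ, 0 < T ∧ ∀ i j, (limitGraph G).Adj i j →
    ∀ t, 1 ≤ t → ∃ τ < T, (G (t + τ)).Adj i j

/-- The weights `w t i j l` of agent `i` on the belief of agent `l` about agent `j`. On the
own parameters (`i = j`) the whole weight is on the agent itself. -/
structure WeightAssumption {ι : Type*} [Fintype ι] (G : ℕ → SimpleGraph ι)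
    (w : ℕ → ι → ι → ι → ℝ) (h : ℝ) : Prop where
  lower : ∀ t, 1 ≤ t → ∀ i j l, i ≠ j → ((G t).Adj i l ∨ l = i) → h ≤ w t i j l
  zero : ∀ t, 1 ≤ t → ∀ i j l, ¬ ((G t).Adj i l ∨ l = i) → w t i j l = 0
  own : ∀ t, 1 ≤ t → ∀ j, w t j j j = 1
  own_other : ∀ t, 1 ≤ t → ∀ j l, l ≠ j → w t j j l = 0
  sum_one : ∀ t, 1 ≤ t → ∀ i j, ∑ l, w t i j l = 1

section Algorithm

variable {ι S A Ω : Type*} [Fintype ι] [DecidableEq ι] [MeasurableSpace S] [MeasurableSpace A]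
  {mΩ : MeasurableSpace Ω} {M : ι → ℕ} {ν : Measure A} [SigmaFinite ν]

/-- `θ`, the beliefs `b` (with `b t i ω j` the belief `θ̂^i_{j,t}`) and the episodes `ep` are
generated by networked policy gradient play. The episode `ep t i` is the one used by agent `i` at
the iteration leading from `t` to `t + 1`; agents sharing one play is the case that `ep t i` does
not depend on `i`. In `belief_step`, the agents have already updated their own parameters when
they exchange beliefs. -/
structure NetworkedPolicyGradientPlay (Γ : MarkovGame ι S A) (π : ParamPolicy ι S A M ν)
    (mode : PlayMode) (est : ι → RewardEstimator) (c : ℝ) (α : ℕ → ℝ) (w : ℕ → ι → ι → ι → ℝ)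
    (P : Measure Ω) (ℱ : Filtration ℕ mΩ) (θ : ℕ → Ω → Param M)
    (b : ℕ → ι → Ω → Param M) (ep : ℕ → ι → Ω → Episode ι S A) : Prop where
  measurable_param : ∀ t, Measurable[ℱ t] (θ t)
  measurable_belief : ∀ t i, Measurable[ℱ t] (b t i)
  measurable_episode : ∀ t i, Measurable[ℱ (t + 1)] (ep t i)
  /-- Given the past, the episode has the law determined by the current beliefs. -/
  episode_law : ∀ t i (E : Set (Episode ι S A)), MeasurableSet E →
    ∀ F : Set Ω, MeasurableSet[ℱ t] F →
      P (F ∩ ep t i ⁻¹' E) =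
        ∫⁻ ω in F, episodeLaw Γ π (mode.acting (fun n => b t n ω) i) E ∂P
  own_init : ∀ i ω, b 0 i ω i = θ 0 ω i
  param_step : ∀ t i ω,
    θ (t + 1) ω i = θ t ω i + α (t + 1) • stochGradient Γ π c (est i) i (b t i ω) (ep t i ω)
  belief_step : ∀ t i j ω,
    b (t + 1) i ω j = ∑ l, w (t + 1) i j l • (if l = j then θ (t + 1) ω j else b t l ω j)

/-- First moments of the initial belief errors are bounded by `κ`. -/
def InitialBeliefError (P : Measure Ω) (θ₀ : Ω → Param M) (b₀ : ι → Ω → Param M) (κ : ℝ) : Prop :=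
  ∀ i j, i ≠ j → ∀ m : Fin (M j),
    ∫⁻ ω, ENNReal.ofReal |b₀ i ω j m - θ₀ ω j m| ∂P ≤ ENNReal.ofReal κ

/-- The times `t` with `min_{0 ≤ τ ≤ t} E ‖∇u(θ_τ)‖² ≤ ε`. -/
def stationaryTimes (P : Measure Ω) (u : Param M → ℝ) (θ : ℕ → Ω → Param M) (ε : ℝ) : Set ℕ :=
  {t | (Finset.range (t + 1)).inf' Finset.nonempty_range_add_one
    (fun τ => ∫ ω, ‖gradient u (θ τ ω)‖ ^ 2 ∂P) ≤ ε}

/-- The number `T_ε` of iterations needed to reach an `ε`-stationary point in expectation. -/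
def stationaryTime (P : Measure Ω) (u : Param M → ℝ) (θ : ℕ → Ω → Param M) (ε : ℝ) : ℕ :=
  sInf (stationaryTimes P u θ ε)

end Algorithm

end

noncomputable section

/-! ### Analytic preliminaries -/

/-! The iteration is a biased stochastic gradient ascent for `u`. The classical argument for smooth
nonconvex functions applies once `u` is known to be smooth with bounded gradient and bounded
oscillation, the gradient estimates have controlled moments, and their bias is of the order of the
step size.

Smoothness. Scores are only Lipschitz with bounded moments, so nothing is differentiated under an
integral sign. Instead, every agent `n` acts at its own copy `φ n` of the joint parameter, and all
quantities are expanded to first order in `φ` with a uniform quadratic remainder. `joint_expansion`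
does this for the joint policy given the state. The performance difference lemma, together with
Lipschitz occupation measures, lifts it to the expected values (`jointUtility_expansion`). A uniform
quadratic expansion forces the derivative to be Lipschitz (`abs_sub_le_of_quadratic_expansion`). On
the diagonal `φ n = θ` the derivative is the policy gradient (`inner_gradient_utility`), and the
identity of the blocks of `∇u` and `∇u_i` carries the bounds over to `u`. The oscillation of `u` is
bounded by changing one block at a time (`IsPotential.abs_sub_le`).

Estimates. Averaged over the horizons, every reward estimate becomes the `Q`-function minus a
multiple of the state value, and the latter drops out because scores have mean zero given the state.
Hence the mean of the estimate is `c (1 - γ)` times the derivative at the acting parameters, and its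
distance from `c (1 - γ) ∇_i u(θ)` is at most a multiple of the belief error
(`exists_norm_integral_actingGradient_sub_le`). The algorithm evaluates scores at an agent's own
belief and not at the acting parameters; by the Lipschitz property this costs another multiple of
the belief error, pointwise.

Beliefs. Information about agent `j` travels along walks in the limit graph, so over a window of
length `W` the largest error shrinks by the factor `1 - h ^ W`, up to perturbations `α E‖g‖`
(`ConnectedNetwork.exists_contraction`). Since `E‖g‖` grows at most linearly in the expected error,
and `t^{-β}` decays slower than any geometric sequence, the expected error is `O(t^{-β})`
(`exists_integral_beliefError_le`).

Rate. Each step thus raises `E u` by at least a multiple of `t^{-β} E‖∇u‖²` minus a multiple of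
`t^{-2β}`. Summing over `T ≤ t < 2T`, with `E u` of bounded oscillation, shows that the smallest
`E‖∇u‖²` is `O(T^{β-1} + T^{-β})` (`exists_le_of_descent`); solving for `T` gives the claim. -/

lemma abs_exp_sub_one_le (y : ℝ) : |Real.exp y - 1| ≤ |y| * (1 + Real.exp y) := by
  have h1 := Real.add_one_le_exp y
  have h2 := Real.add_one_le_exp (-y)
  have h3 := Real.exp_pos y
  have h4 : Real.exp y * Real.exp (-y) = 1 := by rw [← Real.exp_add]; simp
  rcases le_total 0 y with hy | hy
  · rw [abs_of_nonneg hy, abs_of_nonneg (by linarith)]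
    nlinarith
  · rw [abs_of_nonpos hy, abs_of_nonpos (by linarith [Real.exp_le_one_iff.2 hy])]
    nlinarith

/-- The form `1 + exp y` of the factor is chosen for `y` the logarithm of a density: integrating `1`
gives a moment under the old measure and integrating `exp y` gives the same moment under the new
one. -/
lemma abs_exp_sub_one_sub_le (y : ℝ) :
    |Real.exp y - 1 - y| ≤ y ^ 2 * (1 + Real.exp y) := by
  have h1 := Real.add_one_le_exp y
  have h2 := Real.add_one_le_exp (-y)
  have h3 := Real.exp_pos y
  have h4 : Real.exp y * Real.exp (-y) = 1 := by rw [← Real.exp_add]; simp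
  rw [abs_of_nonneg (by linarith)]
  have h5 : Real.exp y - 1 ≤ y * Real.exp y := by nlinarith
  have h6 : Real.exp y - 1 - y ≤ y * (Real.exp y - 1) := by linarith
  refine h6.trans ?_
  calc y * (Real.exp y - 1) ≤ |y * (Real.exp y - 1)| := le_abs_self _
    _ = |y| * |Real.exp y - 1| := abs_mul _ _
    _ ≤ |y| * (|y| * (1 + Real.exp y)) := by
        gcongr; exact abs_exp_sub_one_le y
    _ = y ^ 2 * (1 + Real.exp y) := by rw [← mul_assoc, abs_mul_abs_self]; ring

section Gradient

variable {E : Type*} [NormedAddCommGroup E] [InnerProductSpace ℝ E] [CompleteSpace E]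

lemma Differentiable.hasFDerivAt_gradient {f : E → ℝ} (hf : Differentiable ℝ f) (x : E) :
    HasFDerivAt f (InnerProductSpace.toDual ℝ E (gradient f x)) x :=
  hasGradientAt_iff_hasFDerivAt.1 (hf x).hasGradientAt

/-- Mean value inequality on the segment for `f` minus its linear part at `x`; the constant is `C`
and not `C / 2`, which is immaterial here. -/
lemma abs_sub_sub_inner_gradient_le {f : E → ℝ} (hf : Differentiable ℝ f) {C : ℝ} (hC : 0 ≤ C)
    (hlip : ∀ x y, ‖gradient f x - gradient f y‖ ≤ C * ‖x - y‖) (x y : E) :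
    |f y - f x - inner ℝ (gradient f x) (y - x)| ≤ C * ‖y - x‖ ^ 2 := by
  have := Convex.norm_image_sub_le_of_norm_hasFDerivWithin_le' (𝕜 := ℝ) (f := f)
    (C := C * ‖y - x‖) (s := segment ℝ x y) (x := x) (y := y)
    (f' := fun z => InnerProductSpace.toDual ℝ E (gradient f z))
    (φ := InnerProductSpace.toDual ℝ E (gradient f x))
    (fun z _ => (hf.hasFDerivAt_gradient z).hasFDerivWithinAt)
    (fun z hz => by
      rw [← map_sub, LinearIsometryEquiv.norm_map]
      refine (hlip z x).trans ?_
      gcongr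
      obtain ⟨a, b, ha, hb, hab, rfl⟩ := hz
      have : a • x + b • y - x = b • (y - x) := by
        rw [show a = 1 - b by linarith]; module
      rw [this, norm_smul, Real.norm_of_nonneg hb]
      exact mul_le_of_le_one_left (norm_nonneg _) (by linarith))
    (convex_segment x y) (left_mem_segment ℝ x y) (right_mem_segment ℝ x y)
  rw [Real.norm_eq_abs, InnerProductSpace.toDual_apply_apply] at this
  linarith [this, sq (‖y - x‖), mul_assoc C ‖y - x‖ ‖y - x‖]

lemma abs_sub_le_of_norm_gradient_le {f : E → ℝ} (hf : Differentiable ℝ f) {C : ℝ}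
    (hbd : ∀ x, ‖gradient f x‖ ≤ C) (x y : E) : |f y - f x| ≤ C * ‖y - x‖ := by
  have := Convex.norm_image_sub_le_of_norm_hasFDerivWithin_le (𝕜 := ℝ) (f := f)
    (C := C) (s := Set.univ) (x := x) (y := y)
    (f' := fun z => InnerProductSpace.toDual ℝ E (gradient f z))
    (fun z _ => (hf.hasFDerivAt_gradient z).hasFDerivWithinAt)
    (fun z _ => by rw [LinearIsometryEquiv.norm_map]; exact hbd z)
    convex_univ trivial trivial
  exact this

end Gradient

/-- A function with a uniform quadratic first order expansion has a Lipschitz derivative. -/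
lemma abs_sub_le_of_quadratic_expansion {E : Type*} [NormedAddCommGroup E] [NormedSpace ℝ E]
    {f : E → ℝ} {D : E → E →ₗ[ℝ] ℝ} {C : ℝ}
    (h : ∀ x y, |f y - f x - D x (y - x)| ≤ C * ‖y - x‖ ^ 2) (x y v : E) :
    |D x v - D y v| ≤ 6 * C * ‖x - y‖ * ‖v‖ := by
  rcases eq_or_ne v 0 with rfl | hv
  · simp
  rcases eq_or_ne x y with rfl | hxy
  · simp
  have hv' : 0 < ‖v‖ := norm_pos_iff.2 hv
  set r := ‖x - y‖ with hr
  have hr' : 0 < r := norm_pos_iff.2 (sub_ne_zero.2 hxy)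
  -- The direction is rescaled to length `r = ‖x - y‖`, and the point `y + w` is expanded both from
  -- `x` and from `y`. Together with the expansion of `y` from `x` the remainders add up to at most
  -- `C ((2r)² + r² + r²) = 6 C r²`.
  set w : E := (r / ‖v‖) • v with hw
  have hwn : ‖w‖ = r := by
    rw [hw, norm_smul, Real.norm_of_nonneg (by positivity)]; field_simp
  have hC : 0 ≤ C := by
    have := (abs_nonneg _).trans (h y x)
    rw [← hr] at this
    exact nonneg_of_mul_nonneg_left this (by positivity)
  have h1 := h x (y + w)
  have h2 := h y (y + w)
  have h3 := h x y
  have e1 : D x (y + w - x) = D x (y - x) + D x w := by rw [← map_add]; congr 1; abel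
  have e2 : y + w - y = w := by abel
  have n1 : ‖y + w - x‖ ≤ 2 * r := by
    calc ‖y + w - x‖ = ‖(y - x) + w‖ := by congr 1; abel
      _ ≤ ‖y - x‖ + ‖w‖ := norm_add_le _ _
      _ = 2 * r := by rw [hwn, norm_sub_rev, ← hr]; ring
  have n1' : C * ‖y + w - x‖ ^ 2 ≤ C * (2 * r) ^ 2 := by gcongr
  rw [e1] at h1
  rw [e2, hwn] at h2
  rw [norm_sub_rev, ← hr] at h3
  have key : |D x w - D y w| ≤ 6 * C * r ^ 2 := by
    rw [abs_le] at *
    constructor <;> nlinarith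
  have e3 : D x w - D y w = (r / ‖v‖) * (D x v - D y v) := by
    simp only [hw, map_smul, smul_eq_mul]; ring
  rw [e3, abs_mul, abs_of_pos (by positivity), div_mul_eq_mul_div, div_le_iff₀ hv'] at key
  have : r * |D x v - D y v| ≤ r * (6 * C * r * ‖v‖) := by linarith [key]
  exact le_of_mul_le_mul_left this hr'

/-! ### Change of density -/

section Density

variable {α : Type*} [MeasurableSpace α]

/-- Comparison of the means of a bounded function under two probability measures in terms of the
logarithm `y` of the density. -/
lemma density_change {μ μ' : Measure α} [IsProbabilityMeasure μ] [IsProbabilityMeasure μ']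
    {y X Z Z' : α → ℝ} (hy : Measurable y) (hX : Measurable X)
    (hμ : μ' = μ.withDensity fun a => ENNReal.ofReal (Real.exp (y a)))
    {A C δ : ℝ} (hδ : 0 ≤ δ)
    (hyX : ∀ a, |y a - X a| ≤ C * δ ^ 2) (hyZ : ∀ a, |y a| ≤ δ * Z a) (hyZ' : ∀ a, |y a| ≤ δ * Z' a)
    (hZ : Integrable (fun a => Z a ^ 2) μ) (hZ' : Integrable (fun a => Z' a ^ 2) μ')
    (hZA : ∫ a, Z a ^ 2 ∂μ ≤ A) (hZA' : ∫ a, Z' a ^ 2 ∂μ' ≤ A)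
    {q : α → ℝ} (hq : Measurable q) {K : ℝ} (hK : 0 ≤ K) (hqK : ∀ a, |q a| ≤ K) :
    |∫ a, q a ∂μ' - ∫ a, q a ∂μ| ≤ K * (2 * (1 + A)) * δ ∧
    |∫ a, q a ∂μ' - ∫ a, q a ∂μ - ∫ a, q a * X a ∂μ| ≤ K * (2 * A + C) * δ ^ 2 := by
  have hmeas : Measurable fun a => ENNReal.ofReal (Real.exp (y a)) := by fun_prop
  have hfin : ∀ᵐ a ∂μ, ENNReal.ofReal (Real.exp (y a)) < ⊤ := ae_of_all _ fun _ => by simp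
  have htr : ∀ g : α → ℝ, ∫ a, g a ∂μ' = ∫ a, Real.exp (y a) * g a ∂μ := by
    intro g
    rw [hμ, integral_withDensity_eq_integral_toReal_smul hmeas hfin]
    simp [Real.exp_nonneg]
  have hint : ∀ {g : α → ℝ}, Integrable g μ' ↔ Integrable (fun a => Real.exp (y a) * g a) μ := by
    intro g
    rw [hμ, integrable_withDensity_iff hmeas hfin]
    simp [Real.exp_nonneg, mul_comm]
  have hexp : Integrable (fun a => Real.exp (y a)) μ := by
    have := hint.1 (integrable_const (μ := μ') (1 : ℝ))
    simpa using this
  have sq1 : ∀ a, y a ^ 2 ≤ δ ^ 2 * Z a ^ 2 := fun a => by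
    rw [← mul_pow, ← sq_abs]; exact pow_le_pow_left₀ (abs_nonneg _) (hyZ a) 2
  have sq2 : ∀ a, y a ^ 2 ≤ δ ^ 2 * Z' a ^ 2 := fun a => by
    rw [← mul_pow, ← sq_abs]; exact pow_le_pow_left₀ (abs_nonneg _) (hyZ' a) 2
  -- First moments are obtained from second moments through `z ≤ 1 + z ^ 2`.
  have ly : ∀ a, |y a| ≤ δ * (1 + Z a ^ 2) := fun a => (hyZ a).trans <| by
    gcongr; nlinarith [sq_nonneg (Z a - 1)]
  have ly' : ∀ a, |y a| ≤ δ * (1 + Z' a ^ 2) := fun a => (hyZ' a).trans <| by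
    gcongr; nlinarith [sq_nonneg (Z' a - 1)]
  have mono : ∀ {m : Measure α} {f g : α → ℝ}, AEStronglyMeasurable f m → Integrable g m →
      (∀ a, 0 ≤ f a) → (∀ a, f a ≤ g a) → Integrable f m := by
    intro m f g hf hg h0 h1
    exact hg.mono' hf (ae_of_all _ fun a => by rw [Real.norm_of_nonneg (h0 a)]; exact h1 a)
  have i1 : Integrable (fun a => |y a|) μ :=
    mono (by fun_prop) (((integrable_const 1).add hZ).const_mul δ) (fun _ => abs_nonneg _) ly
  -- Under `μ` there is no direct control of `exp y`. Terms containing it are read as integrals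
  -- under `μ'`, which is why a second dominating function `Z'` with a moment under `μ'` is needed.
  have i1' : Integrable (fun a => |y a|) μ' :=
    mono (by fun_prop) (((integrable_const 1).add hZ').const_mul δ) (fun _ => abs_nonneg _) ly'
  have i2 : Integrable (fun a => y a ^ 2) μ :=
    mono (by fun_prop) (hZ.const_mul (δ ^ 2)) (fun _ => sq_nonneg _) sq1
  have i2' : Integrable (fun a => y a ^ 2) μ' :=
    mono (by fun_prop) (hZ'.const_mul (δ ^ 2)) (fun _ => sq_nonneg _) sq2
  have b1 : ∫ a, |y a| ∂μ ≤ δ * (1 + A) := by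
    calc ∫ a, |y a| ∂μ ≤ ∫ a, δ * (1 + Z a ^ 2) ∂μ :=
          integral_mono i1 (((integrable_const 1).add hZ).const_mul δ) ly
      _ = δ * (1 + ∫ a, Z a ^ 2 ∂μ) := by
          rw [integral_const_mul, integral_add (integrable_const _) hZ]; simp
      _ ≤ _ := by gcongr
  have b1' : ∫ a, |y a| ∂μ' ≤ δ * (1 + A) := by
    calc ∫ a, |y a| ∂μ' ≤ ∫ a, δ * (1 + Z' a ^ 2) ∂μ' :=
          integral_mono i1' (((integrable_const 1).add hZ').const_mul δ) ly'
      _ = δ * (1 + ∫ a, Z' a ^ 2 ∂μ') := by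
          rw [integral_const_mul, integral_add (integrable_const _) hZ']; simp
      _ ≤ _ := by gcongr
  have b2 : ∫ a, y a ^ 2 ∂μ ≤ δ ^ 2 * A := by
    calc ∫ a, y a ^ 2 ∂μ ≤ ∫ a, δ ^ 2 * Z a ^ 2 ∂μ := integral_mono i2 (hZ.const_mul _) sq1
      _ ≤ δ ^ 2 * A := by rw [integral_const_mul]; gcongr
  have b2' : ∫ a, y a ^ 2 ∂μ' ≤ δ ^ 2 * A := by
    calc ∫ a, y a ^ 2 ∂μ' ≤ ∫ a, δ ^ 2 * Z' a ^ 2 ∂μ' := integral_mono i2' (hZ'.const_mul _) sq2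
      _ ≤ δ ^ 2 * A := by rw [integral_const_mul]; gcongr
  have j1 := hint.1 i1'
  have j2 := hint.1 i2'
  rw [htr] at b1' b2'
  have iq : Integrable q μ :=
    Integrable.of_bound hq.aestronglyMeasurable K (ae_of_all _ hqK)
  have ieq : Integrable (fun a => Real.exp (y a) * q a) μ :=
    hint.1 (Integrable.of_bound hq.aestronglyMeasurable K (ae_of_all _ hqK))
  have iX : Integrable X μ := by
    refine (i1.add (integrable_const (C * δ ^ 2))).mono' hX.aestronglyMeasurable
      (ae_of_all _ fun a => ?_)
    have := hyX a
    rw [Real.norm_eq_abs]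
    simp only [Pi.add_apply]
    calc |X a| = |y a - (y a - X a)| := by congr 1; ring
      _ ≤ |y a| + |y a - X a| := abs_sub _ _
      _ ≤ _ := by gcongr
  have iqX : Integrable (fun a => q a * X a) μ :=
    iX.bdd_mul hq.aestronglyMeasurable (c := K) (ae_of_all _ hqK)
  constructor
  · rw [htr, ← integral_sub ieq iq, ← Real.norm_eq_abs]
    calc _ ≤ ∫ a, K * (|y a| + Real.exp (y a) * |y a|) ∂μ := by
          refine norm_integral_le_of_norm_le ((i1.add j1).const_mul K) (ae_of_all _ fun a => ?_)
          rw [show Real.exp (y a) * q a - q a = q a * (Real.exp (y a) - 1) by ring, norm_mul,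
            Real.norm_eq_abs, Real.norm_eq_abs]
          have := abs_exp_sub_one_le (y a)
          calc _ ≤ K * (|y a| * (1 + Real.exp (y a))) :=
                mul_le_mul (hqK a) this (abs_nonneg _) hK
            _ = _ := by ring
      _ = K * (∫ a, |y a| ∂μ + ∫ a, Real.exp (y a) * |y a| ∂μ) := by
          rw [integral_const_mul, integral_add i1 j1]
      _ ≤ K * (δ * (1 + A) + δ * (1 + A)) := by gcongr
      _ = _ := by ring
  · have iqs : Integrable (fun a => Real.exp (y a) * q a - q a) μ := ieq.sub iq
    have i3 : Integrable (fun a => y a ^ 2 + Real.exp (y a) * y a ^ 2) μ := i2.add j2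
    rw [htr, ← integral_sub ieq iq, ← integral_sub iqs iqX, ← Real.norm_eq_abs]
    calc _ ≤ ∫ a, K * (y a ^ 2 + Real.exp (y a) * y a ^ 2 + C * δ ^ 2) ∂μ := by
          refine norm_integral_le_of_norm_le
            (((i2.add j2).add (integrable_const _)).const_mul K) (ae_of_all _ fun a => ?_)
          rw [show Real.exp (y a) * q a - q a - q a * X a
            = q a * ((Real.exp (y a) - 1 - y a) + (y a - X a)) by ring, norm_mul,
            Real.norm_eq_abs, Real.norm_eq_abs]
          have := abs_exp_sub_one_sub_le (y a)
          calc _ ≤ K * (y a ^ 2 * (1 + Real.exp (y a)) + C * δ ^ 2) :=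
                mul_le_mul (hqK a) ((abs_add_le _ _).trans (add_le_add this (hyX a)))
                  (abs_nonneg _) hK
            _ = _ := by ring
      _ = K * (∫ a, y a ^ 2 ∂μ + ∫ a, Real.exp (y a) * y a ^ 2 ∂μ + C * δ ^ 2) := by
          rw [integral_const_mul, integral_add i3 (integrable_const _),
            integral_add i2 j2]; simp
      _ ≤ K * (δ ^ 2 * A + δ ^ 2 * A + C * δ ^ 2) := by gcongr
      _ = _ := by ring

/-- On a box the integral of the product density factorizes because coordinates are independent
under the product measure, and boxes determine the measure. -/
lemma pi_withDensity {ι : Type*} [Fintype ι] {β : ι → Type*} [∀ i, MeasurableSpace (β i)]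
    {μ μ' : ∀ i, Measure (β i)} [∀ i, IsProbabilityMeasure (μ i)]
    [∀ i, IsProbabilityMeasure (μ' i)] {ρ : ∀ i, β i → ENNReal} (hρ : ∀ i, Measurable (ρ i))
    (h : ∀ i, μ' i = (μ i).withDensity (ρ i)) :
    Measure.pi μ' = (Measure.pi μ).withDensity fun a => ∏ i, ρ i (a i) := by
  refine Measure.pi_eq fun s hs => ?_
  have hm : ∀ i, Measurable ((s i).indicator (ρ i)) := fun i => (hρ i).indicator (hs i)
  rw [withDensity_apply _ (MeasurableSet.univ_pi hs),
    ← lintegral_indicator (MeasurableSet.univ_pi hs)]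
  have e : ∀ a, (Set.univ.pi s).indicator (fun a => ∏ i, ρ i (a i)) a
      = ∏ i, (s i).indicator (ρ i) (a i) := by
    intro a
    by_cases ha : a ∈ Set.univ.pi s
    · rw [Set.indicator_of_mem ha]
      exact Finset.prod_congr rfl fun i _ => (Set.indicator_of_mem (ha i trivial) _).symm
    · rw [Set.indicator_of_notMem ha]
      simp only [Set.mem_univ_pi, not_forall] at ha
      obtain ⟨i, hi⟩ := ha
      exact (Finset.prod_eq_zero (Finset.mem_univ i) (Set.indicator_of_notMem hi _)).symm
  simp_rw [e]
  rw [lintegral_prod_eq_prod_lintegral_of_indepFun Finset.univ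
    (fun i (a : ∀ i, β i) => (s i).indicator (ρ i) (a i))
    (iIndepFun_pi fun i => (hm i).aemeasurable) fun i => (hm i).comp (measurable_pi_apply i)]
  refine Finset.prod_congr rfl fun i _ => ?_
  rw [(measurePreserving_eval μ i).lintegral_comp (hm i), lintegral_indicator (hs i),
    h i, withDensity_apply _ (hs i)]

end Density
end


noncomputable section

/-! ### Scores and first order expansion of the joint policy -/

section Score

variable {ι S A : Type*} [Fintype ι] [MeasurableSpace S] [MeasurableSpace A] {M : ι → ℕ}
  {ν : Measure A}

lemma Param.norm_le_sum (x : Param M) : ‖x‖ ≤ ∑ i, ‖x i‖ := by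
  refine le_of_sq_le_sq ?_ (Finset.sum_nonneg fun i _ => norm_nonneg _)
  rw [PiLp.norm_sq_eq_of_L2]
  exact Finset.sum_sq_le_sq_sum_of_nonneg fun i _ => norm_nonneg _

lemma Param.norm_apply_le (x : Param M) (i : ι) : ‖x i‖ ≤ ‖x‖ := PiLp.norm_apply_le x i

/-- The full gradient `∇ log π_{n,θ}(a | s)` in the joint parameter. -/
def ParamPolicy.gradLog (π : ParamPolicy ι S A M ν) (n : ι) (θ : Param M) (s : S) (a : A) :
    Param M :=
  gradient (fun θ' => Real.log (π.density n θ' s a)) θ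

lemma ParamPolicy.differentiable_log (π : ParamPolicy ι S A M ν) (n : ι) (s : S) (a : A) :
    Differentiable ℝ (fun θ => Real.log (π.density n θ s a)) :=
  (π.differentiable_density n s a).log fun θ => (π.density_pos n θ s a).ne'

/-- Directional derivatives are pointwise limits of difference quotients, which inherit joint
measurability from the density; the gradient is then recovered from its components in an orthonormal
basis. -/
lemma ParamPolicy.measurable_gradLog (π : ParamPolicy ι S A M ν) (n : ι) :
    Measurable (fun x : (Param M × S) × A => π.gradLog n x.1.1 x.1.2 x.2) := by
  have hin : ∀ v : Param M, Measurable
      (fun x : (Param M × S) × A => inner ℝ v (π.gradLog n x.1.1 x.1.2 x.2)) := by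
    intro v
    refine measurable_of_tendsto_metrizable (f := fun (k : ℕ) (x : (Param M × S) × A) =>
      ((k : ℝ) + 1) * (Real.log (π.density n (x.1.1 + ((k : ℝ) + 1)⁻¹ • v) x.1.2 x.2)
        - Real.log (π.density n x.1.1 x.1.2 x.2))) (fun k => ?_) ?_
    · have h1 := (π.measurable_density n).comp
        (g := fun x : (Param M × S) × A => π.density n x.1.1 x.1.2 x.2)
        (f := fun x : (Param M × S) × A => ((x.1.1 + ((k : ℝ) + 1)⁻¹ • v, x.1.2), x.2))
        (by fun_prop)
      exact measurable_const.mul ((Real.measurable_log.comp h1).sub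
        (Real.measurable_log.comp (π.measurable_density n)))
    · rw [tendsto_pi_nhds]
      intro x
      have h := (π.differentiable_log n x.1.2 x.2).hasFDerivAt_gradient x.1.1
      have h2 := h.lim_real v
      rw [InnerProductSpace.toDual_apply_apply, real_inner_comm] at h2
      have h3 : Tendsto (fun k : ℕ => (k : ℝ) + 1) atTop atTop :=
        tendsto_atTop_add_const_right _ _ tendsto_natCast_atTop_atTop
      exact h2.comp h3
  have hrepr : (fun x : (Param M × S) × A => π.gradLog n x.1.1 x.1.2 x.2) = fun x =>
      ∑ k, (inner ℝ (stdOrthonormalBasis ℝ (Param M) k) (π.gradLog n x.1.1 x.1.2 x.2))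
        • stdOrthonormalBasis ℝ (Param M) k := by
    funext x
    exact ((stdOrthonormalBasis ℝ (Param M)).sum_repr' _).symm
  rw [hrepr]
  exact Finset.measurable_sum _ fun k _ => (hin _).smul_const _

lemma ParamPolicy.measurable_gradLog_right (π : ParamPolicy ι S A M ν) (n : ι) (θ : Param M)
    (s : S) : Measurable fun a => π.gradLog n θ s a :=
  (π.measurable_gradLog n).comp (measurable_prodMk_left (x := (θ, s)))

lemma ParamPolicy.measurable_density_right (π : ParamPolicy ι S A M ν) (n : ι) (θ : Param M)
    (s : S) : Measurable (π.density n θ s) :=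
  (π.measurable_density n).comp (measurable_prodMk_left (x := (θ, s)))

variable [SigmaFinite ν] {π : ParamPolicy ι S A M ν} {B V L : ℝ}

lemma ScoreAssumption.norm_gradLog_sub_le (h : ScoreAssumption π B V L) (n : ι) (θ₁ θ₂ : Param M)
    (s : S) (a : A) :
    ‖π.gradLog n θ₁ s a - π.gradLog n θ₂ s a‖ ≤ Fintype.card ι * L * ‖θ₁ - θ₂‖ := by
  refine (Param.norm_le_sum _).trans ?_
  calc ∑ i, ‖(π.gradLog n θ₁ s a - π.gradLog n θ₂ s a) i‖ ≤ ∑ _i : ι, L * ‖θ₁ - θ₂‖ :=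
        Finset.sum_le_sum fun i _ => h.lipschitz i n θ₁ θ₂ s a
    _ = _ := by simp [mul_assoc]

lemma ScoreAssumption.lintegral_gradLog_sq_le (h : ScoreAssumption π B V L) (n : ι)
    (θ : Param M) (s : S) :
    ∫⁻ a, ‖π.gradLog n θ s a‖ₑ ^ 2 ∂(π.policy n (θ, s))
      ≤ ENNReal.ofReal (Fintype.card ι * V ^ 2) := by
  have hm : Measurable fun a => π.gradLog n θ s a :=
    (π.measurable_gradLog n).comp (measurable_prodMk_left (x := (θ, s)))
  have e : ∀ x : Param M, ‖x‖ₑ ^ 2 = ∑ i, ‖x i‖ₑ ^ 2 := by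
    intro x
    simp only [← ofReal_norm]
    rw [← ENNReal.ofReal_pow (norm_nonneg _), PiLp.norm_sq_eq_of_L2,
      ENNReal.ofReal_sum_of_nonneg fun i _ => by positivity]
    exact Finset.sum_congr rfl fun i _ => ENNReal.ofReal_pow (norm_nonneg _) _
  simp_rw [e]
  rw [lintegral_finsetSum]
  · calc _ ≤ ∑ _i : ι, ENNReal.ofReal (V ^ 2) :=
          Finset.sum_le_sum fun i _ => h.second_moment i n θ s
      _ = _ := by
          rw [Finset.sum_const, nsmul_eq_mul, Finset.card_univ, ENNReal.ofReal_mul (by positivity),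
            ENNReal.ofReal_natCast]
  · intro i _
    have : Measurable fun x : Param M => x i := by fun_prop
    exact (this.comp hm).enorm.pow_const 2

lemma ParamPolicy.policy_apply (π : ParamPolicy ι S A M ν) (n : ι) (θ : Param M) (s : S) :
    π.policy n (θ, s) = ν.withDensity fun a => ENNReal.ofReal (π.density n θ s a) := by
  have h : Measurable (Function.uncurry
      (fun (x : Param M × S) a => ENNReal.ofReal (π.density n x.1 x.2 a))) :=
    (π.measurable_density n).ennreal_ofReal
  rw [ParamPolicy.policy, Kernel.withDensity_apply _ h, Kernel.const_apply]

/-- Positivity of the densities makes all policies mutually absolutely continuous. Writing the ratio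
as an exponential puts it in the shape required by `density_change` and turns products over the
agents into sums. -/
lemma ParamPolicy.policy_change (π : ParamPolicy ι S A M ν) (n : ι) (θ θ' : Param M) (s : S) :
    π.policy n (θ', s) = (π.policy n (θ, s)).withDensity fun a => ENNReal.ofReal
      (Real.exp (Real.log (π.density n θ' s a) - Real.log (π.density n θ s a))) := by
  have h1 := π.measurable_density_right n θ s
  have h2 := π.measurable_density_right n θ' s
  rw [π.policy_apply, π.policy_apply, ← withDensity_mul _ (by fun_prop) (by fun_prop)]
  congr 1
  funext a
  have p1 := π.density_pos n θ s a
  have p2 := π.density_pos n θ' s a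
  rw [Pi.mul_apply, ← ENNReal.ofReal_mul p1.le, Real.exp_sub, Real.exp_log p1, Real.exp_log p2]
  congr 1
  field_simp

lemma ParamPolicy.joint_apply (π : ParamPolicy ι S A M ν) (φ : ι → Param M) (s : S) :
    π.joint (φ, s) = Measure.pi fun n => π.policy n (φ n, s) := rfl

lemma ParamPolicy.joint_change (π : ParamPolicy ι S A M ν) (φ φ' : ι → Param M) (s : S) :
    π.joint (φ', s) = (π.joint (φ, s)).withDensity fun a => ENNReal.ofReal (Real.exp
      (∑ n, (Real.log (π.density n (φ' n) s (a n)) - Real.log (π.density n (φ n) s (a n))))) := by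
  rw [π.joint_apply, π.joint_apply, pi_withDensity
    (μ := fun n => π.policy n (φ n, s)) (μ' := fun n => π.policy n (φ' n, s))
    (ρ := fun n a => ENNReal.ofReal
      (Real.exp (Real.log (π.density n (φ' n) s a) - Real.log (π.density n (φ n) s a))))
    (fun n => ?_) fun n => π.policy_change n (φ n) (φ' n) s]
  · congr 1
    funext a
    rw [Real.exp_sum, ENNReal.ofReal_prod_of_nonneg fun n _ => (Real.exp_nonneg _)]
  · have h1 := π.measurable_density_right n (φ n) s
    have h2 := π.measurable_density_right n (φ' n) s
    fun_prop

lemma ParamPolicy.measurePreserving_joint_eval (π : ParamPolicy ι S A M ν) (φ : ι → Param M)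
    (s : S) (n : ι) :
    MeasurePreserving (Function.eval n) (π.joint (φ, s)) (π.policy n (φ n, s)) :=
  measurePreserving_eval (fun n => π.policy n (φ n, s)) n

lemma ScoreAssumption.lintegral_joint_gradLog_sq_le (h : ScoreAssumption π B V L) (n : ι)
    (φ : ι → Param M) (s : S) :
    ∫⁻ a, ‖π.gradLog n (φ n) s (a n)‖ₑ ^ 2 ∂(π.joint (φ, s))
      ≤ ENNReal.ofReal (Fintype.card ι * V ^ 2) := by
  have := (π.measurePreserving_joint_eval φ s n).lintegral_comp
    (f := fun a => ‖π.gradLog n (φ n) s a‖ₑ ^ 2)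
    ((π.measurable_gradLog_right n (φ n) s).enorm.pow_const 2)
  simp only [Function.eval] at this
  rw [this]
  exact h.lintegral_gradLog_sq_le n (φ n) s

lemma integrable_sq_of_lintegral_le {α E : Type*} [MeasurableSpace α] [NormedAddCommGroup E]
    [MeasurableSpace E] [OpensMeasurableSpace E] {μ : Measure α} {f : α → E}
    (hf : Measurable f) {C : ℝ} (hC : 0 ≤ C) (h : ∫⁻ a, ‖f a‖ₑ ^ 2 ∂μ ≤ ENNReal.ofReal C) :
    Integrable (fun a => ‖f a‖ ^ 2) μ ∧ ∫ a, ‖f a‖ ^ 2 ∂μ ≤ C := by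
  have e : ∀ a, ‖f a‖ₑ ^ 2 = ENNReal.ofReal (‖f a‖ ^ 2) := fun a => by
    rw [← ofReal_norm, ENNReal.ofReal_pow (norm_nonneg _)]
  simp_rw [e] at h
  have hm : Measurable fun a => ‖f a‖ ^ 2 := hf.norm.pow_const 2
  constructor
  · refine ⟨hm.aestronglyMeasurable, ?_⟩
    rw [hasFiniteIntegral_iff_ofReal (ae_of_all _ fun a => by positivity)]
    exact h.trans_lt ENNReal.ofReal_lt_top
  · rw [integral_eq_lintegral_of_nonneg_ae (ae_of_all _ fun a => by positivity)
      hm.aestronglyMeasurable]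
    exact ENNReal.toReal_le_of_le_ofReal hC h

lemma ScoreAssumption.integrable_joint_gradLog_sq (h : ScoreAssumption π B V L) (n : ι)
    (φ : ι → Param M) (s : S) :
    Integrable (fun a => ‖π.gradLog n (φ n) s (a n)‖ ^ 2) (π.joint (φ, s)) ∧
      ∫ a, ‖π.gradLog n (φ n) s (a n)‖ ^ 2 ∂(π.joint (φ, s)) ≤ Fintype.card ι * V ^ 2 :=
  integrable_sq_of_lintegral_le
    ((π.measurable_gradLog_right n (φ n) s).comp (measurable_pi_apply n)) (by positivity)
    (h.lintegral_joint_gradLog_sq_le n φ s)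

/-- Second moment of `∑ n, ‖∇ log π_n‖ + D` under the joint policy. -/
lemma ScoreAssumption.integrable_joint_sum_sq (h : ScoreAssumption π B V L)
    (φ : ι → Param M) (s : S) (D : ℝ) :
    Integrable (fun a => (∑ n, ‖π.gradLog n (φ n) s (a n)‖ + D) ^ 2) (π.joint (φ, s)) ∧
      ∫ a, (∑ n, ‖π.gradLog n (φ n) s (a n)‖ + D) ^ 2 ∂(π.joint (φ, s))
        ≤ 2 * (Fintype.card ι ^ 3 * V ^ 2 + D ^ 2) := by
  have hm : Measurable fun a : ι → A => ∑ n, ‖π.gradLog n (φ n) s (a n)‖ + D :=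
    (Finset.measurable_sum _ fun n _ => ((π.measurable_gradLog_right n (φ n) s).comp
      (measurable_pi_apply n)).norm).add_const _
  have hb : ∀ a : ι → A, (∑ n, ‖π.gradLog n (φ n) s (a n)‖ + D) ^ 2
      ≤ 2 * (Fintype.card ι * ∑ n, ‖π.gradLog n (φ n) s (a n)‖ ^ 2 + D ^ 2) := by
    intro a
    have h1 := sq_sum_le_card_mul_sum_sq (s := Finset.univ)
      (f := fun n => ‖π.gradLog n (φ n) s (a n)‖)
    rw [Finset.card_univ] at h1
    nlinarith [sq_nonneg (∑ n, ‖π.gradLog n (φ n) s (a n)‖ - D)]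
  have hi : Integrable (fun a => 2 * (Fintype.card ι * ∑ n, ‖π.gradLog n (φ n) s (a n)‖ ^ 2
      + D ^ 2)) (π.joint (φ, s)) :=
    (((integrable_finsetSum _ fun n _ => (h.integrable_joint_gradLog_sq n φ s).1).const_mul
      _).add (integrable_const _)).const_mul _
  refine ⟨hi.mono' (hm.pow_const 2).aestronglyMeasurable (ae_of_all _ fun a => ?_), ?_⟩
  · rw [Real.norm_of_nonneg (sq_nonneg _)]; exact hb a
  · refine (integral_mono_of_nonneg (ae_of_all _ fun a => sq_nonneg _) hi
      (ae_of_all _ hb)).trans ?_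
    rw [integral_const_mul, integral_add ((integrable_finsetSum _ fun n _ =>
      (h.integrable_joint_gradLog_sq n φ s).1).const_mul _) (integrable_const _),
      integral_const_mul, integral_finsetSum _ fun n _ => (h.integrable_joint_gradLog_sq n φ s).1]
    have : ∑ n, ∫ a, ‖π.gradLog n (φ n) s (a n)‖ ^ 2 ∂(π.joint (φ, s))
        ≤ ∑ _n : ι, Fintype.card ι * V ^ 2 :=
      Finset.sum_le_sum fun n _ => (h.integrable_joint_gradLog_sq n φ s).2
    rw [Finset.sum_const, Finset.card_univ, nsmul_eq_mul] at this
    simp only [integral_const, probReal_univ, smul_eq_mul, one_mul]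
    calc _ ≤ 2 * ((Fintype.card ι : ℝ) * (Fintype.card ι * (Fintype.card ι * V ^ 2)) + D ^ 2) := by
          gcongr
      _ = _ := by ring

/-- This is `density_change` for the product policies. The log-density ratio is a sum of log
differences, each linear in `φ' - φ` up to a quadratic remainder, and it is dominated by `δ` times a
sum of gradient norms whose second moment is bounded uniformly in parameter and state. Only
boundedness of `q` enters, so the constant serves for all states and all test functions. -/
theorem ScoreAssumption.joint_expansion (h : ScoreAssumption π B V L) (hL : 0 ≤ L) :
    ∃ C : ℝ, 0 ≤ C ∧ ∀ φ φ' : ι → Param M, ‖φ' - φ‖ ≤ 1 → ∀ (s : S) (q : (ι → A) → ℝ),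
      Measurable q → ∀ K : ℝ, 0 ≤ K → (∀ a, |q a| ≤ K) →
      |∫ a, q a ∂(π.joint (φ', s)) - ∫ a, q a ∂(π.joint (φ, s))| ≤ K * C * ‖φ' - φ‖ ∧
      |∫ a, q a ∂(π.joint (φ', s)) - ∫ a, q a ∂(π.joint (φ, s))
        - ∫ a, q a * ∑ n, inner ℝ (π.gradLog n (φ n) s (a n)) (φ' n - φ n) ∂(π.joint (φ, s))|
        ≤ K * C * ‖φ' - φ‖ ^ 2 := by
  set N : ℝ := (Fintype.card ι : ℝ) with hN
  have hN0 : 0 ≤ N := by positivity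
  -- A full gradient has Lipschitz constant `N * L`, one `L` per block, and the remainders of `N`
  -- agents are summed.
  set D : ℝ := N * (N * L) with hD
  have hD0 : 0 ≤ D := by positivity
  set A₀ : ℝ := 2 * (N ^ 3 * V ^ 2 + D ^ 2) with hA₀
  have hA0 : 0 ≤ A₀ := by positivity
  refine ⟨2 * (1 + A₀) + D, by positivity, fun φ φ' hδ1 s q hq K hK hqK => ?_⟩
  set δ := ‖φ' - φ‖ with hδ
  have hδ0 : 0 ≤ δ := norm_nonneg _
  have hn : ∀ n, ‖φ' n - φ n‖ ≤ δ := fun n => norm_le_pi_norm (φ' - φ) n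
  have hrem : ∀ n a, |Real.log (π.density n (φ' n) s a) - Real.log (π.density n (φ n) s a)
      - inner ℝ (π.gradLog n (φ n) s a) (φ' n - φ n)| ≤ N * L * δ ^ 2 := fun n a => by
    refine (abs_sub_sub_inner_gradient_le (π.differentiable_log n s a)
      (C := N * L) (by positivity) (fun x y => h.norm_gradLog_sub_le n x y s a) _ _).trans ?_
    gcongr; exact hn n
  -- The same expansion based at `φ'`: the resulting dominating function involves gradients at `φ'`,
  -- whose moments are known under the policy at `φ'`.
  have hrem' : ∀ n a, |Real.log (π.density n (φ' n) s a) - Real.log (π.density n (φ n) s a)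
      - inner ℝ (π.gradLog n (φ' n) s a) (φ' n - φ n)| ≤ N * L * δ ^ 2 := fun n a => by
    have := (abs_sub_sub_inner_gradient_le (π.differentiable_log n s a)
      (C := N * L) (by positivity) (fun x y => h.norm_gradLog_sub_le n x y s a) (φ' n) (φ n))
    rw [norm_sub_rev] at this
    rw [abs_sub_comm] at this
    refine le_trans (le_of_eq ?_) (this.trans ?_)
    · congr 1
      rw [← neg_sub (φ' n) (φ n), inner_neg_right]
      simp only [ParamPolicy.gradLog]; ring
    · gcongr; exact hn n
  have hin : ∀ (g : Param M) n, |inner ℝ g (φ' n - φ n)| ≤ ‖g‖ * δ := fun g n =>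
    (abs_real_inner_le_norm _ _).trans (by gcongr; exact hn n)
  -- This is where the restriction to distance at most `1` is used: the quadratic remainder is
  -- absorbed into a linear bound.
  have hδ2 : δ ^ 2 ≤ δ := by nlinarith
  have hsum : ∀ (g : ι → Param M) (a : ι → A),
      (∀ n, |Real.log (π.density n (φ' n) s (a n)) - Real.log (π.density n (φ n) s (a n))
        - inner ℝ (g n) (φ' n - φ n)| ≤ N * L * δ ^ 2) →
      |∑ n, (Real.log (π.density n (φ' n) s (a n)) - Real.log (π.density n (φ n) s (a n)))|
        ≤ δ * (∑ n, ‖g n‖ + D) := by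
    intro g a hg
    refine (Finset.abs_sum_le_sum_abs _ _).trans ?_
    calc _ ≤ ∑ n, (‖g n‖ * δ + N * L * δ) := Finset.sum_le_sum fun n _ => by
          have h1 := hg n
          have h2 := hin (g n) n
          have h3 : N * L * δ ^ 2 ≤ N * L * δ := by gcongr
          rw [abs_le] at *
          constructor <;> linarith
      _ = _ := by
          rw [Finset.sum_add_distrib, ← Finset.sum_mul, Finset.sum_const, Finset.card_univ,
            nsmul_eq_mul]
          ring
  obtain ⟨e1, e2⟩ := density_change (μ := π.joint (φ, s)) (μ' := π.joint (φ', s))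
    (y := fun a => ∑ n, (Real.log (π.density n (φ' n) s (a n))
      - Real.log (π.density n (φ n) s (a n))))
    (X := fun a => ∑ n, inner ℝ (π.gradLog n (φ n) s (a n)) (φ' n - φ n))
    (Z := fun a => ∑ n, ‖π.gradLog n (φ n) s (a n)‖ + D)
    (Z' := fun a => ∑ n, ‖π.gradLog n (φ' n) s (a n)‖ + D) (A := A₀) (C := D) (δ := δ)
    (Finset.measurable_sum _ fun n _ => by
      have h1 := π.measurable_density_right n (φ n) s
      have h2 := π.measurable_density_right n (φ' n) s
      fun_prop)
    (Finset.measurable_sum _ fun n _ => by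
      have h1 := π.measurable_gradLog_right n (φ n) s
      fun_prop)
    (π.joint_change φ φ' s) hδ0
    (fun a => by
      rw [← Finset.sum_sub_distrib]
      refine (Finset.abs_sum_le_sum_abs _ _).trans ?_
      calc _ ≤ ∑ _n : ι, N * L * δ ^ 2 := Finset.sum_le_sum fun n _ => hrem n (a n)
        _ = _ := by
          rw [Finset.sum_const, Finset.card_univ, nsmul_eq_mul]; ring)
    (fun a => hsum _ a fun n => hrem n (a n)) (fun a => hsum _ a fun n => hrem' n (a n))
    (h.integrable_joint_sum_sq φ s D).1 (h.integrable_joint_sum_sq φ' s D).1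
    (h.integrable_joint_sum_sq φ s D).2 (h.integrable_joint_sum_sq φ' s D).2 hq hK hqK
  refine ⟨e1.trans ?_, e2.trans ?_⟩
  · gcongr; linarith
  · gcongr; linarith

/-- The scores have mean zero. -/
theorem ScoreAssumption.integral_joint_gradLog_eq_zero (h : ScoreAssumption π B V L) (hL : 0 ≤ L)
    (φ : ι → Param M) (s : S) (v : ι → Param M) :
    ∫ a, ∑ n, inner ℝ (π.gradLog n (φ n) s (a n)) (v n) ∂(π.joint (φ, s)) = 0 := by
  obtain ⟨C, hC, hexp⟩ := h.joint_expansion hL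
  set I := ∫ a, ∑ n, inner ℝ (π.gradLog n (φ n) s (a n)) (v n) ∂(π.joint (φ, s)) with hI
  -- For the test function `1` both integrals equal `1`, so the linear term `t * I` must itself be
  -- of order `t ^ 2`.
  have key : ∀ t : ℝ, 0 < t → t * ‖v‖ ≤ 1 → |I| ≤ C * ‖v‖ ^ 2 * t := by
    intro t ht htv
    have hd : φ + t • v - φ = t • v := by abel
    have hn : ‖t • v‖ = t * ‖v‖ := by rw [norm_smul, Real.norm_of_nonneg ht.le]
    have := (hexp φ (φ + t • v) (by rw [hd, hn]; exact htv) s (fun _ => 1) measurable_const 1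
      zero_le_one (by simp)).2
    simp only [integral_const, probReal_univ, smul_eq_mul, mul_one, sub_self, zero_sub, abs_neg,
      one_mul, Pi.add_apply, add_sub_cancel_left, Pi.smul_apply, inner_smul_right,
      ← Finset.mul_sum] at this
    rw [hn, integral_const_mul, ← hI, abs_mul, abs_of_pos ht] at this
    have h2 : t * |I| ≤ t * (C * ‖v‖ ^ 2 * t) := by linarith
    exact le_of_mul_le_mul_left h2 ht
  have hlim : Tendsto (fun t : ℝ => C * ‖v‖ ^ 2 * t) (𝓝[>] 0) (𝓝 0) := by
    have : Tendsto (fun t : ℝ => C * ‖v‖ ^ 2 * t) (𝓝 0) (𝓝 (C * ‖v‖ ^ 2 * 0)) :=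
      (continuous_const.mul continuous_id).tendsto 0
    rw [mul_zero] at this
    exact this.mono_left nhdsWithin_le_nhds
  have hev : ∀ᶠ t : ℝ in 𝓝[>] 0, |I| ≤ C * ‖v‖ ^ 2 * t := by
    have h1 : ∀ᶠ t : ℝ in 𝓝[>] 0, t * ‖v‖ < 1 := by
      have : Tendsto (fun t : ℝ => t * ‖v‖) (𝓝 0) (𝓝 (0 * ‖v‖)) :=
        (continuous_id.mul continuous_const).tendsto 0
      rw [zero_mul] at this
      exact nhdsWithin_le_nhds (this.eventually_lt_const one_pos)
    filter_upwards [h1, self_mem_nhdsWithin] with t ht1 ht0 using key t ht0 ht1.le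
  exact abs_nonpos_iff.1 (ge_of_tendsto hlim hev)

end Score
end


noncomputable section

/-! ### Markov chains and discounted values -/

section MarkovChain

variable {Z X : Type*} [MeasurableSpace Z] [MeasurableSpace X]

/-- Under `ρ`, the process is a Markov chain with transition kernel `K`. -/
def IsMarkovChain (K : Kernel X X) (ρ : Measure (ℕ → X)) : Prop :=
  ∀ m : ℕ, ρ.map (fun x => (Preorder.frestrictLe m x, x (m + 1))) =
    (ρ.map (Preorder.frestrictLe (π := fun _ : ℕ => X) m)) ⊗ₘ
      K.comap (fun h : Finset.Iic m → X => h ⟨m, Finset.mem_Iic.2 le_rfl⟩)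
        (measurable_pi_apply _)

/-- In this form the condition is linear in `ρ` and free of product measures, so that it passes
easily to mixtures of starting points and to projections. -/
lemma isMarkovChain_iff_lintegral {K : Kernel X X} [IsMarkovKernel K] {ρ : Measure (ℕ → X)}
    [IsProbabilityMeasure ρ] :
    IsMarkovChain K ρ ↔ ∀ (m : ℕ) (G : (Finset.Iic m → X) × X → ENNReal), Measurable G →
      ∫⁻ x, G (Preorder.frestrictLe m x, x (m + 1)) ∂ρ
        = ∫⁻ x, ∫⁻ y, G (Preorder.frestrictLe m x, y) ∂(K (x m)) ∂ρ := by
  have h1 : ∀ (m : ℕ), Measurable fun x : ℕ → X => (Preorder.frestrictLe m x, x (m + 1)) := by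
    intro m; fun_prop
  have h2 : ∀ (m : ℕ), Measurable (Preorder.frestrictLe (π := fun _ : ℕ => X) m) := by
    intro m; fun_prop
  have key : ∀ (m : ℕ) (G : (Finset.Iic m → X) × X → ENNReal), Measurable G →
      ∫⁻ p, G p ∂((ρ.map (Preorder.frestrictLe (π := fun _ : ℕ => X) m)) ⊗ₘ
        K.comap (fun h : Finset.Iic m → X => h ⟨m, Finset.mem_Iic.2 le_rfl⟩)
        (measurable_pi_apply _)) = ∫⁻ x, ∫⁻ y, G (Preorder.frestrictLe m x, y) ∂(K (x m)) ∂ρ := by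
    intro m G hG
    rw [Measure.lintegral_compProd hG, lintegral_map _ (h2 m)]
    · rfl
    · exact hG.lintegral_kernel_prod_right'
  constructor
  · intro h m G hG
    rw [← key m G hG, ← h m, lintegral_map hG (h1 m)]
  · intro h m
    refine Measure.ext_of_lintegral _ fun G hG => ?_
    rw [key m G hG, lintegral_map hG (h1 m)]
    exact h m G hG

lemma chainLaw_isMarkovChain (K : Kernel Z Z) [IsMarkovKernel K] (z : Z) :
    IsMarkovChain K (chainLaw K z) := by
  intro m
  have h := Kernel.partialTraj_compProd_eq_map_traj (X := fun _ => Z)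
    (κ := fun n => K.comap (fun h : Finset.Iic n → Z => h ⟨n, Finset.mem_Iic.2 le_rfl⟩)
      (measurable_pi_apply _)) (Nat.zero_le m) (x₀ := fun _ => z)
  rw [← Kernel.traj_map_frestrictLe_apply] at h
  exact h.symm

instance (K : Kernel Z Z) [IsMarkovKernel K] : IsMarkovKernel (chainLaw K) := by
  unfold chainLaw; infer_instance

lemma chainLaw_map_zero (K : Kernel Z Z) [IsMarkovKernel K] (z : Z) :
    (chainLaw K z).map (fun x => x 0) = Measure.dirac z := by
  have h := Kernel.traj_map_frestrictLe_apply (X := fun _ => Z)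
    (κ := fun n => K.comap (fun h : Finset.Iic n → Z => h ⟨n, Finset.mem_Iic.2 le_rfl⟩)
      (measurable_pi_apply _)) 0 0 (fun _ => z)
  rw [Kernel.partialTraj_self, Kernel.id_apply] at h
  have e : (fun x : ℕ → Z => x 0) = (fun h : Finset.Iic 0 → Z => h ⟨0, Finset.mem_Iic.2 le_rfl⟩) ∘
      Preorder.frestrictLe (π := fun _ : ℕ => Z) 0 := rfl
  rw [e, ← Measure.map_map (by fun_prop) (by fun_prop)]
  change Measure.map _ (Measure.map (Preorder.frestrictLe (π := fun _ : ℕ => Z) 0)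
    ((Kernel.traj (X := fun _ => Z) _ 0) fun _ => z)) = _
  rw [h, Measure.map_dirac' (by fun_prop)]

lemma IsMarkovChain.bind {K : Kernel X X} [IsMarkovKernel K] {κ : Kernel Z (ℕ → X)}
    [IsMarkovKernel κ] {μ : Measure Z} [IsProbabilityMeasure μ]
    (h : ∀ z, IsMarkovChain K (κ z)) : IsMarkovChain K (κ ∘ₘ μ) := by
  rw [isMarkovChain_iff_lintegral]
  intro m G hG
  rw [Measure.lintegral_bind κ.measurable.aemeasurable,
    Measure.lintegral_bind κ.measurable.aemeasurable]
  · exact lintegral_congr fun z => isMarkovChain_iff_lintegral.1 (h z) m G hG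
  · have h1 : Measurable fun p : (ℕ → X) × X => G (Preorder.frestrictLe m p.1, p.2) :=
      hG.comp (by fun_prop)
    exact (Measurable.lintegral_kernel_prod_right'
      (κ := K.comap (fun x : ℕ → X => x m) (measurable_pi_apply _)) h1).aemeasurable
  · exact (hG.comp (by fun_prop)).aemeasurable

/-- A chain on `Z` whose first component is frozen projects to a chain on `X`. -/
lemma IsMarkovChain.map_snd {Φ : Type*} [MeasurableSpace Φ] [MeasurableSingletonClass Φ]
    {K : Kernel (Φ × X) (Φ × X)} [IsMarkovKernel K] {φ : Φ} {Kφ : Kernel X X} [IsMarkovKernel Kφ]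
    (hK : ∀ x, K (φ, x) = (Kφ x).map (Prod.mk φ)) {ρ : Measure (ℕ → Φ × X)}
    [IsProbabilityMeasure ρ] (h : IsMarkovChain K ρ) (h0 : ∀ᵐ z ∂ρ, (z 0).1 = φ) :
    IsMarkovChain Kφ (ρ.map fun z t => (z t).2) := by
  have hms : Measurable fun (z : ℕ → Φ × X) t => (z t).2 := by fun_prop
  have : IsProbabilityMeasure (ρ.map fun (z : ℕ → Φ × X) t => (z t).2) :=
    Measure.isProbabilityMeasure_map hms.aemeasurable
  rw [isMarkovChain_iff_lintegral] at h ⊢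
  -- The frozen component stays at `φ` almost surely, by induction on time, since from `(φ, x)` the
  -- kernel charges only points over `φ`.
  have hfix : ∀ m, ∀ᵐ z ∂ρ, (z m).1 = φ := by
    intro m
    induction m with
    | zero => exact h0
    | succ m ih =>
      have hs : MeasurableSet {p : Φ × X | p.1 ≠ φ} :=
        (measurable_fst (measurableSet_singleton φ)).compl
      have e := h m (fun p => Set.indicator {p : Φ × X | p.1 ≠ φ} 1 p.2)
        ((measurable_one.indicator hs).comp measurable_snd)
      have e2 : ∫⁻ z, ∫⁻ y, Set.indicator {p : Φ × X | p.1 ≠ φ} 1 y ∂(K (z m)) ∂ρ = 0 := by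
        rw [lintegral_eq_zero_iff']
        · filter_upwards [ih] with z hz
          have : z m = (φ, (z m).2) := Prod.ext hz rfl
          rw [this, hK, lintegral_map (measurable_one.indicator hs) (by fun_prop)]
          simp
        · exact (((measurable_one.indicator hs).lintegral_kernel (κ := K)).comp
            (measurable_pi_apply m)).aemeasurable
      rw [e2, lintegral_eq_zero_iff' (by
        exact ((measurable_one.indicator hs).comp (measurable_pi_apply (m + 1))).aemeasurable)] at e
      filter_upwards [e] with z hz
      by_contra hne
      have : z (m + 1) ∈ {p : Φ × X | p.1 ≠ φ} := hne
      simp [Set.indicator_of_mem this] at hz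
  intro m G hG
  have hG1 : Measurable fun x : ℕ → X => G (Preorder.frestrictLe m x, x (m + 1)) :=
    hG.comp (by fun_prop)
  have hG2 : Measurable fun p : (ℕ → X) × X => G (Preorder.frestrictLe m p.1, p.2) :=
    hG.comp (by fun_prop)
  have hG4 : Measurable fun x : ℕ → X => ∫⁻ y, G (Preorder.frestrictLe m x, y) ∂(Kφ (x m)) :=
    Measurable.lintegral_kernel_prod_right'
      (κ := Kφ.comap (fun x : ℕ → X => x m) (measurable_pi_apply _)) hG2
  rw [lintegral_map hG1 hms, lintegral_map hG4 hms]
  have hG3 : Measurable fun p : (Finset.Iic m → Φ × X) × (Φ × X) => G (fun i => (p.1 i).2, p.2.2) :=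
    hG.comp (by fun_prop)
  refine (h m _ hG3).trans (lintegral_congr_ae ?_)
  filter_upwards [hfix m] with z hz
  have : z m = (φ, (z m).2) := Prod.ext hz rfl
  rw [this, hK, lintegral_map (by exact hG.comp (by fun_prop)) (by fun_prop)]
  rfl

lemma abs_integral_le_of_abs_le {α : Type*} [MeasurableSpace α] {μ : Measure α}
    [IsProbabilityMeasure μ] {g : α → ℝ} {C : ℝ} (h : ∀ x, |g x| ≤ C) : |∫ x, g x ∂μ| ≤ C := by
  have := norm_integral_le_of_norm_le_const (μ := μ) (f := g) (ae_of_all _ h)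
  simpa using this

/-- The mean of `g` after one step. -/
def stepMean (K : Kernel X X) (g : X → ℝ) (x : X) : ℝ := ∫ y, g y ∂(K x)

lemma measurable_stepMean {K : Kernel X X} {g : X → ℝ} (hg : Measurable g) :
    Measurable (stepMean K g) :=
  (hg.stronglyMeasurable.integral_kernel (κ := K)).measurable

variable {K : Kernel X X} [IsMarkovKernel K] {ρ : Measure (ℕ → X)} [IsProbabilityMeasure ρ]
  {E : Type*} [NormedAddCommGroup E] [NormedSpace ℝ E]
  [CompleteSpace E]

/-- Since `k ≤ m`, the factor `f (x k)` is a function of the history up to `m` and can be pulled out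
when conditioning on it. -/
lemma IsMarkovChain.integral_step (h : IsMarkovChain K ρ) {k m : ℕ} (hkm : k ≤ m)
    {g : X → ℝ} (hg : Measurable g) {C : ℝ} (hgC : ∀ x, |g x| ≤ C) {f : X → E}
    (hf : StronglyMeasurable f) (hfi : Integrable (fun x => f (x k)) ρ) :
    ∫ x, g (x (m + 1)) • f (x k) ∂ρ = ∫ x, (∫ y, g y ∂(K (x m))) • f (x k) ∂ρ := by
  set F : (Finset.Iic m → X) × X → E := fun p => g p.2 • f (p.1 ⟨k, Finset.mem_Iic.2 hkm⟩) with hF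
  have hFm : StronglyMeasurable F :=
    (hg.comp measurable_snd).stronglyMeasurable.smul
      (hf.comp_measurable ((measurable_pi_apply _).comp measurable_fst))
  have h1 : Measurable fun x : ℕ → X => (Preorder.frestrictLe m x, x (m + 1)) := by fun_prop
  have h2 : Measurable (Preorder.frestrictLe (π := fun _ : ℕ => X) m) := by fun_prop
  have hFi : Integrable F (ρ.map fun x => (Preorder.frestrictLe m x, x (m + 1))) := by
    rw [integrable_map_measure hFm.aestronglyMeasurable h1.aemeasurable]
    exact hfi.bdd_smul C (hg.comp (measurable_pi_apply (m + 1))).aestronglyMeasurable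
      (ae_of_all _ fun x => hgC _)
  calc ∫ x, g (x (m + 1)) • f (x k) ∂ρ
      = ∫ p, F p ∂(ρ.map fun x => (Preorder.frestrictLe m x, x (m + 1))) := by
        rw [integral_map h1.aemeasurable hFm.aestronglyMeasurable]; rfl
    _ = _ := by
        rw [h m] at hFi ⊢
        rw [Measure.integral_compProd hFi, integral_map h2.aemeasurable]
        · refine integral_congr_ae (ae_of_all _ fun x => ?_)
          simp only [hF]
          rw [integral_smul_const]
          rfl
        · exact (hFm.integral_kernel_prod_right').aestronglyMeasurable

lemma abs_stepMean_le {g : X → ℝ} {C : ℝ} (h : ∀ x, |g x| ≤ C) (x : X) : |stepMean K g x| ≤ C :=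
  abs_integral_le_of_abs_le h

/-- The expected discounted sum `∑ γ ^ t r(x_t)` along the chain, as a function of `x₀`. -/
def discountedValue (K : Kernel X X) (γ : ℝ) (r : X → ℝ) (x : X) : ℝ :=
  ∑' t : ℕ, γ ^ t * (stepMean K)^[t] r x

variable {γ : ℝ} {r : X → ℝ} {R : ℝ}

lemma iterate_stepMean (hr : Measurable r) (hR : ∀ x, |r x| ≤ R) (t : ℕ) :
    Measurable ((stepMean K)^[t] r) ∧ ∀ x, |(stepMean K)^[t] r x| ≤ R := by
  induction t with
  | zero => exact ⟨hr, hR⟩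
  | succ t ih =>
    rw [Function.iterate_succ_apply']
    exact ⟨measurable_stepMean ih.1, abs_stepMean_le ih.2⟩

lemma summable_discounted (hγ0 : 0 ≤ γ) (hγ1 : γ < 1) {a : ℕ → ℝ} (ha : ∀ t, |a t| ≤ R) :
    Summable fun t => γ ^ t * a t := by
  refine Summable.of_norm_bounded ((summable_geometric_of_lt_one hγ0 hγ1).mul_right R) fun t => ?_
  rw [norm_mul, Real.norm_of_nonneg (pow_nonneg hγ0 t)]
  exact mul_le_mul_of_nonneg_left (ha t) (pow_nonneg hγ0 t)

lemma abs_tsum_discounted_le (hγ0 : 0 ≤ γ) (hγ1 : γ < 1) {a : ℕ → ℝ} (ha : ∀ t, |a t| ≤ R) :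
    |∑' t, γ ^ t * a t| ≤ R / (1 - γ) := by
  have h1 := (hasSum_geometric_of_lt_one hγ0 hγ1).mul_right R
  rw [inv_mul_eq_div] at h1
  rw [← Real.norm_eq_abs]
  refine tsum_of_norm_bounded h1 fun t => ?_
  rw [norm_mul, Real.norm_of_nonneg (pow_nonneg hγ0 t)]
  exact mul_le_mul_of_nonneg_left (ha t) (pow_nonneg hγ0 t)

lemma measurable_tsum_discounted {α : Type*} [MeasurableSpace α] (hγ0 : 0 ≤ γ) (hγ1 : γ < 1)
    {a : ℕ → α → ℝ} (hm : ∀ t, Measurable (a t)) (ha : ∀ t x, |a t x| ≤ R) :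
    Measurable fun x => ∑' t, γ ^ t * a t x := by
  refine measurable_of_tendsto_metrizable
    (f := fun n x => ∑ t ∈ Finset.range n, γ ^ t * a t x)
    (fun n => Finset.measurable_sum _ fun t _ => (hm t).const_mul _) ?_
  rw [tendsto_pi_nhds]
  exact fun x => (summable_discounted hγ0 hγ1 fun t => ha t x).hasSum.tendsto_sum_nat

lemma measurable_discountedValue (hγ0 : 0 ≤ γ) (hγ1 : γ < 1) (hr : Measurable r)
    (hR : ∀ x, |r x| ≤ R) : Measurable (discountedValue K γ r) :=
  measurable_tsum_discounted hγ0 hγ1 (fun t => (iterate_stepMean hr hR t).1)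
    fun t => (iterate_stepMean hr hR t).2

lemma abs_discountedValue_le (hγ0 : 0 ≤ γ) (hγ1 : γ < 1) (hr : Measurable r)
    (hR : ∀ x, |r x| ≤ R) (x : X) : |discountedValue K γ r x| ≤ R / (1 - γ) :=
  abs_tsum_discounted_le hγ0 hγ1 fun t => (iterate_stepMean hr hR t).2 x

/-- The Bellman equation: split off the first term of the series and exchange the remaining sum with
the one-step mean by dominated convergence. -/
lemma discountedValue_eq (hγ0 : 0 ≤ γ) (hγ1 : γ < 1) (hr : Measurable r)
    (hR : ∀ x, |r x| ≤ R) (x : X) :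
    discountedValue K γ r x = r x + γ * stepMean K (discountedValue K γ r) x := by
  have hR0 : 0 ≤ R := (abs_nonneg _).trans (hR x)
  have h1 := (summable_discounted hγ0 hγ1
    fun t => (iterate_stepMean (K := K) hr hR t).2 x).tsum_eq_zero_add
  have h2 : HasSum (fun t => ∫ y, γ ^ t * (stepMean K)^[t] r y ∂(K x))
      (∫ y, ∑' t, γ ^ t * (stepMean K)^[t] r y ∂(K x)) := by
    refine hasSum_integral_of_dominated_convergence (fun t _ => γ ^ t * R)
      (fun t => ((iterate_stepMean hr hR t).1.const_mul _).aestronglyMeasurable)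
      (fun t => ae_of_all _ fun y => ?_)
      (ae_of_all _ fun y => (summable_geometric_of_lt_one hγ0 hγ1).mul_right R)
      (integrable_const _) (ae_of_all _ fun y => (summable_discounted hγ0 hγ1
        fun t => (iterate_stepMean hr hR t).2 y).hasSum)
    rw [norm_mul, Real.norm_of_nonneg (pow_nonneg hγ0 t)]
    exact mul_le_mul_of_nonneg_left ((iterate_stepMean hr hR t).2 y) (pow_nonneg hγ0 t)
  unfold discountedValue
  rw [h1]
  congr 1
  · rw [pow_zero, one_mul, Function.iterate_zero, id]
  · rw [stepMean, ← h2.tsum_eq, ← tsum_mul_left]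
    refine tsum_congr fun t => ?_
    rw [integral_const_mul, Function.iterate_succ_apply', pow_succ]
    change γ ^ t * γ * ∫ y, (stepMean K)^[t] r y ∂(K x) = _
    ring

/-- Rewards collected from time `k` on may be replaced by their conditional expectation given
`x_k`. -/
lemma IsMarkovChain.integral_discounted (h : IsMarkovChain K ρ) (hγ0 : 0 ≤ γ) (hγ1 : γ < 1)
    (hr : Measurable r) (hR : ∀ x, |r x| ≤ R) (k : ℕ) {f : X → E}
    (hf : StronglyMeasurable f) (hfi : Integrable (fun x => f (x k)) ρ) :
    ∫ x, (∑' t : ℕ, γ ^ t * r (x (k + t))) • f (x k) ∂ρ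
      = ∫ x, discountedValue K γ r (x k) • f (x k) ∂ρ := by
  set Q := discountedValue K γ r with hQ
  have hQm : Measurable Q := measurable_discountedValue hγ0 hγ1 hr hR
  have hQb : ∀ x, |Q x| ≤ R / (1 - γ) := abs_discountedValue_le hγ0 hγ1 hr hR
  have hint : ∀ {g : X → ℝ} {C : ℝ}, Measurable g → (∀ x, |g x| ≤ C) → ∀ m,
      Integrable (fun x : ℕ → X => g (x m) • f (x k)) ρ := fun hg hC m =>
    hfi.bdd_smul _ (hg.comp (measurable_pi_apply m)).aestronglyMeasurable
      (ae_of_all _ fun x => hC _)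
  -- By the Bellman equation each reward is a difference `Q - γ Q(next)` in conditional mean, so
  -- partial sums telescope. What remains is a boundary term with factor `γ ^ n`, and the limit `n →
  -- ∞` removes it.
  have hpart : ∀ n, ∫ x, (∑ t ∈ Finset.range n, γ ^ t * r (x (k + t))) • f (x k) ∂ρ
      = ∫ x, Q (x k) • f (x k) ∂ρ - γ ^ n • ∫ x, Q (x (k + n)) • f (x k) ∂ρ := by
    intro n
    induction n with
    | zero => simp
    | succ n ih =>
      have e : ∀ x : ℕ → X, (∑ t ∈ Finset.range (n + 1), γ ^ t * r (x (k + t))) • f (x k)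
          = (∑ t ∈ Finset.range n, γ ^ t * r (x (k + t))) • f (x k)
            + γ ^ n • r (x (k + n)) • f (x k) := fun x => by
        rw [Finset.sum_range_succ, add_smul, mul_smul]
      have i1 : Integrable (fun x : ℕ → X =>
          (∑ t ∈ Finset.range n, γ ^ t * r (x (k + t))) • f (x k)) ρ := by
        simp_rw [Finset.sum_smul, mul_smul]
        exact integrable_finsetSum _ fun t _ => (hint hr hR (k + t)).smul (γ ^ t)
      simp_rw [e]
      have i2 : Integrable (fun x : ℕ → X => γ ^ n • r (x (k + n)) • f (x k)) ρ :=
        (hint hr hR (k + n)).smul _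
      rw [integral_add i1 i2, integral_smul, ih]
      have e2 : ∫ x, r (x (k + n)) • f (x k) ∂ρ
          = ∫ x, Q (x (k + n)) • f (x k) ∂ρ - γ • ∫ x, Q (x (k + (n + 1))) • f (x k) ∂ρ := by
        have e3 := h.integral_step (Nat.le_add_right k n) hQm hQb hf hfi
        rw [← add_assoc, e3, ← integral_smul, ← integral_sub (hint hQm hQb _)]
        · refine integral_congr_ae (ae_of_all _ fun x => ?_)
          have e4 := discountedValue_eq (K := K) hγ0 hγ1 hr hR (x (k + n))
          rw [← hQ] at e4
          simp only [stepMean] at e4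
          simp only
          rw [← mul_smul, ← sub_smul]
          congr 1
          linarith
        · exact (hint (g := stepMean K Q) (measurable_stepMean hQm) (abs_stepMean_le hQb)
            (k + n)).smul γ
      rw [e2, smul_sub, ← mul_smul, ← pow_succ]
      abel
  have hsb : ∀ x : ℕ → X, Summable fun t => γ ^ t * r (x (k + t)) := fun x =>
    summable_discounted hγ0 hγ1 fun t => hR _
  have l1 : Tendsto (fun n => ∫ x, (∑ t ∈ Finset.range n, γ ^ t * r (x (k + t))) • f (x k) ∂ρ)
      atTop (𝓝 (∫ x, (∑' t : ℕ, γ ^ t * r (x (k + t))) • f (x k) ∂ρ)) := by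
    refine tendsto_integral_of_dominated_convergence (fun x => R / (1 - γ) * ‖f (x k)‖)
      (fun n => ?_) (hfi.norm.const_mul _) (fun n => ae_of_all _ fun x => ?_)
      (ae_of_all _ fun x => ((hsb x).hasSum.tendsto_sum_nat).smul_const _)
    · have : Measurable fun x : ℕ → X => ∑ t ∈ Finset.range n, γ ^ t * r (x (k + t)) := by fun_prop
      exact this.aestronglyMeasurable.smul hfi.aestronglyMeasurable
    · rw [norm_smul]
      gcongr
      rw [Real.norm_eq_abs]
      have hR0 : 0 ≤ R := (abs_nonneg _).trans (hR (x 0))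
      calc _ ≤ ∑ t ∈ Finset.range n, γ ^ t * R := by
            refine (Finset.abs_sum_le_sum_abs _ _).trans (Finset.sum_le_sum fun t _ => ?_)
            rw [abs_mul, abs_of_nonneg (pow_nonneg hγ0 t)]
            exact mul_le_mul_of_nonneg_left (hR _) (pow_nonneg hγ0 t)
        _ ≤ ∑' t : ℕ, γ ^ t * R := ((summable_geometric_of_lt_one hγ0 hγ1).mul_right R).sum_le_tsum
            _ fun t _ => mul_nonneg (pow_nonneg hγ0 t) hR0
        _ = R / (1 - γ) := by rw [tsum_mul_right, tsum_geometric_of_lt_one hγ0 hγ1, inv_mul_eq_div]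
  have l2 : Tendsto (fun n => ∫ x, (∑ t ∈ Finset.range n, γ ^ t * r (x (k + t))) • f (x k) ∂ρ)
      atTop (𝓝 (∫ x, Q (x k) • f (x k) ∂ρ)) := by
    simp_rw [hpart]
    have : Tendsto (fun n => γ ^ n • ∫ x, Q (x (k + n)) • f (x k) ∂ρ) atTop (𝓝 0) := by
      refine squeeze_zero_norm (a := fun n => γ ^ n * (R / (1 - γ) * ∫ x, ‖f (x k)‖ ∂ρ))
        (fun n => ?_) ?_
      · rw [norm_smul, Real.norm_of_nonneg (pow_nonneg hγ0 n), ← integral_const_mul]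
        refine mul_le_mul_of_nonneg_left (norm_integral_le_of_norm_le (hfi.norm.const_mul _)
          (ae_of_all _ fun x => ?_)) (pow_nonneg hγ0 n)
        rw [norm_smul]
        gcongr
        exact hQb _
      · simpa using (tendsto_pow_atTop_nhds_zero_of_lt_one hγ0 hγ1).mul_const
          (R / (1 - γ) * ∫ x, ‖f (x k)‖ ∂ρ)
    simpa using tendsto_const_nhds.sub this
  exact tendsto_nhds_unique l1 l2

end MarkovChain
end


noncomputable section

/-! ### The game under fixed policy parameters -/

lemma lintegral_bind_kernel {α β : Type*} [MeasurableSpace α] [MeasurableSpace β] (κ : Kernel α β)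
    (μ : Measure α) {g : β → ENNReal} (hg : Measurable g) :
    ∫⁻ y, g y ∂(κ ∘ₘ μ) = ∫⁻ x, ∫⁻ y, g y ∂(κ x) ∂μ :=
  Measure.lintegral_bind κ.measurable.aemeasurable hg.aemeasurable

lemma integral_bind_kernel {α β E : Type*} [MeasurableSpace α] [MeasurableSpace β]
    [NormedAddCommGroup E] [NormedSpace ℝ E] (κ : Kernel α β)
    (μ : Measure α) {g : β → E} (hg : Integrable g (κ ∘ₘ μ)) :
    ∫ y, g y ∂(κ ∘ₘ μ) = ∫ x, ∫ y, g y ∂(κ x) ∂μ := by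
  have e : (κ ∘ₖ Kernel.const Unit μ) () = κ ∘ₘ μ := by
    rw [Kernel.comp_apply, Kernel.const_apply]
  rw [← e] at hg ⊢
  rw [Kernel.integral_comp hg, Kernel.const_apply]

section Horizon

variable {ι S A : Type*} [MeasurableSpace S] [MeasurableSpace A]

/-- The law of the horizon `T₁`. -/
def horizonLaw (Γ : MarkovGame ι S A) : Measure ℕ :=
  geometricMeasure
    ⟨1 - Γ.discount, by linarith [Γ.discount_lt_one], by linarith [Γ.discount_pos]⟩

instance (Γ : MarkovGame ι S A) : IsProbabilityMeasure (horizonLaw Γ) := by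
  unfold horizonLaw; infer_instance

lemma integral_horizonLaw (Γ : MarkovGame ι S A) (f : ℕ → ℝ) :
    ∫ n, f n ∂(horizonLaw Γ) = ∑' n, Γ.discount ^ n * (1 - Γ.discount) * f n := by
  rw [horizonLaw, integral_geometricMeasure]
  · simp
  · intro h
    have := congrArg Subtype.val h
    change 1 - Γ.discount = 0 at this
    linarith [Γ.discount_lt_one]

end Horizon

section FixedPolicy

variable {ι S A : Type*} [Fintype ι] [MeasurableSpace S] [MeasurableSpace A] {M : ι → ℕ}
  {ν : Measure A} [SigmaFinite ν]

/-- `s ↦ (s, a)` with `a` drawn from the joint policy at the parameters `φ`. -/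
def actAt (π : ParamPolicy ι S A M ν) (φ : ι → Param M) : Kernel S (StateAction ι S A) :=
  Kernel.id ×ₖ π.joint.comap (fun s => (φ, s)) measurable_prodMk_left

instance (π : ParamPolicy ι S A M ν) (φ : ι → Param M) : IsMarkovKernel (actAt π φ) := by
  unfold actAt; infer_instance

/-- The transition kernel of the state-action chain at the parameters `φ`. -/
def stepAt (Γ : MarkovGame ι S A) (π : ParamPolicy ι S A M ν) (φ : ι → Param M) :
    Kernel (StateAction ι S A) (StateAction ι S A) :=
  actAt π φ ∘ₖ Γ.transition

instance (Γ : MarkovGame ι S A) (π : ParamPolicy ι S A M ν) (φ : ι → Param M) :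
    IsMarkovKernel (stepAt Γ π φ) := by
  unfold stepAt; infer_instance

instance (Γ : MarkovGame ι S A) (π : ParamPolicy ι S A M ν) : IsMarkovKernel (pathLaw Γ π) := by
  unfold pathLaw
  exact Kernel.IsMarkovKernel.map _ (by fun_prop)

lemma actAt_apply (π : ParamPolicy ι S A M ν) (φ : ι → Param M) (s : S) :
    actAt π φ s = (π.joint (φ, s)).map (Prod.mk s) := by
  rw [actAt, Kernel.prod_apply, Kernel.id_apply, Kernel.comap_apply, Measure.dirac_prod]

lemma lintegral_actAt (π : ParamPolicy ι S A M ν) (φ : ι → Param M) (s : S)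
    {g : StateAction ι S A → ENNReal} (hg : Measurable g) :
    ∫⁻ x, g x ∂(actAt π φ s) = ∫⁻ a, g (s, a) ∂(π.joint (φ, s)) := by
  rw [actAt_apply, lintegral_map hg measurable_prodMk_left]

lemma integral_actAt {E : Type*} [NormedAddCommGroup E] [NormedSpace ℝ E]
    (π : ParamPolicy ι S A M ν) (φ : ι → Param M) (s : S)
    {g : StateAction ι S A → E} (hg : StronglyMeasurable g) :
    ∫ x, g x ∂(actAt π φ s) = ∫ a, g (s, a) ∂(π.joint (φ, s)) := by
  rw [actAt_apply, integral_map measurable_prodMk_left.aemeasurable hg.aestronglyMeasurable]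

lemma actKernel_apply_eq_map (π : ParamPolicy ι S A M ν) (φ : ι → Param M) (s : S) :
    actKernel π (φ, s) = (actAt π φ s).map (Prod.mk φ) := by
  rw [actKernel, Kernel.prod_apply, Kernel.prod_apply, Kernel.deterministic_apply,
    Kernel.deterministic_apply, Measure.dirac_prod, Measure.dirac_prod, actAt_apply]

/-- The parameters are only carried along. For fixed `φ` the chain therefore reduces, by
`IsMarkovChain.map_snd`, to a chain of state-action pairs with kernel `stepAt`. -/
lemma stepKernel_apply_eq_map (Γ : MarkovGame ι S A) (π : ParamPolicy ι S A M ν)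
    (φ : ι → Param M) (x : StateAction ι S A) :
    stepKernel Γ π (φ, x) = (stepAt Γ π φ x).map (Prod.mk φ) := by
  refine Measure.ext_of_lintegral _ fun g hg => ?_
  rw [stepKernel, stepAt, Kernel.lintegral_comp _ _ _ hg, Kernel.prod_apply,
    Kernel.deterministic_apply, Measure.dirac_prod, Kernel.comap_apply,
    lintegral_map hg.lintegral_kernel measurable_prodMk_left,
    lintegral_map hg measurable_prodMk_left,
    Kernel.lintegral_comp _ _ _ (show Measurable fun y => g (φ, y) from
      hg.comp measurable_prodMk_left)]
  refine lintegral_congr fun s => ?_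
  rw [actKernel_apply_eq_map, lintegral_map hg measurable_prodMk_left]

lemma pathLaw_apply (Γ : MarkovGame ι S A) (π : ParamPolicy ι S A M ν)
    (φ : ι → Param M) (s : S) :
    pathLaw Γ π (φ, s)
      = ((chainLaw (stepKernel Γ π)) ∘ₘ (actKernel π (φ, s))).map (fun z t => (z t).2) := by
  rw [pathLaw, Kernel.map_apply _ (by fun_prop), Kernel.comp_apply]

lemma bind_map_chainLaw_zero {Z : Type*} [MeasurableSpace Z] (K : Kernel Z Z) [IsMarkovKernel K]
    (μ : Measure Z) : ((chainLaw K) ∘ₘ μ).map (fun x => x 0) = μ := by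
  refine Measure.ext_of_lintegral _ fun g hg => ?_
  rw [lintegral_map hg (measurable_pi_apply 0), lintegral_bind_kernel _ _
    (show Measurable fun x : ℕ → Z => g (x 0) from hg.comp (measurable_pi_apply 0))]
  refine lintegral_congr fun z => ?_
  have e : ∫⁻ y, g y ∂((chainLaw K z).map fun x => x 0) = ∫⁻ x, g (x 0) ∂(chainLaw K z) :=
    lintegral_map hg (measurable_pi_apply 0)
  rw [← e, chainLaw_map_zero, lintegral_dirac' _ hg]

lemma pathLaw_map_zero (Γ : MarkovGame ι S A) (π : ParamPolicy ι S A M ν)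
    (φ : ι → Param M) (s : S) :
    (pathLaw Γ π (φ, s)).map (fun x => x 0) = actAt π φ s := by
  rw [pathLaw_apply, Measure.map_map (by fun_prop) (by fun_prop)]
  have e : (fun x : Play ι S A => x 0) ∘ (fun (z : ℕ → (ι → Param M) × StateAction ι S A) t =>
    (z t).2) = Prod.snd ∘ fun z => z 0 := rfl
  rw [e, ← Measure.map_map (by fun_prop) (by fun_prop), bind_map_chainLaw_zero,
    actKernel_apply_eq_map, Measure.map_map (by fun_prop) (by fun_prop)]
  exact Measure.map_id

lemma pathLaw_isMarkovChain (Γ : MarkovGame ι S A) (π : ParamPolicy ι S A M ν)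
    (φ : ι → Param M) (s : S) : IsMarkovChain (stepAt Γ π φ) (pathLaw Γ π (φ, s)) := by
  rw [pathLaw_apply]
  refine IsMarkovChain.map_snd (stepKernel_apply_eq_map Γ π φ)
    (IsMarkovChain.bind fun z => chainLaw_isMarkovChain _ z) ?_
  have h : ∀ᵐ z ∂(((chainLaw (stepKernel Γ π)) ∘ₘ (actKernel π (φ, s))).map (fun x => x 0)),
      z.1 = φ := by
    rw [bind_map_chainLaw_zero, actKernel_apply_eq_map, ae_map_iff measurable_prodMk_left.aemeasurable
      (show MeasurableSet {z : (ι → Param M) × StateAction ι S A | z.1 = φ} from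
        measurable_fst (measurableSet_singleton φ))]
    exact ae_of_all _ fun _ => rfl
  exact ae_of_ae_map (measurable_pi_apply 0).aemeasurable h

/-- The law of an infinite play at the parameters `φ`. -/
def playLaw (Γ : MarkovGame ι S A) (π : ParamPolicy ι S A M ν) (φ : ι → Param M) :
    Measure (Play ι S A) :=
  (pathLaw Γ π ∘ₖ (Kernel.id ×ₖ Kernel.const _ Γ.init)) φ

instance (Γ : MarkovGame ι S A) (π : ParamPolicy ι S A M ν) (φ : ι → Param M) :
    IsProbabilityMeasure (playLaw Γ π φ) := by
  unfold playLaw; infer_instance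

lemma playLaw_eq_bind (Γ : MarkovGame ι S A) (π : ParamPolicy ι S A M ν) (φ : ι → Param M) :
    playLaw Γ π φ = ((pathLaw Γ π).comap (fun s => (φ, s)) measurable_prodMk_left) ∘ₘ Γ.init := by
  refine Measure.ext_of_lintegral _ fun g hg => ?_
  rw [playLaw, Kernel.lintegral_comp _ _ _ hg, Kernel.prod_apply, Kernel.id_apply,
    Kernel.const_apply, Measure.dirac_prod, lintegral_map hg.lintegral_kernel
    measurable_prodMk_left, lintegral_bind_kernel _ _ hg]
  rfl

lemma playLaw_isMarkovChain (Γ : MarkovGame ι S A) (π : ParamPolicy ι S A M ν)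
    (φ : ι → Param M) : IsMarkovChain (stepAt Γ π φ) (playLaw Γ π φ) := by
  rw [playLaw_eq_bind]
  exact IsMarkovChain.bind fun s => pathLaw_isMarkovChain Γ π φ s

lemma bind_actAt_map_fst (π : ParamPolicy ι S A M ν) (φ : ι → Param M) (μ : Measure S) :
    (actAt π φ ∘ₘ μ).map Prod.fst = μ := by
  refine Measure.ext_of_lintegral _ fun g hg => ?_
  rw [lintegral_map hg measurable_fst, lintegral_bind_kernel _ _
    (show Measurable fun x : StateAction ι S A => g x.1 from hg.comp measurable_fst)]
  refine lintegral_congr fun s => ?_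
  rw [lintegral_actAt _ _ _
    (show Measurable fun x : StateAction ι S A => g x.1 from hg.comp measurable_fst)]
  simp

lemma playLaw_map_zero (Γ : MarkovGame ι S A) (π : ParamPolicy ι S A M ν) (φ : ι → Param M) :
    (playLaw Γ π φ).map (fun x => x 0) = actAt π φ ∘ₘ Γ.init := by
  refine Measure.ext_of_lintegral _ fun g hg => ?_
  rw [lintegral_map hg (measurable_pi_apply 0), playLaw_eq_bind,
    lintegral_bind_kernel _ _ (show Measurable fun x : Play ι S A => g (x 0) from
      hg.comp (measurable_pi_apply 0)), lintegral_bind_kernel _ _ hg]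
  refine lintegral_congr fun s => ?_
  rw [← pathLaw_map_zero Γ, lintegral_map hg (measurable_pi_apply 0)]
  rfl

lemma IsMarkovChain.map_succ {X : Type*} [MeasurableSpace X] {K : Kernel X X} [IsMarkovKernel K]
    {ρ : Measure (ℕ → X)} [IsProbabilityMeasure ρ] (h : IsMarkovChain K ρ) (m : ℕ) :
    ρ.map (fun x => x (m + 1)) = K ∘ₘ (ρ.map fun x => x m) := by
  refine Measure.ext_of_lintegral _ fun g hg => ?_
  rw [lintegral_map hg (measurable_pi_apply _), lintegral_bind_kernel _ _ hg, lintegral_map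
    hg.lintegral_kernel (measurable_pi_apply _)]
  exact isMarkovChain_iff_lintegral.1 h m (fun p => g p.2) (hg.comp measurable_snd)

/-- Given the state at time `k`, the action is drawn from the joint policy. -/
lemma playLaw_map_eq_bind (Γ : MarkovGame ι S A) (π : ParamPolicy ι S A M ν) (φ : ι → Param M)
    (k : ℕ) : (playLaw Γ π φ).map (fun x => x k)
      = actAt π φ ∘ₘ ((playLaw Γ π φ).map fun x => (x k).1) := by
  -- At time `0` and after every transition the pair arises by drawing an action for some random
  -- state; the law of that state is then identified as the first marginal.
  have key : ∃ μ : Measure S, (playLaw Γ π φ).map (fun x => x k) = actAt π φ ∘ₘ μ := by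
    cases k with
    | zero => exact ⟨_, playLaw_map_zero Γ π φ⟩
    | succ k =>
      refine ⟨Γ.transition ∘ₘ ((playLaw Γ π φ).map fun x => x k), ?_⟩
      rw [(playLaw_isMarkovChain Γ π φ).map_succ, Measure.comp_assoc]
      rfl
  obtain ⟨μ, hμ⟩ := key
  have e : (fun x : Play ι S A => (x k).1) = Prod.fst ∘ fun x => x k := rfl
  rw [e, ← Measure.map_map (by fun_prop) (by fun_prop), hμ, bind_actAt_map_fst]

/-- The discounted occupation measure of the states. -/
def stateOccupation (Γ : MarkovGame ι S A) (π : ParamPolicy ι S A M ν) (φ : ι → Param M) :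
    Measure S :=
  ((horizonLaw Γ).prod (playLaw Γ π φ)).map fun q => (q.2 q.1).1

/-- The discounted occupation measure of the state-action pairs. -/
def occupation (Γ : MarkovGame ι S A) (π : ParamPolicy ι S A M ν) (φ : ι → Param M) :
    Measure (StateAction ι S A) :=
  ((horizonLaw Γ).prod (playLaw Γ π φ)).map fun q => q.2 q.1

lemma measurable_eval_horizon {X : Type*} [MeasurableSpace X] :
    Measurable fun q : ℕ × (ℕ → X) => q.2 q.1 :=
  measurable_from_prod_countable_right fun n => measurable_pi_apply n

lemma measurable_state_horizon {ι S A : Type*} [MeasurableSpace S] [MeasurableSpace A] :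
    Measurable fun q : ℕ × Play ι S A => (q.2 q.1).1 :=
  measurable_fst.comp measurable_eval_horizon

instance (Γ : MarkovGame ι S A) (π : ParamPolicy ι S A M ν) (φ : ι → Param M) :
    IsProbabilityMeasure (stateOccupation Γ π φ) :=
  Measure.isProbabilityMeasure_map (measurable_fst.comp measurable_eval_horizon).aemeasurable

instance (Γ : MarkovGame ι S A) (π : ParamPolicy ι S A M ν) (φ : ι → Param M) :
    IsProbabilityMeasure (occupation Γ π φ) :=
  Measure.isProbabilityMeasure_map measurable_eval_horizon.aemeasurable

/-- The action is drawn from the joint policy given the state at every fixed time, hence also at an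
independent random time. -/
lemma occupation_eq_bind (Γ : MarkovGame ι S A) (π : ParamPolicy ι S A M ν) (φ : ι → Param M) :
    occupation Γ π φ = actAt π φ ∘ₘ stateOccupation Γ π φ := by
  refine Measure.ext_of_lintegral _ fun g hg => ?_
  have hg' : Measurable fun s => ∫⁻ x, g x ∂(actAt π φ s) := hg.lintegral_kernel
  rw [lintegral_bind_kernel _ _ hg, occupation,
    stateOccupation, lintegral_map hg measurable_eval_horizon,
    lintegral_map hg' measurable_state_horizon,
    lintegral_prod _ (show Measurable fun q : ℕ × Play ι S A => g (q.2 q.1) from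
      hg.comp measurable_eval_horizon).aemeasurable,
    lintegral_prod _ (show Measurable fun q : ℕ × Play ι S A =>
      ∫⁻ x, g x ∂(actAt π φ (q.2 q.1).1) from hg'.comp measurable_state_horizon).aemeasurable]
  refine lintegral_congr fun k => ?_
  have e : ∫⁻ y, g y ∂((playLaw Γ π φ).map fun x => x k) = ∫⁻ x, g (x k) ∂(playLaw Γ π φ) :=
    lintegral_map hg (measurable_pi_apply k)
  simp only
  rw [← e, playLaw_map_eq_bind, lintegral_bind_kernel _ _ hg, lintegral_map hg' (by fun_prop)]

lemma lintegral_occupation (Γ : MarkovGame ι S A) (π : ParamPolicy ι S A M ν) (φ : ι → Param M)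
    {g : StateAction ι S A → ENNReal} (hg : Measurable g) :
    ∫⁻ x, g x ∂(occupation Γ π φ)
      = ∫⁻ s, ∫⁻ a, g (s, a) ∂(π.joint (φ, s)) ∂(stateOccupation Γ π φ) := by
  rw [occupation_eq_bind, lintegral_bind_kernel _ _ hg]
  exact lintegral_congr fun s => lintegral_actAt π φ s hg

lemma integral_occupation {E : Type*} [NormedAddCommGroup E] [NormedSpace ℝ E]
    (Γ : MarkovGame ι S A) (π : ParamPolicy ι S A M ν) (φ : ι → Param M)
    {g : StateAction ι S A → E} (hg : StronglyMeasurable g)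
    (hgi : Integrable g (occupation Γ π φ)) :
    ∫ x, g x ∂(occupation Γ π φ)
      = ∫ s, ∫ a, g (s, a) ∂(π.joint (φ, s)) ∂(stateOccupation Γ π φ) := by
  rw [occupation_eq_bind] at hgi ⊢
  rw [integral_bind_kernel _ _ hgi]
  exact integral_congr_ae (ae_of_all _ fun s => integral_actAt π φ s hg)

/-- The flow equation of the occupation measure: the geometric horizon is zero with probability `1 -
γ`, and otherwise, being memoryless, it is one more step after a horizon of the same law. -/
lemma integral_stateOccupation (Γ : MarkovGame ι S A) (π : ParamPolicy ι S A M ν)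
    (φ : ι → Param M) {g : S → ℝ} (hg : Measurable g) {C : ℝ} (hC : ∀ s, |g s| ≤ C) :
    ∫ s, g s ∂(stateOccupation Γ π φ) = (1 - Γ.discount) * ∫ s, g s ∂Γ.init
      + Γ.discount * ∫ x, ∫ s, g s ∂(Γ.transition x) ∂(occupation Γ π φ) := by
  set h : StateAction ι S A → ℝ := fun x => ∫ s, g s ∂(Γ.transition x) with hh
  have hhm : Measurable h := (hg.stronglyMeasurable.integral_kernel (κ := Γ.transition)).measurable
  have hhb : ∀ x, |h x| ≤ C := fun x => abs_integral_le_of_abs_le hC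
  have e1 : ∫ s, g s ∂(stateOccupation Γ π φ)
      = ∑' n, Γ.discount ^ n * (1 - Γ.discount) * ∫ x, g (x n).1 ∂(playLaw Γ π φ) := by
    rw [stateOccupation, integral_map measurable_state_horizon.aemeasurable
      hg.aestronglyMeasurable, integral_prod, integral_horizonLaw]
    exact Integrable.of_bound (hg.comp measurable_state_horizon).aestronglyMeasurable C (ae_of_all _ fun q => hC _)
  have e2 : ∫ x, h x ∂(occupation Γ π φ)
      = ∑' n, Γ.discount ^ n * (1 - Γ.discount) * ∫ x, h (x n) ∂(playLaw Γ π φ) := by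
    rw [occupation, integral_map measurable_eval_horizon.aemeasurable
      hhm.aestronglyMeasurable, integral_prod, integral_horizonLaw]
    exact Integrable.of_bound (hhm.comp measurable_eval_horizon).aestronglyMeasurable C
      (ae_of_all _ fun q => hhb _)
  have e0 : ∫ x, g (x 0).1 ∂(playLaw Γ π φ) = ∫ s, g s ∂Γ.init := by
    have h1 : (playLaw Γ π φ).map (fun x => (x 0).1) = Γ.init := by
      have e : (fun x : Play ι S A => (x 0).1) = Prod.fst ∘ fun x => x 0 := rfl
      rw [e, ← Measure.map_map (by fun_prop) (by fun_prop), playLaw_map_zero, bind_actAt_map_fst]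
    rw [← h1, integral_map (by fun_prop : Measurable fun x : Play ι S A => (x 0).1).aemeasurable
      hg.aestronglyMeasurable]
  have es : ∀ n, ∫ x, g (x (n + 1)).1 ∂(playLaw Γ π φ) = ∫ x, h (x n) ∂(playLaw Γ π φ) := by
    intro n
    have := (playLaw_isMarkovChain Γ π φ).integral_step (le_refl n)
      (g := fun x => g x.1) (hg.comp measurable_fst) (fun x => hC _) (f := fun _ => (1 : ℝ))
      stronglyMeasurable_const (integrable_const _)
    simp only [smul_eq_mul, mul_one] at this
    rw [this]
    refine integral_congr_ae (ae_of_all _ fun x => ?_)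
    simp only [hh]
    rw [stepAt, Kernel.comp_apply, integral_bind_kernel]
    · refine integral_congr_ae (ae_of_all _ fun s => ?_)
      simp only
      rw [integral_actAt _ _ _ (show StronglyMeasurable fun x : StateAction ι S A => g x.1 from
        (hg.comp measurable_fst).stronglyMeasurable)]
      simp
    · exact Integrable.of_bound (hg.comp measurable_fst).aestronglyMeasurable C
        (ae_of_all _ fun q => hC _)
  have hsum : Summable fun n => Γ.discount ^ n * ((1 - Γ.discount) *
      ∫ x, g (x n).1 ∂(playLaw Γ π φ)) :=
    summable_discounted (R := (1 - Γ.discount) * C) Γ.discount_pos.le Γ.discount_lt_one fun n => by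
      rw [abs_mul, abs_of_pos (by linarith [Γ.discount_lt_one])]
      exact mul_le_mul_of_nonneg_left (abs_integral_le_of_abs_le fun x => hC _)
        (by linarith [Γ.discount_lt_one])
  rw [e1, e2]
  simp_rw [mul_assoc]
  rw [hsum.tsum_eq_zero_add, e0, ← tsum_mul_left, pow_zero, one_mul]
  congr 1
  refine tsum_congr fun n => ?_
  rw [es, pow_succ]
  ring

/-- The `Q`-function of agent `i` at the parameters `φ`. -/
def qValue (Γ : MarkovGame ι S A) (π : ParamPolicy ι S A M ν) (i : ι) (φ : ι → Param M) :
    StateAction ι S A → ℝ :=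
  discountedValue (stepAt Γ π φ) Γ.discount (Γ.reward i)

/-- The value function of agent `i` at the parameters `φ`. -/
def stateValue (Γ : MarkovGame ι S A) (π : ParamPolicy ι S A M ν) (i : ι) (φ : ι → Param M)
    (s : S) : ℝ :=
  ∫ a, qValue Γ π i φ (s, a) ∂(π.joint (φ, s))

/-- The expected value of agent `i` when agent `n` acts by its policy at the parameter `φ n`. -/
def jointUtility (Γ : MarkovGame ι S A) (π : ParamPolicy ι S A M ν) (i : ι) (φ : ι → Param M) :
    ℝ :=
  ∫ s, stateValue Γ π i φ s ∂Γ.init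

variable {Γ : MarkovGame ι S A} {π : ParamPolicy ι S A M ν} {R : ℝ}

lemma BoundedReward.measurable_qValue (hR : BoundedReward Γ R) (i : ι) (φ : ι → Param M) :
    Measurable (qValue Γ π i φ) :=
  measurable_discountedValue Γ.discount_pos.le Γ.discount_lt_one (Γ.measurable_reward i) (hR i)

lemma BoundedReward.abs_qValue_le (hR : BoundedReward Γ R) (i : ι) (φ : ι → Param M)
    (x : StateAction ι S A) : |qValue Γ π i φ x| ≤ R / (1 - Γ.discount) :=
  abs_discountedValue_le Γ.discount_pos.le Γ.discount_lt_one (Γ.measurable_reward i) (hR i) x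

lemma BoundedReward.stateValue_eq (hR : BoundedReward Γ R) (i : ι) (φ : ι → Param M) (s : S) :
    stateValue Γ π i φ s = ∫ x, qValue Γ π i φ x ∂(actAt π φ s) :=
  (integral_actAt π φ s (hR.measurable_qValue i φ).stronglyMeasurable).symm

lemma BoundedReward.measurable_stateValue (hR : BoundedReward Γ R) (i : ι) (φ : ι → Param M) :
    Measurable (stateValue Γ π i φ) := by
  have : stateValue Γ π i φ = fun s => ∫ x, qValue Γ π i φ x ∂(actAt π φ s) :=
    funext fun s => hR.stateValue_eq i φ s
  rw [this]
  exact ((hR.measurable_qValue i φ).stronglyMeasurable.integral_kernel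
    (κ := actAt π φ)).measurable

lemma BoundedReward.abs_stateValue_le (hR : BoundedReward Γ R) (i : ι) (φ : ι → Param M) (s : S) :
    |stateValue Γ π i φ s| ≤ R / (1 - Γ.discount) :=
  abs_integral_le_of_abs_le fun a => hR.abs_qValue_le i φ (s, a)

lemma BoundedReward.abs_jointUtility_le (hR : BoundedReward Γ R) (i : ι) (φ : ι → Param M) :
    |jointUtility Γ π i φ| ≤ R / (1 - Γ.discount) :=
  abs_integral_le_of_abs_le fun s => hR.abs_stateValue_le i φ s

lemma BoundedReward.qValue_eq (hR : BoundedReward Γ R) (i : ι) (φ : ι → Param M)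
    (x : StateAction ι S A) :
    qValue Γ π i φ x = Γ.reward i x
      + Γ.discount * ∫ s, stateValue Γ π i φ s ∂(Γ.transition x) := by
  rw [qValue, discountedValue_eq Γ.discount_pos.le Γ.discount_lt_one (Γ.measurable_reward i)
    (hR i)]
  congr 2
  rw [stepMean, stepAt, Kernel.comp_apply, integral_bind_kernel]
  · exact integral_congr_ae (ae_of_all _ fun s => (hR.stateValue_eq i φ s).symm)
  · exact Integrable.of_bound (hR.measurable_qValue i φ).aestronglyMeasurable _
      (ae_of_all _ fun x => hR.abs_qValue_le i φ x)

/-- Connects the value defined through whole plays with the one obtained by iterating one-step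
means; this is `IsMarkovChain.integral_discounted` at time `0` with a constant test function. -/
lemma BoundedReward.integral_pathLaw (hR : BoundedReward Γ R) (i : ι) (φ : ι → Param M) (s : S) :
    ∫ x, ∑' t : ℕ, Γ.discount ^ t * Γ.reward i (x t) ∂(pathLaw Γ π (φ, s))
      = stateValue Γ π i φ s := by
  have := (pathLaw_isMarkovChain Γ π φ s).integral_discounted Γ.discount_pos.le Γ.discount_lt_one
    (Γ.measurable_reward i) (hR i) 0 (f := fun _ => (1 : ℝ)) stronglyMeasurable_const
    (integrable_const _)
  simp only [zero_add, smul_eq_mul, mul_one] at this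
  rw [this, hR.stateValue_eq, ← pathLaw_map_zero Γ, integral_map (measurable_pi_apply 0).aemeasurable
    (hR.measurable_qValue i φ).aestronglyMeasurable]
  rfl

lemma BoundedReward.utility_eq (hR : BoundedReward Γ R) (i : ι) (θ : Param M) :
    utility Γ π i θ = jointUtility Γ π i (fun _ => θ) :=
  integral_congr_ae (ae_of_all _ fun s => hR.integral_pathLaw i (fun _ => θ) s)

end FixedPolicy
end


noncomputable section

/-! ### First order expansion of the utilities -/

section Utility

variable {ι S A : Type*} [Fintype ι] [MeasurableSpace S] [MeasurableSpace A] {M : ι → ℕ}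
  {ν : Measure A}

lemma ParamPolicy.measurable_gradLog_action (π : ParamPolicy ι S A M ν) (n : ι) (θ : Param M) :
    Measurable fun x : StateAction ι S A => π.gradLog n θ x.1 (x.2 n) :=
  (π.measurable_gradLog n).comp (f := fun x : StateAction ι S A => ((θ, x.1), x.2 n)) (by fun_prop)

/-- The derivative at `φ` of the logarithm of the joint policy in the direction `v`. -/
def scoreDir (π : ParamPolicy ι S A M ν) (φ v : ι → Param M) (x : StateAction ι S A) : ℝ :=
  ∑ n, inner ℝ (π.gradLog n (φ n) x.1 (x.2 n)) (v n)

lemma measurable_scoreDir (π : ParamPolicy ι S A M ν) (φ v : ι → Param M) :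
    Measurable (scoreDir π φ v) :=
  Finset.measurable_sum _ fun n _ => by
    have := π.measurable_gradLog_action n (φ n)
    fun_prop

lemma MarkovGame.one_sub_discount_pos {ι : Type*} (Γ : MarkovGame ι S A) :
    0 < 1 - Γ.discount := by
  linarith [Γ.discount_lt_one]

variable [SigmaFinite ν]

variable {Γ : MarkovGame ι S A} {π : ParamPolicy ι S A M ν} {B V L R : ℝ}

lemma ScoreAssumption.integrable_gradLog_sq (h : ScoreAssumption π B V L) (Γ : MarkovGame ι S A)
    (n : ι) (φ : ι → Param M) :
    Integrable (fun x => ‖π.gradLog n (φ n) x.1 (x.2 n)‖ ^ 2) (occupation Γ π φ) ∧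
      ∫ x, ‖π.gradLog n (φ n) x.1 (x.2 n)‖ ^ 2 ∂(occupation Γ π φ) ≤ Fintype.card ι * V ^ 2 := by
  refine integrable_sq_of_lintegral_le (π.measurable_gradLog_action n (φ n)) (by positivity) ?_
  rw [lintegral_occupation Γ π φ ((π.measurable_gradLog_action n (φ n)).enorm.pow_const 2)]
  calc _ ≤ ∫⁻ _s, ENNReal.ofReal (Fintype.card ι * V ^ 2) ∂(stateOccupation Γ π φ) :=
        lintegral_mono fun s => h.lintegral_joint_gradLog_sq_le n φ s
    _ = _ := by simp

lemma ScoreAssumption.integrable_gradLog (h : ScoreAssumption π B V L) (Γ : MarkovGame ι S A)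
    (n : ι) (φ : ι → Param M) :
    Integrable (fun x => π.gradLog n (φ n) x.1 (x.2 n)) (occupation Γ π φ) ∧
      ∫ x, ‖π.gradLog n (φ n) x.1 (x.2 n)‖ ∂(occupation Γ π φ) ≤ 1 + Fintype.card ι * V ^ 2 := by
  obtain ⟨h1, h2⟩ := h.integrable_gradLog_sq Γ n φ
  have hi : Integrable (fun x => 1 + ‖π.gradLog n (φ n) x.1 (x.2 n)‖ ^ 2) (occupation Γ π φ) :=
    (integrable_const 1).add h1
  have hle : ∀ x : StateAction ι S A, ‖π.gradLog n (φ n) x.1 (x.2 n)‖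
      ≤ 1 + ‖π.gradLog n (φ n) x.1 (x.2 n)‖ ^ 2 := fun x => by
    nlinarith [sq_nonneg (‖π.gradLog n (φ n) x.1 (x.2 n)‖ - 1)]
  have hint : Integrable (fun x => π.gradLog n (φ n) x.1 (x.2 n)) (occupation Γ π φ) :=
    hi.mono' (π.measurable_gradLog_action n (φ n)).aestronglyMeasurable (ae_of_all _ hle)
  refine ⟨hint, (integral_mono hint.norm hi hle).trans ?_⟩
  rw [integral_add (integrable_const 1) h1]
  simpa using h2

lemma ScoreAssumption.integrable_scoreDir (h : ScoreAssumption π B V L) (Γ : MarkovGame ι S A)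
    (φ v : ι → Param M) : Integrable (scoreDir π φ v) (occupation Γ π φ) :=
  integrable_finsetSum _ fun n _ => (h.integrable_gradLog Γ n φ).1.inner_const _

lemma ScoreAssumption.integral_abs_scoreDir_le (h : ScoreAssumption π B V L)
    (Γ : MarkovGame ι S A) (φ v : ι → Param M) :
    ∫ x, |scoreDir π φ v x| ∂(occupation Γ π φ)
      ≤ Fintype.card ι * (1 + Fintype.card ι * V ^ 2) * ‖v‖ := by
  have hi : ∀ n, Integrable (fun x => ‖π.gradLog n (φ n) x.1 (x.2 n)‖ * ‖v‖)
      (occupation Γ π φ) := fun n => (h.integrable_gradLog Γ n φ).1.norm.mul_const _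
  calc _ ≤ ∫ x, ∑ n, ‖π.gradLog n (φ n) x.1 (x.2 n)‖ * ‖v‖ ∂(occupation Γ π φ) := by
        refine integral_mono (h.integrable_scoreDir Γ φ v).abs
          (integrable_finsetSum _ fun n _ => hi n) fun x => ?_
        refine (Finset.abs_sum_le_sum_abs _ _).trans (Finset.sum_le_sum fun n _ => ?_)
        exact (abs_real_inner_le_norm _ _).trans
          (mul_le_mul_of_nonneg_left (norm_le_pi_norm v n) (norm_nonneg _))
    _ = ∑ n, (∫ x, ‖π.gradLog n (φ n) x.1 (x.2 n)‖ ∂(occupation Γ π φ)) * ‖v‖ := by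
        rw [integral_finsetSum _ fun n _ => hi n]
        exact Finset.sum_congr rfl fun n _ => integral_mul_const _ _
    _ ≤ ∑ _n : ι, (1 + Fintype.card ι * V ^ 2) * ‖v‖ :=
        Finset.sum_le_sum fun n _ =>
          mul_le_mul_of_nonneg_right (h.integrable_gradLog Γ n φ).2 (norm_nonneg _)
    _ = _ := by rw [Finset.sum_const, Finset.card_univ, nsmul_eq_mul]; ring

lemma ScoreAssumption.integrable_qValue_mul_scoreDir (h : ScoreAssumption π B V L)
    (hR : BoundedReward Γ R) (i : ι) (φ v : ι → Param M) :
    Integrable (fun x => qValue Γ π i φ x * scoreDir π φ v x) (occupation Γ π φ) :=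
  (h.integrable_scoreDir Γ φ v).bdd_mul (hR.measurable_qValue i φ).aestronglyMeasurable
    (c := R / (1 - Γ.discount)) (ae_of_all _ fun x => hR.abs_qValue_le i φ x)

/-- The derivative of `jointUtility` at `φ`. -/
def utilityDeriv (h : ScoreAssumption π B V L) (hR : BoundedReward Γ R) (i : ι)
    (φ : ι → Param M) : (ι → Param M) →ₗ[ℝ] ℝ where
  toFun v := (1 - Γ.discount)⁻¹ *
    ∫ x, qValue Γ π i φ x * scoreDir π φ v x ∂(occupation Γ π φ)
  map_add' v w := by
    rw [← mul_add, ← integral_add (h.integrable_qValue_mul_scoreDir hR i φ v)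
      (h.integrable_qValue_mul_scoreDir hR i φ w)]
    congr 2
    funext x
    simp only [scoreDir, Pi.add_apply, inner_add_right, Finset.sum_add_distrib, mul_add]
  map_smul' c v := by
    rw [RingHom.id_apply, smul_eq_mul, mul_left_comm, ← integral_const_mul c]
    congr 2
    funext x
    simp only [scoreDir, Pi.smul_apply, inner_smul_right, ← Finset.mul_sum]
    ring

lemma utilityDeriv_apply (h : ScoreAssumption π B V L) (hR : BoundedReward Γ R) (i : ι)
    (φ v : ι → Param M) : utilityDeriv h hR i φ v = (1 - Γ.discount)⁻¹ *
      ∫ x, qValue Γ π i φ x * scoreDir π φ v x ∂(occupation Γ π φ) := rfl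

lemma abs_utilityDeriv_le (h : ScoreAssumption π B V L) (hR : BoundedReward Γ R) (hR0 : 0 ≤ R)
    (i : ι) (φ v : ι → Param M) : |utilityDeriv h hR i φ v| ≤ (1 - Γ.discount)⁻¹ *
      (R / (1 - Γ.discount)) * (Fintype.card ι * (1 + Fintype.card ι * V ^ 2)) * ‖v‖ := by
  have hg := Γ.one_sub_discount_pos
  rw [utilityDeriv_apply, abs_mul, abs_of_pos (inv_pos.2 hg), mul_assoc, mul_assoc]
  refine mul_le_mul_of_nonneg_left ?_ (inv_pos.2 hg).le
  calc |∫ x, qValue Γ π i φ x * scoreDir π φ v x ∂(occupation Γ π φ)|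
      ≤ ∫ x, R / (1 - Γ.discount) * |scoreDir π φ v x| ∂(occupation Γ π φ) := by
        rw [← Real.norm_eq_abs]
        refine norm_integral_le_of_norm_le ((h.integrable_scoreDir Γ φ v).abs.const_mul _)
          (ae_of_all _ fun x => ?_)
        rw [norm_mul]
        exact mul_le_mul_of_nonneg_right (hR.abs_qValue_le i φ x) (abs_nonneg _)
    _ ≤ _ := by
        rw [integral_const_mul]
        exact mul_le_mul_of_nonneg_left (h.integral_abs_scoreDir_le Γ φ v)
          (div_nonneg hR0 hg.le)

/-- Integrals of bounded functions over the joint policy, as functions of the state. -/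
lemma measurable_integral_joint (π : ParamPolicy ι S A M ν) (φ : ι → Param M)
    {g : StateAction ι S A → ℝ} (hg : Measurable g) :
    Measurable fun s => ∫ a, g (s, a) ∂(π.joint (φ, s)) := by
  have : (fun s => ∫ a, g (s, a) ∂(π.joint (φ, s))) = fun s => ∫ x, g x ∂(actAt π φ s) :=
    funext fun s => (integral_actAt π φ s hg.stronglyMeasurable).symm
  rw [this]
  exact (hg.stronglyMeasurable.integral_kernel (κ := actAt π φ)).measurable

lemma integrable_of_abs_le {α : Type*} [MeasurableSpace α] {μ : Measure α} [IsFiniteMeasure μ]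
    {g : α → ℝ} (hg : Measurable g) {C : ℝ} (hC : ∀ x, |g x| ≤ C) : Integrable g μ :=
  Integrable.of_bound hg.aestronglyMeasurable C (ae_of_all _ hC)

/-- The performance difference lemma. -/
lemma BoundedReward.performance_difference (hR : BoundedReward Γ R) (i : ι)
    (φ φ' : ι → Param M) :
    (1 - Γ.discount) * (jointUtility Γ π i φ' - jointUtility Γ π i φ)
      = ∫ s, (∫ a, qValue Γ π i φ (s, a) ∂(π.joint (φ', s))
          - ∫ a, qValue Γ π i φ (s, a) ∂(π.joint (φ, s))) ∂(stateOccupation Γ π φ') := by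
  set K := R / (1 - Γ.discount)
  have hV := hR.measurable_stateValue (π := π) i φ
  have hV' := hR.measurable_stateValue (π := π) i φ'
  have hVb := hR.abs_stateValue_le (π := π) i φ
  have hVb' := hR.abs_stateValue_le (π := π) i φ'
  have hQ := hR.measurable_qValue (π := π) i φ
  have hQ' := hR.measurable_qValue (π := π) i φ'
  have hQb := hR.abs_qValue_le (π := π) i φ
  have hQb' := hR.abs_qValue_le (π := π) i φ'
  set W : S → ℝ := fun s => stateValue Γ π i φ' s - stateValue Γ π i φ s with hW
  have hWm : Measurable W := hV'.sub hV
  have hWb : ∀ s, |W s| ≤ K + K := fun s => (abs_sub _ _).trans (add_le_add (hVb' s) (hVb s))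
  set T : StateAction ι S A → ℝ := fun x => ∫ s, W s ∂(Γ.transition x) with hT
  have hTm : Measurable T := (hWm.stronglyMeasurable.integral_kernel (κ := Γ.transition)).measurable
  have hTb : ∀ x, |T x| ≤ K + K := fun x => abs_integral_le_of_abs_le hWb
  have hQdiff : ∀ x, qValue Γ π i φ' x - qValue Γ π i φ x = Γ.discount * T x := fun x => by
    rw [hR.qValue_eq, hR.qValue_eq, hT]
    simp only [hW]
    rw [integral_sub (integrable_of_abs_le hV' hVb') (integrable_of_abs_le hV hVb)]
    ring
  set D : S → ℝ := fun s => ∫ a, qValue Γ π i φ (s, a) ∂(π.joint (φ', s))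
          - ∫ a, qValue Γ π i φ (s, a) ∂(π.joint (φ, s)) with hD
  have hDm : Measurable D := (measurable_integral_joint π φ' hQ).sub
    (measurable_integral_joint π φ hQ)
  have hDb : ∀ s, |D s| ≤ K + K := fun s => (abs_sub _ _).trans
    (add_le_add (abs_integral_le_of_abs_le fun a => hQb (s, a))
      (abs_integral_le_of_abs_le fun a => hQb (s, a)))
  -- The difference `W` of the state values solves a Bellman equation under the new policy, with the
  -- one-step gain `D` as its reward.
  have hWeq : ∀ s, W s = D s + Γ.discount * ∫ a, T (s, a) ∂(π.joint (φ', s)) := fun s => by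
    rw [← integral_const_mul]
    simp_rw [← hQdiff]
    have i1 : Integrable (fun a => qValue Γ π i φ' (s, a)) (π.joint (φ', s)) :=
      integrable_of_abs_le (hQ'.comp measurable_prodMk_left) fun a => hQb' (s, a)
    have i2 : Integrable (fun a => qValue Γ π i φ (s, a)) (π.joint (φ', s)) :=
      integrable_of_abs_le (hQ.comp measurable_prodMk_left) fun a => hQb (s, a)
    rw [integral_sub i1 i2]
    simp only [hW, hD, stateValue]
    ring
  -- Integrated against the new occupation measure, the discounted term of this equation is the one
  -- in the flow equation. Both cancel, and only the initial law and `D` are left.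
  have e1 := integral_stateOccupation Γ π φ' hWm hWb
  have e2 : ∫ s, W s ∂(stateOccupation Γ π φ') = ∫ s, D s ∂(stateOccupation Γ π φ')
      + Γ.discount * ∫ x, T x ∂(occupation Γ π φ') := by
    rw [integral_occupation Γ π φ' hTm.stronglyMeasurable (integrable_of_abs_le hTm hTb),
      ← integral_const_mul, ← integral_add (integrable_of_abs_le hDm hDb)]
    · exact integral_congr_ae (ae_of_all _ hWeq)
    · exact (integrable_of_abs_le (measurable_integral_joint π φ' hTm)
        fun s => abs_integral_le_of_abs_le fun a => hTb (s, a)).const_mul _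
  have e3 : ∫ s, W s ∂Γ.init = jointUtility Γ π i φ' - jointUtility Γ π i φ :=
    integral_sub (integrable_of_abs_le hV' hVb') (integrable_of_abs_le hV hVb)
  rw [← e3]
  linarith

/-- The discounted occupation measures depend on the parameters in a Lipschitz way. -/
lemma abs_integral_stateOccupation_sub_le {φ φ' : ι → Param M} {C : ℝ} (hC : 0 ≤ C)
    (hlip : ∀ (s : S) (q : (ι → A) → ℝ), Measurable q → ∀ K : ℝ, 0 ≤ K → (∀ a, |q a| ≤ K) →
      |∫ a, q a ∂(π.joint (φ', s)) - ∫ a, q a ∂(π.joint (φ, s))| ≤ K * C)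
    {g : S → ℝ} (hg : Measurable g) {K : ℝ} (hK : 0 ≤ K) (hgK : ∀ s, |g s| ≤ K) :
    |∫ s, g s ∂(stateOccupation Γ π φ') - ∫ s, g s ∂(stateOccupation Γ π φ)|
      ≤ K * (C / (1 - Γ.discount)) := by
  have hγ := Γ.one_sub_discount_pos
  have hγ0 := Γ.discount_pos
  -- Each use of the flow equation passes to a test function one step later and turns an error bound
  -- `e` into `γ (e + K C)`. Starting from the trivial bound, iteration leaves `2 K γ ^ n` plus a
  -- constant, and `n` tends to infinity.
  have key : ∀ n : ℕ, ∀ g : S → ℝ, Measurable g → (∀ s, |g s| ≤ K) →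
      |∫ s, g s ∂(stateOccupation Γ π φ') - ∫ s, g s ∂(stateOccupation Γ π φ)|
        ≤ K * (2 * Γ.discount ^ n + C / (1 - Γ.discount)) := by
    intro n
    induction n with
    | zero =>
      intro g _ hgK
      refine (abs_sub _ _).trans ((add_le_add (abs_integral_le_of_abs_le hgK)
        (abs_integral_le_of_abs_le hgK)).trans ?_)
      have : 0 ≤ K * (C / (1 - Γ.discount)) := by positivity
      rw [pow_zero]
      linarith
    | succ n ih =>
      intro g hg hgK
      set T : StateAction ι S A → ℝ := fun x => ∫ s, g s ∂(Γ.transition x) with hT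
      have hTm : Measurable T :=
        (hg.stronglyMeasurable.integral_kernel (κ := Γ.transition)).measurable
      have hTb : ∀ x, |T x| ≤ K := fun x => abs_integral_le_of_abs_le hgK
      rw [integral_stateOccupation Γ π φ' hg hgK, integral_stateOccupation Γ π φ hg hgK,
        integral_occupation Γ π φ' hTm.stronglyMeasurable (integrable_of_abs_le hTm hTb),
        integral_occupation Γ π φ hTm.stronglyMeasurable (integrable_of_abs_le hTm hTb)]
      set P : S → ℝ := fun s => ∫ a, T (s, a) ∂(π.joint (φ, s)) with hP
      set P' : S → ℝ := fun s => ∫ a, T (s, a) ∂(π.joint (φ', s)) with hP'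
      have hPm : Measurable P := measurable_integral_joint π φ hTm
      have hPm' : Measurable P' := measurable_integral_joint π φ' hTm
      have hPb : ∀ s, |P s| ≤ K := fun s => abs_integral_le_of_abs_le fun a => hTb (s, a)
      have hPb' : ∀ s, |P' s| ≤ K := fun s => abs_integral_le_of_abs_le fun a => hTb (s, a)
      have h1 := ih P' hPm' hPb'
      have h2 : |∫ s, P' s ∂(stateOccupation Γ π φ) - ∫ s, P s ∂(stateOccupation Γ π φ)|
          ≤ K * C := by
        rw [← integral_sub (integrable_of_abs_le hPm' hPb') (integrable_of_abs_le hPm hPb)]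
        exact abs_integral_le_of_abs_le fun s => hlip s _ (hTm.comp measurable_prodMk_left) K hK
          fun a => hTb (s, a)
      have h3 : |∫ s, P' s ∂(stateOccupation Γ π φ') - ∫ s, P s ∂(stateOccupation Γ π φ)|
          ≤ K * (2 * Γ.discount ^ n + C / (1 - Γ.discount)) + K * C :=
        (abs_sub_le _ _ _).trans (add_le_add h1 h2)
      calc _ = |Γ.discount * (∫ s, P' s ∂(stateOccupation Γ π φ')
              - ∫ s, P s ∂(stateOccupation Γ π φ))| := by congr 1; ring
        _ ≤ Γ.discount * (K * (2 * Γ.discount ^ n + C / (1 - Γ.discount)) + K * C) := by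
            rw [abs_mul, abs_of_pos hγ0]; gcongr
        _ = K * (2 * Γ.discount ^ (n + 1)
              + C * (Γ.discount / (1 - Γ.discount) + Γ.discount)) := by
            rw [pow_succ]; ring
        _ ≤ _ := by
            have : Γ.discount / (1 - Γ.discount) + Γ.discount ≤ 1 / (1 - Γ.discount) := by
              rw [div_add' _ _ _ hγ.ne']
              gcongr
              nlinarith [sq_nonneg (1 - Γ.discount)]
            have h4 : C / (1 - Γ.discount) = C * (1 / (1 - Γ.discount)) := by ring
            rw [h4]
            gcongr
  have hlim : Tendsto (fun n : ℕ => K * (2 * Γ.discount ^ n + C / (1 - Γ.discount))) atTop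
      (𝓝 (K * (2 * 0 + C / (1 - Γ.discount)))) :=
    (((tendsto_pow_atTop_nhds_zero_of_lt_one hγ0.le Γ.discount_lt_one).const_mul 2).add_const
      _).const_mul K
  rw [mul_zero, zero_add] at hlim
  exact ge_of_tendsto' hlim fun n => key n g hg hgK

/-- The joint utilities have uniform first order expansions with quadratic remainder. -/
theorem jointUtility_expansion (h : ScoreAssumption π B V L) (hL : 0 ≤ L)
    (hR : BoundedReward Γ R) (hR0 : 0 ≤ R) :
    ∃ C : ℝ, 0 ≤ C ∧ ∀ (i : ι) (φ φ' : ι → Param M),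
      |jointUtility Γ π i φ' - jointUtility Γ π i φ - utilityDeriv h hR i φ (φ' - φ)|
        ≤ C * ‖φ' - φ‖ ^ 2 := by
  obtain ⟨C, hC, hexp⟩ := h.joint_expansion hL
  have hγ := Γ.one_sub_discount_pos
  set K := R / (1 - Γ.discount) with hK
  have hK0 : 0 ≤ K := by positivity
  set C₁ := (1 - Γ.discount)⁻¹ * (K * C * (C / (1 - Γ.discount)) + K * C) with hC₁
  set C₂ := (1 - Γ.discount)⁻¹ * K * (Fintype.card ι * (1 + Fintype.card ι * V ^ 2)) with hC₂
  have hC₁0 : 0 ≤ C₁ := by positivity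
  have hC₂0 : 0 ≤ C₂ := by positivity
  refine ⟨C₁ + (K + K + C₂), by positivity, fun i φ φ' => ?_⟩
  set δ := ‖φ' - φ‖ with hδ
  have hδ0 : 0 ≤ δ := norm_nonneg _
  -- For `δ > 1` the quadratic bound is trivial: the values are bounded, the derivative is linear in
  -- the displacement, and `1 ≤ δ ≤ δ ^ 2`.
  rcases le_or_gt δ 1 with hδ1 | hδ1
  · have hQ := hR.measurable_qValue (π := π) i φ
    have hQb := hR.abs_qValue_le (π := π) i φ
    set D : S → ℝ := fun s => ∫ a, qValue Γ π i φ (s, a) ∂(π.joint (φ', s))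
          - ∫ a, qValue Γ π i φ (s, a) ∂(π.joint (φ, s)) with hD
    set X : S → ℝ := fun s => ∫ a, qValue Γ π i φ (s, a) * scoreDir π φ (φ' - φ) (s, a)
      ∂(π.joint (φ, s)) with hX
    have hDm : Measurable D := (measurable_integral_joint π φ' hQ).sub
      (measurable_integral_joint π φ hQ)
    have hXm : Measurable X :=
      measurable_integral_joint π φ (hQ.mul (measurable_scoreDir π φ (φ' - φ)))
    have hDb : ∀ s, |D s| ≤ K * C * δ := fun s =>
      (hexp φ φ' hδ1 s _ (hQ.comp measurable_prodMk_left) K hK0 fun a => hQb (s, a)).1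
    have hDX : ∀ s, |D s - X s| ≤ K * C * δ ^ 2 := fun s =>
      (hexp φ φ' hδ1 s _ (hQ.comp measurable_prodMk_left) K hK0 fun a => hQb (s, a)).2
    have hXb : ∀ s, |X s| ≤ K * C * δ + K * C * δ ^ 2 := fun s => by
      calc |X s| = |D s - (D s - X s)| := by congr 1; ring
        _ ≤ _ := (abs_sub _ _).trans (add_le_add (hDb s) (hDX s))
    -- The exact difference is the mean of `D` over the new occupation measure. Passing to the old
    -- measure costs `O(δ ^ 2)`, as `D` and the change of measure are each `O(δ)`; replacing `D` by
    -- its linearization `X` costs `O(δ ^ 2)` as well.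
    have e1 := hR.performance_difference (π := π) i φ φ'
    have e2 : |∫ s, D s ∂(stateOccupation Γ π φ') - ∫ s, D s ∂(stateOccupation Γ π φ)|
        ≤ K * C * δ * (C * δ / (1 - Γ.discount)) :=
      abs_integral_stateOccupation_sub_le (by positivity)
        (fun s q hq K' hK' hqK => by
          rw [← mul_assoc]; exact (hexp φ φ' hδ1 s q hq K' hK' hqK).1) hDm (by positivity) hDb
    have e3 : |∫ s, D s ∂(stateOccupation Γ π φ) - ∫ s, X s ∂(stateOccupation Γ π φ)|
        ≤ K * C * δ ^ 2 := by
      rw [← integral_sub (integrable_of_abs_le hDm hDb) (integrable_of_abs_le hXm hXb)]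
      exact abs_integral_le_of_abs_le hDX
    have e4 : (1 - Γ.discount) * utilityDeriv h hR i φ (φ' - φ)
        = ∫ s, X s ∂(stateOccupation Γ π φ) := by
      rw [utilityDeriv_apply, mul_inv_cancel_left₀ hγ.ne', integral_occupation Γ π φ
        (g := fun x => qValue Γ π i φ x * scoreDir π φ (φ' - φ) x)
        (hQ.mul (measurable_scoreDir π φ (φ' - φ))).stronglyMeasurable
        (h.integrable_qValue_mul_scoreDir hR i φ _)]
    have e5 : |(1 - Γ.discount) * (jointUtility Γ π i φ' - jointUtility Γ π i φ
        - utilityDeriv h hR i φ (φ' - φ))| ≤ K * C * δ * (C * δ / (1 - Γ.discount))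
          + K * C * δ ^ 2 := by
      rw [mul_sub, e1, e4]
      exact (abs_sub_le _ _ _).trans (add_le_add e2 e3)
    rw [abs_mul, abs_of_pos hγ, ← le_div_iff₀' hγ] at e5
    refine e5.trans ?_
    calc _ = C₁ * δ ^ 2 := by rw [hC₁]; ring
      _ ≤ _ := by gcongr; linarith
  · have h1 := hR.abs_jointUtility_le (π := π) i φ
    have h2 := hR.abs_jointUtility_le (π := π) i φ'
    have h3 := abs_utilityDeriv_le h hR hR0 i φ (φ' - φ)
    rw [← hδ, ← hK, ← hC₂] at h3
    calc _ ≤ K + K + C₂ * δ :=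
          (abs_sub _ _).trans (add_le_add ((abs_sub _ _).trans (add_le_add h2 h1)) h3)
      _ ≤ (K + K) * δ ^ 2 + C₂ * δ ^ 2 := by
          gcongr
          · exact le_mul_of_one_le_right (by positivity) (by nlinarith)
          · nlinarith
      _ ≤ _ := by rw [← add_mul]; exact mul_le_mul_of_nonneg_right (by linarith) (by positivity)

lemma norm_const_le {E : Type*} [NormedAddCommGroup E] (w : E) : ‖(fun _ : ι => w)‖ ≤ ‖w‖ :=
  pi_norm_const_le w

/-- The policy gradient theorem. -/
theorem inner_gradient_utility (h : ScoreAssumption π B V L) (hL : 0 ≤ L)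
    (hR : BoundedReward Γ R) (hR0 : 0 ≤ R) (i : ι)
    (hdiff : Differentiable ℝ (utility Γ π i)) (θ w : Param M) :
    inner ℝ (gradient (utility Γ π i) θ) w = utilityDeriv h hR i (fun _ => θ) (fun _ => w) := by
  obtain ⟨C, hC, hexp⟩ := jointUtility_expansion (Γ := Γ) h hL hR hR0
  -- A displacement of `θ` moves the copies of all agents simultaneously, so the expansion is
  -- restricted to constant families; its quadratic remainder makes `Λ` the Fréchet derivative.
  let Λ : Param M →ₗ[ℝ] ℝ := (utilityDeriv h hR i (fun _ => θ)) ∘ₗ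
    (LinearMap.pi fun _ => LinearMap.id)
  have hΛ : ∀ w, Λ w = utilityDeriv h hR i (fun _ => θ) (fun _ => w) := fun w => rfl
  have hd : HasFDerivAt (utility Γ π i) (LinearMap.toContinuousLinearMap Λ) θ := by
    rw [hasFDerivAt_iff_isLittleO_nhds_zero]
    refine IsBigO.trans_isLittleO (g := fun v : Param M => ‖v‖ ^ 2) ?_
      (isLittleO_norm_pow_id one_lt_two)
    refine IsBigO.of_bound C (Eventually.of_forall fun v => ?_)
    have := hexp i (fun _ => θ) (fun _ => θ + v)
    have e : (fun _ : ι => θ + v) - (fun _ : ι => θ) = fun _ => v := by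
      funext; simp
    rw [e] at this
    rw [hR.utility_eq, hR.utility_eq, Real.norm_eq_abs, LinearMap.coe_toContinuousLinearMap', hΛ,
      norm_pow, norm_norm]
    exact this.trans (by gcongr; exact norm_const_le v)
  have := hd.unique (hdiff.hasFDerivAt_gradient θ)
  have e := congrArg (fun l : Param M →L[ℝ] ℝ => l w) this
  simp only [LinearMap.coe_toContinuousLinearMap', InnerProductSpace.toDual_apply_apply] at e
  rw [← e, hΛ]

end Utility
end


noncomputable section

/-! ### The law of an episode and the mean of the stochastic gradient -/

section Collected

variable {ι S A : Type*} [MeasurableSpace S] [MeasurableSpace A]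

/-- The law of the horizons `T₂`, `T₂'`. -/
def rewardHorizonLaw (Γ : MarkovGame ι S A) : Measure ℕ :=
  geometricMeasure
    ⟨1 - √Γ.discount,
      sub_nonneg.2 (Real.sqrt_le_one.2 Γ.discount_lt_one.le),
      sub_le_self _ (Real.sqrt_nonneg _)⟩

instance (Γ : MarkovGame ι S A) : IsProbabilityMeasure (rewardHorizonLaw Γ) := by
  unfold rewardHorizonLaw; infer_instance

lemma MarkovGame.sqrt_discount_lt_one (Γ : MarkovGame ι S A) : √Γ.discount < 1 := by
  rw [Real.sqrt_lt' one_pos, one_pow]; exact Γ.discount_lt_one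

lemma integral_rewardHorizonLaw (Γ : MarkovGame ι S A) (f : ℕ → ℝ) :
    ∫ n, f n ∂(rewardHorizonLaw Γ) = ∑' n, √Γ.discount ^ n * (1 - √Γ.discount) * f n := by
  rw [rewardHorizonLaw, integral_geometricMeasure]
  · simp
  · intro h
    have := congrArg Subtype.val h
    change 1 - √Γ.discount = 0 at this
    linarith [Γ.sqrt_discount_lt_one]

lemma collected_eq (Γ : MarkovGame ι S A) (i : ι) (x : Play ι S A) (k T : ℕ) :
    collected Γ i x k T
      = ∑ t ∈ Finset.range (T + 1), √Γ.discount ^ t * Γ.reward i (x (k + t)) := by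
  refine Finset.sum_congr rfl fun t _ => ?_
  rw [Real.sqrt_eq_rpow, ← Real.rpow_natCast (Γ.discount ^ (1 / 2 : ℝ)), ← Real.rpow_mul
    Γ.discount_pos.le]
  congr 2
  ring

variable {Γ : MarkovGame ι S A} {R : ℝ}

lemma BoundedReward.abs_collected_le (hR : BoundedReward Γ R) (hR0 : 0 ≤ R) (i : ι)
    (x : Play ι S A) (k T : ℕ) : |collected Γ i x k T| ≤ R / (1 - √Γ.discount) := by
  have h0 := Real.sqrt_nonneg Γ.discount
  have h1 := Γ.sqrt_discount_lt_one
  rw [collected_eq]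
  calc _ ≤ ∑ t ∈ Finset.range (T + 1), √Γ.discount ^ t * R := by
        refine (Finset.abs_sum_le_sum_abs _ _).trans (Finset.sum_le_sum fun t _ => ?_)
        rw [abs_mul, abs_of_nonneg (pow_nonneg h0 t)]
        exact mul_le_mul_of_nonneg_left (hR i _) (pow_nonneg h0 t)
    _ ≤ ∑' t : ℕ, √Γ.discount ^ t * R := ((summable_geometric_of_lt_one h0 h1).mul_right R).sum_le_tsum
        _ fun t _ => mul_nonneg (pow_nonneg h0 t) hR0
    _ = R / (1 - √Γ.discount) := by
        rw [tsum_mul_right, tsum_geometric_of_lt_one h0 h1, inv_mul_eq_div]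

/-- Summation by parts for geometrically weighted partial sums. -/
lemma tsum_geometric_mul_sum {b C : ℝ} (h0 : 0 ≤ b) (h1 : b < 1) {a s : ℕ → ℝ}
    (hs0 : s 0 = a 0) (hs1 : ∀ n, s (n + 1) = s n + b ^ (n + 1) * a (n + 1))
    (ha : ∀ t, |a t| ≤ C) {D : ℝ} (hs : ∀ t, |s t| ≤ D) :
    ∑' n, b ^ n * (1 - b) * s n = ∑' t, (b * b) ^ t * a t := by
  -- Probabilistically, the horizon reaches `t` with probability `b ^ t`, and this multiplies the
  -- weight `b ^ t` already present in the partial sum. With `b = √γ` the product is `γ ^ t`.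
  have hS : Summable fun n => b ^ n * s n := summable_discounted h0 h1 hs
  have hS1 : Summable fun n => b ^ (n + 1) * s (n + 1) := (summable_nat_add_iff 1).2 hS
  have hA : Summable fun t => (b * b) ^ t * a t :=
    summable_discounted (mul_nonneg h0 h0) (by nlinarith) ha
  have e1 : ∑' n, b ^ n * (1 - b) * s n = ∑' n, b ^ n * s n - b * ∑' n, b ^ n * s n := by
    rw [← tsum_mul_left, ← Summable.tsum_sub hS (hS.mul_left b)]
    exact tsum_congr fun n => by ring
  have e2 : ∑' n, b ^ n * s n = s 0 + ∑' n, b ^ (n + 1) * s (n + 1) := by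
    rw [hS.tsum_eq_zero_add, pow_zero, one_mul]
  have e3 : ∑' n, b ^ (n + 1) * s (n + 1) - b * ∑' n, b ^ n * s n
      = ∑' t : ℕ, (b * b) ^ (t + 1) * a (t + 1) := by
    rw [← tsum_mul_left, ← Summable.tsum_sub hS1 (hS.mul_left b)]
    refine tsum_congr fun n => ?_
    rw [hs1, mul_pow]
    ring
  rw [e1, hA.tsum_eq_zero_add, ← e3, pow_zero, one_mul, ← hs0]
  linarith [e2]

/-- Averaging over the horizon turns the collected rewards into the discounted sum. -/
lemma BoundedReward.integral_collected (hR : BoundedReward Γ R) (hR0 : 0 ≤ R) (i : ι)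
    (x : Play ι S A) (k : ℕ) :
    ∫ T, collected Γ i x k T ∂(rewardHorizonLaw Γ)
      = ∑' t : ℕ, Γ.discount ^ t * Γ.reward i (x (k + t)) := by
  have := tsum_geometric_mul_sum (Real.sqrt_nonneg Γ.discount) Γ.sqrt_discount_lt_one
    (a := fun t => Γ.reward i (x (k + t))) (s := fun n => collected Γ i x k n)
    (by rw [collected_eq]; simp)
    (fun n => by rw [collected_eq, collected_eq, Finset.sum_range_succ _ (n + 1)])
    (fun t => hR i _) (fun n => hR.abs_collected_le hR0 i x k n)
  rw [integral_rewardHorizonLaw, this, Real.mul_self_sqrt Γ.discount_pos.le]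

lemma measurable_collected (Γ : MarkovGame ι S A) (i : ι) :
    Measurable fun p : (ℕ × ℕ) × Play ι S A => collected Γ i p.2 p.1.1 p.1.2 := by
  refine measurable_from_prod_countable_right fun q => ?_
  have h : Measurable fun x : Play ι S A => ∑ t ∈ Finset.range (q.2 + 1),
      Γ.discount ^ ((t : ℝ) / 2) * Γ.reward i (x (q.1 + t)) :=
    Finset.measurable_sum _ fun t _ =>
      ((Γ.measurable_reward i).comp (measurable_pi_apply (q.1 + t))).const_mul _
  exact h

lemma measurable_rewardEstimate (Γ : MarkovGame ι S A) (i : ι) (e : RewardEstimator) :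
    Measurable (rewardEstimate Γ i e) := by
  have hx : Measurable fun d : Episode ι S A => collected Γ i d.1.1.2 d.1.1.1 d.2.1 :=
    (measurable_collected Γ i).comp
      (f := fun d : Episode ι S A => ((d.1.1.1, d.2.1), d.1.1.2)) (by fun_prop)
  have hx' : Measurable fun d : Episode ι S A => collected Γ i d.1.1.2 (d.1.1.1 + 1) d.2.1 :=
    (measurable_collected Γ i).comp
      (f := fun d : Episode ι S A => ((d.1.1.1 + 1, d.2.1), d.1.1.2)) (by fun_prop)
  have hy : Measurable fun d : Episode ι S A => collected Γ i d.1.2 0 d.2.2 :=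
    (measurable_collected Γ i).comp
      (f := fun d : Episode ι S A => ((0, d.2.2), d.1.2)) (by fun_prop)
  have hr : Measurable fun d : Episode ι S A => Γ.reward i (d.1.1.2 d.1.1.1) :=
    (Γ.measurable_reward i).comp (measurable_eval_horizon.comp
      (measurable_fst.comp measurable_fst))
  cases e with
  | qFunction => exact hx
  | advantage => exact hx.sub hy
  | temporalDifference => exact (hr.add (hx'.const_mul _)).sub hy

lemma measurable_episode_eval :
    Measurable fun d : Episode ι S A => d.1.1.2 d.1.1.1 :=
  measurable_eval_horizon.comp (measurable_fst.comp measurable_fst)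

/-- A bound for all the reward estimates. -/
def rewardBound (Γ : MarkovGame ι S A) (R : ℝ) : ℝ := R + 2 * (R / (1 - √Γ.discount))

lemma rewardBound_nonneg (Γ : MarkovGame ι S A) (hR0 : 0 ≤ R) : 0 ≤ rewardBound Γ R := by
  have : 0 < 1 - √Γ.discount := by linarith [Γ.sqrt_discount_lt_one]
  unfold rewardBound; positivity

lemma BoundedReward.abs_rewardEstimate_le (hR : BoundedReward Γ R) (hR0 : 0 ≤ R) (i : ι)
    (e : RewardEstimator) (d : Episode ι S A) :
    |rewardEstimate Γ i e d| ≤ rewardBound Γ R := by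
  have hK : 0 ≤ R / (1 - √Γ.discount) :=
    div_nonneg hR0 (by linarith [Γ.sqrt_discount_lt_one])
  obtain ⟨⟨⟨T₁, x⟩, y⟩, T₂, T₂'⟩ := d
  have hc := hR.abs_collected_le hR0 i
  unfold rewardBound
  cases e with
  | qFunction => exact (hc _ _ _).trans (by linarith)
  | advantage =>
    exact (abs_sub _ _).trans ((add_le_add (hc _ _ _) (hc _ _ _)).trans (by linarith))
  | temporalDifference =>
    have h1 : |Γ.discount * collected Γ i x (T₁ + 1) T₂| ≤ R / (1 - √Γ.discount) := by
      rw [abs_mul, abs_of_pos Γ.discount_pos]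
      exact (mul_le_of_le_one_left (abs_nonneg _) Γ.discount_lt_one.le).trans (hc _ _ _)
    exact (abs_sub _ _).trans ((add_le_add ((abs_add_le _ _).trans (add_le_add (hR i _) h1))
      (hc _ _ _)).trans (by linarith))

/-- Whether the estimator subtracts the value function as a baseline. -/
def RewardEstimator.baseline : RewardEstimator → ℝ
  | .qFunction => 0
  | .advantage => 1
  | .temporalDifference => 1

/-- The three estimators averaged over the horizons. -/
lemma BoundedReward.integral_rewardEstimate (hR : BoundedReward Γ R) (hR0 : 0 ≤ R) (i : ι)
    (e : RewardEstimator) (p : (ℕ × Play ι S A) × Play ι S A) :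
    ∫ q, rewardEstimate Γ i e (p, q) ∂((rewardHorizonLaw Γ).prod (rewardHorizonLaw Γ))
      = ∑' t : ℕ, Γ.discount ^ t * Γ.reward i (p.1.2 (p.1.1 + t))
        - e.baseline * ∑' t : ℕ, Γ.discount ^ t * Γ.reward i (p.2 t) := by
  obtain ⟨⟨k, x⟩, y⟩ := p
  have hint : ∀ (z : Play ι S A) (m : ℕ), Integrable (fun n => collected Γ i z m n)
      (rewardHorizonLaw Γ) := fun z m =>
    integrable_of_abs_le (Measurable.of_discrete) fun n => hR.abs_collected_le hR0 i z m n
  have h1 : ∀ (z : Play ι S A) (m : ℕ), ∫ q : ℕ × ℕ, collected Γ i z m q.1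
      ∂((rewardHorizonLaw Γ).prod (rewardHorizonLaw Γ))
      = ∑' t : ℕ, Γ.discount ^ t * Γ.reward i (z (m + t)) := fun z m => by
    rw [integral_prod _ ((hint z m).comp_fst _)]
    simp [hR.integral_collected hR0]
  have h2 : ∀ (z : Play ι S A) (m : ℕ), ∫ q : ℕ × ℕ, collected Γ i z m q.2
      ∂((rewardHorizonLaw Γ).prod (rewardHorizonLaw Γ))
      = ∑' t : ℕ, Γ.discount ^ t * Γ.reward i (z (m + t)) := fun z m => by
    rw [integral_prod _ ((hint z m).comp_snd _)]
    simp [hR.integral_collected hR0]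
  have i1 : ∀ (z : Play ι S A) (m : ℕ), Integrable (fun q : ℕ × ℕ => collected Γ i z m q.1)
      ((rewardHorizonLaw Γ).prod (rewardHorizonLaw Γ)) := fun z m => (hint z m).comp_fst _
  have i2 : ∀ (z : Play ι S A) (m : ℕ), Integrable (fun q : ℕ × ℕ => collected Γ i z m q.2)
      ((rewardHorizonLaw Γ).prod (rewardHorizonLaw Γ)) := fun z m => (hint z m).comp_snd _
  cases e with
  | qFunction =>
    simp only [rewardEstimate, RewardEstimator.baseline, h1]
    ring
  | advantage =>
    simp only [rewardEstimate, RewardEstimator.baseline]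
    rw [integral_sub (i1 x k) (i2 y 0), h1, h2]
    simp
  | temporalDifference =>
    simp only [rewardEstimate, RewardEstimator.baseline]
    have i3 : Integrable (fun q : ℕ × ℕ => Γ.reward i (x k)
        + Γ.discount * collected Γ i x (k + 1) q.1)
        ((rewardHorizonLaw Γ).prod (rewardHorizonLaw Γ)) :=
      (integrable_const _).add ((i1 x (k + 1)).const_mul _)
    rw [integral_sub i3 (i2 y 0), integral_add (integrable_const _) ((i1 x (k + 1)).const_mul _),
      integral_const_mul, h1, h2]
    -- The reward at time `k` plus `γ` times the discounted sum from `k + 1` is the discounted sum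
    -- from `k`, so after averaging the temporal difference agrees with the advantage estimate.
    have hs : Summable fun t => Γ.discount ^ t * Γ.reward i (x (k + t)) :=
      summable_discounted Γ.discount_pos.le Γ.discount_lt_one fun t => hR i _
    rw [hs.tsum_eq_zero_add, ← tsum_mul_left]
    simp only [integral_const, probReal_univ, smul_eq_mul, one_mul, pow_zero, add_zero, zero_add]
    congr 2
    refine tsum_congr fun t => ?_
    rw [pow_succ, show k + 1 + t = k + (t + 1) by ring]
    ring

end Collected

section Episode

variable {ι S A : Type*} [Fintype ι] [MeasurableSpace S] [MeasurableSpace A] {M : ι → ℕ}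
  {ν : Measure A} [SigmaFinite ν]

/-- The second play, restarted from the state at time `T₁`. -/
def restartLaw (Γ : MarkovGame ι S A) (π : ParamPolicy ι S A M ν) (φ : ι → Param M) :
    Kernel (ℕ × Play ι S A) (Play ι S A) :=
  (pathLaw Γ π).comap (fun q => (φ, (q.2 q.1).1)) (measurable_const.prodMk measurable_state_horizon)

instance (Γ : MarkovGame ι S A) (π : ParamPolicy ι S A M ν) (φ : ι → Param M) :
    IsMarkovKernel (restartLaw Γ π φ) := by
  unfold restartLaw; infer_instance

lemma episodeLaw_apply (Γ : MarkovGame ι S A) (π : ParamPolicy ι S A M ν) (φ : ι → Param M) :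
    episodeLaw Γ π φ = ((((horizonLaw Γ).prod (playLaw Γ π φ)) ⊗ₘ restartLaw Γ π φ).prod
      ((rewardHorizonLaw Γ).prod (rewardHorizonLaw Γ))) := by
  simp only [episodeLaw]
  rw [Kernel.prod_apply, Kernel.compProd_apply_eq_compProd_sectR, Kernel.prod_apply,
    Kernel.const_apply, Kernel.const_apply]
  rfl

instance (Γ : MarkovGame ι S A) (π : ParamPolicy ι S A M ν) : IsMarkovKernel (episodeLaw Γ π) :=
  ⟨fun φ => by rw [episodeLaw_apply]; infer_instance⟩

/-- The restarted play and the reward horizons are integrated out, which leaves the first play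
observed at an independent geometric time. -/
lemma episodeLaw_map_eval (Γ : MarkovGame ι S A) (π : ParamPolicy ι S A M ν) (φ : ι → Param M) :
    (episodeLaw Γ π φ).map (fun d => d.1.1.2 d.1.1.1) = occupation Γ π φ := by
  have e : (fun d : Episode ι S A => d.1.1.2 d.1.1.1)
      = (fun q : ℕ × Play ι S A => q.2 q.1) ∘ Prod.fst ∘ Prod.fst := rfl
  rw [e, ← Measure.map_map measurable_eval_horizon (by fun_prop),
    ← Measure.map_map measurable_fst measurable_fst, episodeLaw_apply]
  have h1 := Measure.fst_prod (μ := ((horizonLaw Γ).prod (playLaw Γ π φ)) ⊗ₘ restartLaw Γ π φ)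
    (ν := (rewardHorizonLaw Γ).prod (rewardHorizonLaw Γ))
  have h2 := Measure.fst_compProd ((horizonLaw Γ).prod (playLaw Γ π φ)) (restartLaw Γ π φ)
  rw [Measure.fst] at h1 h2
  rw [h1, h2]
  rfl

variable {Γ : MarkovGame ι S A} {π : ParamPolicy ι S A M ν} {B V L R : ℝ}

lemma integrable_episode_eval {E : Type*} [NormedAddCommGroup E] {φ : ι → Param M} {f : StateAction ι S A → E}
    (hf : Integrable f (occupation Γ π φ)) :
    Integrable (fun d => f (d.1.1.2 d.1.1.1)) (episodeLaw Γ π φ) := by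
  rw [← episodeLaw_map_eval] at hf
  exact hf.comp_measurable measurable_episode_eval

variable {E : Type*} [NormedAddCommGroup E] [NormedSpace ℝ E] [CompleteSpace E]

/-- The mean of the reward estimate times a function of the state-action pair at time `T₁`. -/
theorem BoundedReward.integral_episode (hR : BoundedReward Γ R) (hR0 : 0 ≤ R) (i : ι)
    (e : RewardEstimator) (φ : ι → Param M) {f : StateAction ι S A → E}
    (hf : StronglyMeasurable f) (hfi : Integrable f (occupation Γ π φ)) :
    ∫ d, rewardEstimate Γ i e d • f (d.1.1.2 d.1.1.1) ∂(episodeLaw Γ π φ)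
      = ∫ x, (qValue Γ π i φ x - e.baseline * stateValue Γ π i φ x.1) • f x
        ∂(occupation Γ π φ) := by
  have hγ0 := Γ.discount_pos.le
  have hγ1 := Γ.discount_lt_one
  have hint : Integrable (fun d => rewardEstimate Γ i e d • f (d.1.1.2 d.1.1.1))
      (episodeLaw Γ π φ) :=
    (integrable_episode_eval hfi).bdd_smul _ (measurable_rewardEstimate Γ i e).aestronglyMeasurable
      (ae_of_all _ fun d => hR.abs_rewardEstimate_le hR0 i e d)
  set H : ℕ × Play ι S A → ℝ := fun q => ∑' t : ℕ, Γ.discount ^ t * Γ.reward i (q.2 (q.1 + t))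
    with hH
  set Y : Play ι S A → ℝ := fun y => ∑' t : ℕ, Γ.discount ^ t * Γ.reward i (y t) with hY
  set K := R / (1 - Γ.discount)
  have hHm : Measurable H := by
    refine measurable_from_prod_countable_right fun k => ?_
    exact measurable_tsum_discounted hγ0 hγ1
      (fun t => (Γ.measurable_reward i).comp (measurable_pi_apply (k + t))) fun t x => hR i _
  have hYm : Measurable Y := measurable_tsum_discounted hγ0 hγ1
      (fun t => (Γ.measurable_reward i).comp (measurable_pi_apply t)) fun t x => hR i _
  have hHb : ∀ q, |H q| ≤ K := fun q => abs_tsum_discounted_le hγ0 hγ1 fun t => hR i _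
  have hYb : ∀ q, |Y q| ≤ K := fun q => abs_tsum_discounted_le hγ0 hγ1 fun t => hR i _
  have hfe : Integrable (fun q : ℕ × Play ι S A => f (q.2 q.1))
      ((horizonLaw Γ).prod (playLaw Γ π φ)) := by
    rw [occupation] at hfi
    exact hfi.comp_measurable measurable_eval_horizon
  have hVm := hR.measurable_stateValue (π := π) i φ
  have hVb := hR.abs_stateValue_le (π := π) i φ
  have hQm := hR.measurable_qValue (π := π) i φ
  have hQb := hR.abs_qValue_le (π := π) i φ
  rw [episodeLaw_apply] at hint ⊢
  -- The randomness is integrated from the inside out: reward horizons, then the restarted play,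
  -- whose mean given the state is the state value, then the continuation of the first play after
  -- `T₁`.
  rw [integral_prod _ hint]
  have e1 : ∀ p : (ℕ × Play ι S A) × Play ι S A,
      ∫ q, rewardEstimate Γ i e (p, q) • f (p.1.2 p.1.1)
        ∂((rewardHorizonLaw Γ).prod (rewardHorizonLaw Γ))
      = (H p.1 - e.baseline * Y p.2) • f (p.1.2 p.1.1) := fun p => by
    rw [integral_smul_const, hR.integral_rewardEstimate hR0]
  simp_rw [e1]
  have hint2 : Integrable (fun p : (ℕ × Play ι S A) × Play ι S A =>
      (H p.1 - e.baseline * Y p.2) • f (p.1.2 p.1.1))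
      (((horizonLaw Γ).prod (playLaw Γ π φ)) ⊗ₘ restartLaw Γ π φ) :=
    (hint.integral_prod_left).congr (ae_of_all _ e1)
  rw [Measure.integral_compProd hint2]
  have e2 : ∀ q : ℕ × Play ι S A, ∫ y, (H q - e.baseline * Y y) • f (q.2 q.1)
      ∂(restartLaw Γ π φ q)
      = (H q - e.baseline * stateValue Γ π i φ (q.2 q.1).1) • f (q.2 q.1) := fun q => by
    rw [integral_smul_const, integral_sub (integrable_const _)
      ((integrable_of_abs_le hYm hYb).const_mul _), integral_const_mul, restartLaw,
      Kernel.comap_apply, hY, hR.integral_pathLaw]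
    simp
  simp_rw [e2]
  have hint3 : Integrable (fun q : ℕ × Play ι S A => H q • f (q.2 q.1))
      ((horizonLaw Γ).prod (playLaw Γ π φ)) :=
    hfe.bdd_smul _ hHm.aestronglyMeasurable (ae_of_all _ hHb)
  have hint4 : Integrable (fun q : ℕ × Play ι S A =>
      (e.baseline * stateValue Γ π i φ (q.2 q.1).1) • f (q.2 q.1))
      ((horizonLaw Γ).prod (playLaw Γ π φ)) := by
    refine hfe.bdd_smul (|e.baseline| * K)
      ((hVm.comp measurable_state_horizon).const_mul _).aestronglyMeasurable
      (ae_of_all _ fun q => ?_)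
    rw [norm_mul]
    exact mul_le_mul_of_nonneg_left (hVb _) (abs_nonneg _)
  have hint5 : Integrable (fun q : ℕ × Play ι S A => qValue Γ π i φ (q.2 q.1) • f (q.2 q.1))
      ((horizonLaw Γ).prod (playLaw Γ π φ)) :=
    hfe.bdd_smul _ (hQm.comp measurable_eval_horizon).aestronglyMeasurable
      (ae_of_all _ fun q => hQb _)
  have e3 : ∫ q, H q • f (q.2 q.1) ∂((horizonLaw Γ).prod (playLaw Γ π φ))
      = ∫ q, qValue Γ π i φ (q.2 q.1) • f (q.2 q.1) ∂((horizonLaw Γ).prod (playLaw Γ π φ)) := by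
    rw [integral_prod _ hint3, integral_prod _ hint5]
    refine integral_congr_ae ?_
    -- The Markov property is applied for fixed `T₁ = k`. Integrability of `f` at time `k` is
    -- inherited from the occupation measure only for almost every `k`.
    filter_upwards [hfe.prod_right_ae] with k hk
    exact (playLaw_isMarkovChain Γ π φ).integral_discounted hγ0 hγ1 (Γ.measurable_reward i)
      (hR i) k hf hk
  simp_rw [sub_smul]
  rw [integral_sub hint3 hint4, e3, ← integral_sub hint5 hint4, occupation,
    integral_map measurable_eval_horizon.aemeasurable]
  exact ((hQm.stronglyMeasurable.smul hf).sub
    (((hVm.comp measurable_fst).const_mul _).stronglyMeasurable.smul hf)).aestronglyMeasurable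

end Episode
end


noncomputable section

/-! ### Mean, second moment and bias of the stochastic gradient -/

section StochasticGradient

variable {ι S A : Type*} [Fintype ι] [MeasurableSpace S] [MeasurableSpace A] {M : ι → ℕ}
  {ν : Measure A}

/-- The sum of the scores `∇_i log π_{n,φ_n}(a_n | s)` over the agents `n`. -/
def totalScore (π : ParamPolicy ι S A M ν) (i : ι) (φ : ι → Param M) (x : StateAction ι S A) :
    EuclideanSpace ℝ (Fin (M i)) :=
  ∑ n, π.score i n (φ n) x.1 (x.2 n)

lemma measurable_totalScore (π : ParamPolicy ι S A M ν) (i : ι) :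
    Measurable fun p : (ι → Param M) × StateAction ι S A => totalScore π i p.1 p.2 := by
  refine Finset.measurable_sum _ fun n _ => ?_
  have h1 : Measurable fun g : Param M => g i := by fun_prop
  have h2 : Measurable fun p : (ι → Param M) × StateAction ι S A =>
      ((p.1 n, p.2.1), p.2.2 n) := by fun_prop
  exact h1.comp ((π.measurable_gradLog n).comp h2)

lemma measurable_totalScore_right (π : ParamPolicy ι S A M ν) (i : ι) (φ : ι → Param M) :
    Measurable fun x => totalScore π i φ x := by
  have h : Measurable fun x : StateAction ι S A => (φ, x) := measurable_prodMk_left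
  have h2 := Measurable.comp (measurable_totalScore π i) h
  exact h2

lemma Param.inner_single_right [DecidableEq ι] (x : Param M) (i : ι)
    (w : EuclideanSpace ℝ (Fin (M i))) :
    inner ℝ x (PiLp.single 2 i w : Param M) = inner ℝ (x i) w := by
  rw [PiLp.inner_apply, Finset.sum_eq_single i]
  · simp
  · intro j _ hj
    simp [hj]
  · simp

/-- Block `i` of a gradient is tested by vectors supported in block `i`. The total score of agent
`i` is therefore the logarithmic derivative of the joint policy when block `i` is moved in the
copies of all agents. -/
lemma inner_totalScore [DecidableEq ι] (π : ParamPolicy ι S A M ν) (i : ι) (φ : ι → Param M)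
    (x : StateAction ι S A) (w : EuclideanSpace ℝ (Fin (M i))) :
    inner ℝ (totalScore π i φ x) w
      = scoreDir π φ (fun _ => PiLp.single 2 i w) x := by
  rw [totalScore, scoreDir, sum_inner]
  refine Finset.sum_congr rfl fun n _ => ?_
  rw [Param.inner_single_right]
  rfl

/-- The stochastic gradient with the scores of the agents `n` evaluated at the parameters `φ n`
by which they act. -/
def actingGradient (Γ : MarkovGame ι S A) (π : ParamPolicy ι S A M ν) (c : ℝ)
    (e : RewardEstimator) (i : ι) (φ : ι → Param M) (d : Episode ι S A) :
    EuclideanSpace ℝ (Fin (M i)) :=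
  (c * rewardEstimate Γ i e d) • totalScore π i φ (d.1.1.2 d.1.1.1)

lemma stochGradient_eq (Γ : MarkovGame ι S A) (π : ParamPolicy ι S A M ν) (c : ℝ)
    (e : RewardEstimator) (i : ι) (ψ : Param M) (d : Episode ι S A) :
    stochGradient Γ π c e i ψ d = actingGradient Γ π c e i (fun _ => ψ) d := rfl

lemma measurable_actingGradient (Γ : MarkovGame ι S A) (π : ParamPolicy ι S A M ν) (c : ℝ)
    (e : RewardEstimator) (i : ι) :
    Measurable fun p : (ι → Param M) × Episode ι S A => actingGradient Γ π c e i p.1 p.2 := by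
  have h1 : Measurable fun p : (ι → Param M) × Episode ι S A => c * rewardEstimate Γ i e p.2 :=
    ((measurable_rewardEstimate Γ i e).comp measurable_snd).const_mul c
  have h2 : Measurable fun p : (ι → Param M) × Episode ι S A => (p.1, p.2.1.1.2 p.2.1.1.1) :=
    measurable_fst.prodMk (measurable_episode_eval.comp measurable_snd)
  have h3 := Measurable.comp (measurable_totalScore π i) h2
  have h4 := h1.smul h3
  exact h4

variable {Γ : MarkovGame ι S A} {π : ParamPolicy ι S A M ν} {B V L R : ℝ}

lemma norm_actingGradient_sq_le (hR : BoundedReward Γ R) (hR0 : 0 ≤ R) {c : ℝ} (hc : 0 ≤ c)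
    (e : RewardEstimator) (i : ι) (φ : ι → Param M) (d : Episode ι S A) :
    ‖actingGradient Γ π c e i φ d‖ ^ 2
      ≤ (c * rewardBound Γ R) ^ 2 * ‖totalScore π i φ (d.1.1.2 d.1.1.1)‖ ^ 2 := by
  rw [actingGradient, norm_smul, norm_mul, Real.norm_of_nonneg hc, mul_pow]
  have := hR.abs_rewardEstimate_le hR0 i e d
  gcongr
  exact this

variable [SigmaFinite ν]

lemma ScoreAssumption.norm_totalScore_sub_le (h : ScoreAssumption π B V L) (hL : 0 ≤ L) (i : ι)
    (φ φ' : ι → Param M) (x : StateAction ι S A) :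
    ‖totalScore π i φ x - totalScore π i φ' x‖ ≤ Fintype.card ι * L * ‖φ - φ'‖ := by
  rw [totalScore, totalScore, ← Finset.sum_sub_distrib]
  calc _ ≤ ∑ _n : ι, L * ‖φ - φ'‖ := norm_sum_le_of_le _ fun n _ =>
        (h.lipschitz i n (φ n) (φ' n) x.1 (x.2 n)).trans
          (mul_le_mul_of_nonneg_left (norm_le_pi_norm (φ - φ') n) hL)
    _ = _ := by simp [mul_assoc]

lemma ScoreAssumption.integrable_totalScore_sq (h : ScoreAssumption π B V L)
    (Γ : MarkovGame ι S A) (i : ι) (φ : ι → Param M) :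
    Integrable (fun x => ‖totalScore π i φ x‖ ^ 2) (occupation Γ π φ) ∧
      ∫ x, ‖totalScore π i φ x‖ ^ 2 ∂(occupation Γ π φ)
        ≤ Fintype.card ι * (Fintype.card ι * (Fintype.card ι * V ^ 2)) := by
  have hle : ∀ x, ‖totalScore π i φ x‖ ^ 2
      ≤ Fintype.card ι * ∑ n, ‖π.gradLog n (φ n) x.1 (x.2 n)‖ ^ 2 := fun x => by
    have h1 : ‖totalScore π i φ x‖ ≤ ∑ n, ‖π.gradLog n (φ n) x.1 (x.2 n)‖ :=
      norm_sum_le_of_le _ fun n _ => Param.norm_apply_le (π.gradLog n (φ n) x.1 (x.2 n)) i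
    exact (pow_le_pow_left₀ (norm_nonneg _) h1 2).trans sq_sum_le_card_mul_sum_sq
  have hi : Integrable (fun x => (Fintype.card ι : ℝ) * ∑ n, ‖π.gradLog n (φ n) x.1 (x.2 n)‖ ^ 2)
      (occupation Γ π φ) :=
    (integrable_finsetSum _ fun n _ => (h.integrable_gradLog_sq Γ n φ).1).const_mul _
  have hi' : Integrable (fun x => ‖totalScore π i φ x‖ ^ 2) (occupation Γ π φ) :=
    hi.mono' ((measurable_totalScore_right π i φ).norm.pow_const 2).aestronglyMeasurable
      (ae_of_all _ fun x => by rw [Real.norm_of_nonneg (by positivity)]; exact hle x)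
  refine ⟨hi', (integral_mono hi' hi hle).trans ?_⟩
  rw [integral_const_mul, integral_finsetSum _ fun n _ => (h.integrable_gradLog_sq Γ n φ).1]
  refine mul_le_mul_of_nonneg_left ?_ (by positivity)
  calc _ ≤ ∑ _n : ι, (Fintype.card ι * V ^ 2 : ℝ) :=
        Finset.sum_le_sum fun n _ => (h.integrable_gradLog_sq Γ n φ).2
    _ = _ := by simp

lemma ScoreAssumption.integrable_totalScore (h : ScoreAssumption π B V L)
    (Γ : MarkovGame ι S A) (i : ι) (φ : ι → Param M) :
    Integrable (totalScore π i φ) (occupation Γ π φ) := by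
  have hi : Integrable (fun x => 1 + ‖totalScore π i φ x‖ ^ 2) (occupation Γ π φ) :=
    (integrable_const 1).add (h.integrable_totalScore_sq Γ i φ).1
  refine hi.mono' (measurable_totalScore_right π i φ).aestronglyMeasurable
    (ae_of_all _ fun x => ?_)
  nlinarith [sq_nonneg (‖totalScore π i φ x‖ - 1)]

lemma norm_actingGradient_sub_le (h : ScoreAssumption π B V L) (hL : 0 ≤ L)
    (hR : BoundedReward Γ R) (hR0 : 0 ≤ R) {c : ℝ} (hc : 0 ≤ c) (e : RewardEstimator) (i : ι)
    (φ φ' : ι → Param M) (d : Episode ι S A) :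
    ‖actingGradient Γ π c e i φ d - actingGradient Γ π c e i φ' d‖
      ≤ c * rewardBound Γ R * (Fintype.card ι * L) * ‖φ - φ'‖ := by
  rw [actingGradient, actingGradient, ← smul_sub, norm_smul, norm_mul, Real.norm_of_nonneg hc,
    mul_assoc (c * rewardBound Γ R)]
  have := rewardBound_nonneg Γ hR0
  gcongr
  · exact hR.abs_rewardEstimate_le hR0 i e d
  · exact h.norm_totalScore_sub_le hL i φ φ' _

/-- The acting gradient has bounded second moments. -/
lemma exists_lintegral_actingGradient_sq_le (h : ScoreAssumption π B V L)
    (hR : BoundedReward Γ R) (hR0 : 0 ≤ R) {c : ℝ} (hc : 0 ≤ c) :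
    ∃ C : ℝ, 0 ≤ C ∧ ∀ (e : RewardEstimator) (i : ι) (φ : ι → Param M),
      ∫⁻ d, ENNReal.ofReal (‖actingGradient Γ π c e i φ d‖ ^ 2) ∂(episodeLaw Γ π φ)
        ≤ ENNReal.ofReal C := by
  refine ⟨(c * rewardBound Γ R) ^ 2 * (Fintype.card ι * (Fintype.card ι *
    (Fintype.card ι * V ^ 2))), by positivity, fun e i φ => ?_⟩
  obtain ⟨h1, h2⟩ := h.integrable_totalScore_sq Γ i φ
  have hi := (integrable_episode_eval h1).const_mul ((c * rewardBound Γ R) ^ 2)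
  refine (lintegral_mono fun d => ENNReal.ofReal_le_ofReal
    (norm_actingGradient_sq_le hR hR0 hc e i φ d)).trans ?_
  rw [← ofReal_integral_eq_lintegral_ofReal hi (ae_of_all _ fun d => by positivity)]
  refine ENNReal.ofReal_le_ofReal ?_
  rw [integral_const_mul]
  refine mul_le_mul_of_nonneg_left (le_trans (le_of_eq ?_) h2) (by positivity)
  rw [← episodeLaw_map_eval, integral_map measurable_episode_eval.aemeasurable]
  exact ((measurable_totalScore_right π i φ).norm.pow_const 2).aestronglyMeasurable

lemma integrable_actingGradient (h : ScoreAssumption π B V L) (hR : BoundedReward Γ R)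
    (hR0 : 0 ≤ R) (c : ℝ) (e : RewardEstimator) (i : ι) (φ : ι → Param M) :
    Integrable (actingGradient Γ π c e i φ) (episodeLaw Γ π φ) := by
  have := ((integrable_episode_eval (h.integrable_totalScore Γ i φ)).bdd_smul _
    (measurable_rewardEstimate Γ i e).aestronglyMeasurable
      (ae_of_all _ fun d => hR.abs_rewardEstimate_le hR0 i e d)).smul c
  refine this.congr (ae_of_all _ fun d => ?_)
  simp [actingGradient, mul_smul]

/-- The baseline does not contribute to the mean. -/
lemma integral_stateValue_mul_scoreDir (h : ScoreAssumption π B V L) (hL : 0 ≤ L)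
    (hR : BoundedReward Γ R) (i : ι) (φ v : ι → Param M) :
    ∫ x, stateValue Γ π i φ x.1 * scoreDir π φ v x ∂(occupation Γ π φ) = 0 := by
  have hm := hR.measurable_stateValue (π := π) i φ
  have hi : Integrable (fun x : StateAction ι S A => stateValue Γ π i φ x.1 * scoreDir π φ v x)
      (occupation Γ π φ) :=
    (h.integrable_scoreDir Γ φ v).bdd_mul (hm.comp measurable_fst).aestronglyMeasurable
      (ae_of_all _ fun x => hR.abs_stateValue_le i φ x.1)
  rw [integral_occupation Γ π φ
    (g := fun x => stateValue Γ π i φ x.1 * scoreDir π φ v x)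
    ((hm.comp measurable_fst).mul (measurable_scoreDir π φ v)).stronglyMeasurable hi]
  -- The state value is constant given the state, and the scores have conditional mean zero.
  simp only [integral_const_mul, scoreDir, h.integral_joint_gradLog_eq_zero hL, mul_zero,
    integral_zero]

/-- The utility derivatives are Lipschitz in the policy parameters. -/
lemma exists_abs_utilityDeriv_sub_le (h : ScoreAssumption π B V L) (hL : 0 ≤ L)
    (hR : BoundedReward Γ R) (hR0 : 0 ≤ R) :
    ∃ C : ℝ, 0 ≤ C ∧ ∀ (i : ι) (φ φ' v : ι → Param M),
      |utilityDeriv h hR i φ v - utilityDeriv h hR i φ' v| ≤ C * ‖φ - φ'‖ * ‖v‖ := by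
  obtain ⟨C, hC, hexp⟩ := jointUtility_expansion (Γ := Γ) h hL hR hR0
  exact ⟨6 * C, by positivity, fun i φ φ' v => by
    have := abs_sub_le_of_quadratic_expansion (f := jointUtility Γ π i)
      (D := utilityDeriv h hR i) (C := C) (fun x y => hexp i x y) φ φ' v
    exact this⟩

variable [DecidableEq ι]

/-- The mean of the acting gradient, tested against a vector. -/
lemma inner_integral_actingGradient (h : ScoreAssumption π B V L) (hL : 0 ≤ L)
    (hR : BoundedReward Γ R) (hR0 : 0 ≤ R) (c : ℝ) (e : RewardEstimator) (i : ι)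
    (φ : ι → Param M) (w : EuclideanSpace ℝ (Fin (M i))) :
    inner ℝ (∫ d, actingGradient Γ π c e i φ d ∂(episodeLaw Γ π φ)) w
      = c * (1 - Γ.discount) * utilityDeriv h hR i φ (fun _ => PiLp.single 2 i w) := by
  set v : ι → Param M := fun _ => PiLp.single 2 i w with hv
  have hg := Γ.one_sub_discount_pos
  have e0 : ∫ d, actingGradient Γ π c e i φ d ∂(episodeLaw Γ π φ)
      = c • ∫ x, (qValue Γ π i φ x - e.baseline * stateValue Γ π i φ x.1) • totalScore π i φ x
        ∂(occupation Γ π φ) := by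
    rw [← hR.integral_episode hR0 i e φ
      (measurable_totalScore_right π i φ).stronglyMeasurable (h.integrable_totalScore Γ i φ),
      ← integral_smul]
    simp only [actingGradient, mul_smul]
  have hq := h.integrable_qValue_mul_scoreDir hR i φ v
  have hm := hR.measurable_stateValue (π := π) i φ
  have hb : Integrable (fun x : StateAction ι S A => stateValue Γ π i φ x.1 * scoreDir π φ v x)
      (occupation Γ π φ) :=
    (h.integrable_scoreDir Γ φ v).bdd_mul (hm.comp measurable_fst).aestronglyMeasurable
      (ae_of_all _ fun x => hR.abs_stateValue_le i φ x.1)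
  have hint : Integrable (fun x : StateAction ι S A =>
      (qValue Γ π i φ x - e.baseline * stateValue Γ π i φ x.1) • totalScore π i φ x)
      (occupation Γ π φ) := by
    simp only [sub_smul, mul_smul]
    exact ((h.integrable_totalScore Γ i φ).bdd_smul _
      (hR.measurable_qValue i φ).aestronglyMeasurable
      (ae_of_all _ fun x => hR.abs_qValue_le i φ x)).sub
      (((h.integrable_totalScore Γ i φ).bdd_smul _ (hm.comp measurable_fst).aestronglyMeasurable
      (ae_of_all _ fun x => hR.abs_stateValue_le i φ x.1)).smul e.baseline)
  rw [e0, real_inner_smul_left, ← real_inner_comm, ← integral_inner hint]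
  have e1 : ∀ x, inner ℝ w ((qValue Γ π i φ x - e.baseline * stateValue Γ π i φ x.1)
      • totalScore π i φ x) = qValue Γ π i φ x * scoreDir π φ v x
        - e.baseline * (stateValue Γ π i φ x.1 * scoreDir π φ v x) := fun x => by
    rw [real_inner_smul_right, real_inner_comm, inner_totalScore]
    ring
  simp_rw [e1]
  rw [integral_sub hq (hb.const_mul _), integral_const_mul,
    integral_stateValue_mul_scoreDir h hL hR, utilityDeriv_apply]
  field_simp
  ring

lemma norm_le_of_forall_inner_le {E : Type*} [NormedAddCommGroup E] [InnerProductSpace ℝ E]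
    {x : E} {C : ℝ} (h : ∀ w, |inner ℝ x w| ≤ C * ‖w‖) (hC : 0 ≤ C) : ‖x‖ ≤ C := by
  rcases eq_or_ne x 0 with rfl | hx
  · simpa using hC
  · have := h x
    rw [real_inner_self_eq_norm_sq, abs_of_nonneg (sq_nonneg _), sq] at this
    exact le_of_mul_le_mul_right this (norm_pos_iff.2 hx)

lemma norm_const_single_le (i : ι) (w : EuclideanSpace ℝ (Fin (M i))) :
    ‖(fun _ : ι => (PiLp.single 2 i w : Param M))‖ ≤ ‖w‖ :=
  (norm_const_le _).trans (PiLp.norm_single _ _ _ _ |>.le)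

/-- The bias of the acting gradient is controlled by the distance of the acting parameters from
the true ones. -/
theorem exists_norm_integral_actingGradient_sub_le (h : ScoreAssumption π B V L) (hL : 0 ≤ L)
    (hR : BoundedReward Γ R) (hR0 : 0 ≤ R) {c : ℝ} (hc : 0 ≤ c)
    (hdiff : ∀ i, Differentiable ℝ (utility Γ π i)) :
    ∃ C : ℝ, 0 ≤ C ∧ ∀ (e : RewardEstimator) (i : ι) (φ : ι → Param M) (θ : Param M),
      ‖∫ d, actingGradient Γ π c e i φ d ∂(episodeLaw Γ π φ)
          - (c * (1 - Γ.discount)) • (gradient (utility Γ π i) θ) i‖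
        ≤ C * ‖φ - fun _ => θ‖ := by
  obtain ⟨C, hC, hlip⟩ := exists_abs_utilityDeriv_sub_le (Γ := Γ) h hL hR hR0
  have hg := Γ.one_sub_discount_pos
  refine ⟨c * (1 - Γ.discount) * C, by positivity, fun e i φ θ => ?_⟩
  refine norm_le_of_forall_inner_le (fun w => ?_) (by positivity)
  -- The true gradient and the mean of the estimate are the same derivative at two parameter
  -- families, the diagonal one and `φ`, so its Lipschitz bound controls the bias.
  have e1 : inner ℝ ((gradient (utility Γ π i) θ) i) w
      = utilityDeriv h hR i (fun _ => θ) (fun _ => PiLp.single 2 i w) := by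
    rw [← inner_gradient_utility h hL hR hR0 i (hdiff i) θ, Param.inner_single_right]
  rw [inner_sub_left, inner_integral_actingGradient h hL hR hR0, real_inner_smul_left, e1,
    ← mul_sub, abs_mul, abs_of_nonneg (by positivity : 0 ≤ c * (1 - Γ.discount))]
  calc _ ≤ c * (1 - Γ.discount) * (C * ‖φ - fun _ => θ‖
        * ‖(fun _ : ι => (PiLp.single 2 i w : Param M))‖) := by
        gcongr; exact hlip i φ _ _
    _ ≤ c * (1 - Γ.discount) * (C * ‖φ - fun _ => θ‖ * ‖w‖) := by
        gcongr; exact norm_const_single_le i w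
    _ = _ := by ring

/-! ### The potential -/

variable {u : Param M → ℝ}

/-- The gradient of the potential is Lipschitz. -/
theorem IsPotential.exists_lipschitz_gradient (hu : IsPotential Γ π u)
    (h : ScoreAssumption π B V L) (hL : 0 ≤ L) (hR : BoundedReward Γ R) (hR0 : 0 ≤ R) :
    ∃ C : ℝ, 0 ≤ C ∧ ∀ θ θ' : Param M, ‖gradient u θ - gradient u θ'‖ ≤ C * ‖θ - θ'‖ := by
  obtain ⟨C, hC, hlip⟩ := exists_abs_utilityDeriv_sub_le (Γ := Γ) h hL hR hR0
  refine ⟨Fintype.card ι * C, by positivity, fun θ θ' => (Param.norm_le_sum _).trans ?_⟩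
  calc ∑ i, ‖(gradient u θ - gradient u θ') i‖ ≤ ∑ _i : ι, C * ‖θ - θ'‖ := by
        refine Finset.sum_le_sum fun i _ => norm_le_of_forall_inner_le (fun w => ?_)
          (by positivity)
        rw [PiLp.sub_apply, ← hu.gradient_eq, ← hu.gradient_eq, ← PiLp.sub_apply,
          ← Param.inner_single_right, inner_sub_left,
          inner_gradient_utility h hL hR hR0 i (hu.differentiable_utility i),
          inner_gradient_utility h hL hR hR0 i (hu.differentiable_utility i)]
        refine (hlip i _ _ _).trans ?_
        gcongr
        · exact norm_const_le (ι := ι) (θ - θ')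
        · exact norm_const_single_le i w
    _ = _ := by simp [mul_assoc]

/-- The gradient of the potential is bounded. -/
theorem IsPotential.exists_norm_gradient_le (hu : IsPotential Γ π u)
    (h : ScoreAssumption π B V L) (hL : 0 ≤ L) (hR : BoundedReward Γ R) (hR0 : 0 ≤ R) :
    ∃ C : ℝ, 0 ≤ C ∧ ∀ θ : Param M, ‖gradient u θ‖ ≤ C := by
  have hg := Γ.one_sub_discount_pos
  set C := (1 - Γ.discount)⁻¹ *
      (R / (1 - Γ.discount)) * (Fintype.card ι * (1 + Fintype.card ι * V ^ 2)) with hC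
  have hC0 : 0 ≤ C := by positivity
  refine ⟨Fintype.card ι * C, by positivity, fun θ => (Param.norm_le_sum _).trans ?_⟩
  calc ∑ i, ‖gradient u θ i‖ ≤ ∑ _i : ι, C := by
        refine Finset.sum_le_sum fun i _ => norm_le_of_forall_inner_le (fun w => ?_) hC0
        rw [← hu.gradient_eq, ← Param.inner_single_right,
          inner_gradient_utility h hL hR hR0 i (hu.differentiable_utility i)]
        exact (abs_utilityDeriv_le h hR hR0 i _ _).trans
          (mul_le_mul_of_nonneg_left (norm_const_single_le i w) hC0)
    _ = _ := by simp

end StochasticGradient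
end


noncomputable section

/-! ### The potential is bounded -/

section Potential

variable {ι S A : Type*} [Fintype ι] [DecidableEq ι] [MeasurableSpace S] [MeasurableSpace A]
  {M : ι → ℕ} {ν : Measure A} [SigmaFinite ν] {Γ : MarkovGame ι S A} {π : ParamPolicy ι S A M ν}
  {u : Param M → ℝ} {R : ℝ}

/-- On a line parallel to block `i` only the `i`-th blocks of the gradients matter. They agree, so
the difference of the two functions is constant along the line. -/
lemma IsPotential.sub_eq_utility_sub (hu : IsPotential Γ π u) (i : ι) (θ : Param M)
    (v : EuclideanSpace ℝ (Fin (M i))) :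
    u (θ + PiLp.single 2 i v) - u θ
      = utility Γ π i (θ + PiLp.single 2 i v) - utility Γ π i θ := by
  set e : Param M := PiLp.single 2 i v with he
  have hline : ∀ t : ℝ, HasDerivAt (fun t : ℝ => θ + t • e) e t := fun t => by
    simpa using ((hasDerivAt_id t).smul_const e).const_add θ
  have hder : ∀ t : ℝ, HasDerivAt (fun t : ℝ => u (θ + t • e) - utility Γ π i (θ + t • e)) 0 t :=
    fun t => by
      have h1 := (hu.differentiable_potential.hasFDerivAt_gradient (θ + t • e)).comp_hasDerivAt t
        (hline t)
      have h2 := ((hu.differentiable_utility i).hasFDerivAt_gradient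
        (θ + t • e)).comp_hasDerivAt t (hline t)
      refine (h1.sub h2).congr_deriv ?_
      simp only [InnerProductSpace.toDual_apply_apply, he]
      rw [Param.inner_single_right, Param.inner_single_right, hu.gradient_eq, sub_self]
  have hc := is_const_of_deriv_eq_zero (fun t => (hder t).differentiableAt)
    (fun t => (hder t).deriv) 1 0
  simp only [one_smul, zero_smul, add_zero] at hc
  linarith

/-- The oscillation of the potential is bounded. -/
theorem IsPotential.abs_sub_le (hu : IsPotential Γ π u) (hR : BoundedReward Γ R)
    (θ θ' : Param M) :
    |u θ' - u θ| ≤ Fintype.card ι * (2 * (R / (1 - Γ.discount))) := by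
  have hU : ∀ i (x : Param M), |utility Γ π i x| ≤ R / (1 - Γ.discount) := fun i x => by
    rw [hR.utility_eq]
    exact hR.abs_jointUtility_le i _
  -- The blocks are exchanged one agent at a time. Each exchange changes the potential exactly as
  -- the utility of that agent, hence by at most twice the bound on the utilities.
  have key : ∀ s : Finset ι, |u (θ + ∑ i ∈ s, PiLp.single 2 i ((θ' - θ) i)) - u θ|
      ≤ s.card * (2 * (R / (1 - Γ.discount))) := fun s => by
    induction s using Finset.induction_on with
    | empty => simp
    | insert i s hi ih =>
      rw [Finset.sum_insert hi, add_comm (PiLp.single 2 i _), ← add_assoc,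
        Finset.card_insert_of_notMem hi]
      set x := θ + ∑ i ∈ s, PiLp.single 2 i ((θ' - θ) i)
      have h1 := hu.sub_eq_utility_sub i x ((θ' - θ) i)
      have h2 := abs_le.1 (hU i x)
      have h3 := abs_le.1 (hU i (x + PiLp.single 2 i ((θ' - θ) i)))
      have h4 := abs_le.1 ih
      push_cast
      rw [abs_le]
      constructor <;> linarith [h4.1, h4.2, h2.1, h2.2, h3.1, h3.2]
  have h := key Finset.univ
  have hsum : ∑ i, (PiLp.single 2 i ((θ' - θ) i) : Param M) = θ' - θ := by
    ext j : 1
    simp only [WithLp.ofLp_sum, Finset.sum_apply]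
    rw [Finset.sum_eq_single j]
    · simp
    · intro i _ hij
      simp [hij.symm]
    · simp
  rwa [hsum, add_sub_cancel, Finset.card_univ] at h

end Potential
end


noncomputable section

/-! ### Consensus: contraction of the belief errors -/

section Contraction

variable {ι : Type*} [Fintype ι] {G : ℕ → SimpleGraph ι} {w : ℕ → ι → ι → ι → ℝ} {h : ℝ}

lemma WeightAssumption.nonneg (hw : WeightAssumption G w h) (hh0 : 0 ≤ h) {t : ℕ} (ht : 1 ≤ t)
    (i j l : ι) : 0 ≤ w t i j l := by
  by_cases hij : i = j
  · subst hij
    by_cases hl : l = i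
    · rw [hl, hw.own t ht]; exact zero_le_one
    · rw [hw.own_other t ht i l hl]
  · by_cases hl : (G t).Adj i l ∨ l = i
    · exact hh0.trans (hw.lower t ht i j l hij hl)
    · rw [hw.zero t ht i j l hl]

/-- An average with a weight at least `h` on a value that is smaller by `d` than the bound for
all values. -/
lemma sum_mul_le_sub {p y : ι → ℝ} {c d h : ℝ} (hp : ∀ l, 0 ≤ p l) (hsum : ∑ l, p l = 1)
    (hy : ∀ l, y l ≤ c) {l₀ : ι} (hl : h ≤ p l₀) (hy₀ : y l₀ ≤ c - d) (hd : 0 ≤ d) :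
    ∑ l, p l * y l ≤ c - h * d := by
  classical
  have h1 : ∑ l, p l * y l ≤ ∑ l, (p l * c - if l = l₀ then h * d else 0) := by
    refine Finset.sum_le_sum fun l _ => ?_
    split_ifs with hll
    · subst hll
      have := mul_le_mul_of_nonneg_left hy₀ (hp l)
      have := mul_le_mul_of_nonneg_right hl hd
      linarith
    · have := mul_le_mul_of_nonneg_left (hy l) (hp l)
      linarith
  rw [Finset.sum_sub_distrib, ← Finset.sum_mul, hsum, Finset.sum_ite_eq' Finset.univ l₀] at h1
  simpa using h1

variable [DecidableEq ι]

/-- A network in which the beliefs about agent `j` are averaged and perturbed by `a`. -/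
structure BeliefError (w : ℕ → ι → ι → ι → ℝ) (j : ι) (X : ℕ → ι → ℝ) (a : ℕ → ℝ) : Prop where
  own : ∀ t, X t j = 0
  perturbation_nonneg : ∀ t, 0 ≤ a t
  step : ∀ t i, X (t + 1) i ≤ ∑ l, w (t + 1) i j l * if l = j then 0 else X t l + a t

variable {j : ι} {X : ℕ → ι → ℝ} {a : ℕ → ℝ}

/-- Averaging never raises the maximum, so the errors grow only by the accumulated perturbations. -/
lemma BeliefError.le_add_sum (hX : BeliefError w j X a) (hw : WeightAssumption G w h)
    (hh0 : 0 ≤ h) {t : ℕ} {m : ℝ} (hm0 : 0 ≤ m) (hm : ∀ l, X t l ≤ m) (k : ℕ) (i : ι) :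
    X (t + k) i ≤ m + ∑ s ∈ Finset.range k, a (t + s) := by
  induction k generalizing i with
  | zero => simpa using hm i
  | succ k ih =>
    have hs : 0 ≤ ∑ s ∈ Finset.range (k + 1), a (t + s) :=
      Finset.sum_nonneg fun s _ => hX.perturbation_nonneg _
    rw [← add_assoc]
    calc _ ≤ ∑ l, w (t + k + 1) i j l * if l = j then 0 else X (t + k) l + a (t + k) :=
          hX.step (t + k) i
      _ ≤ ∑ l, w (t + k + 1) i j l * (m + ∑ s ∈ Finset.range (k + 1), a (t + s)) := by
          refine Finset.sum_le_sum fun l _ => mul_le_mul_of_nonneg_left ?_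
            (hw.nonneg hh0 (by omega) i j l)
          split_ifs
          · positivity
          · rw [Finset.sum_range_succ]; linarith [ih l]
      _ = _ := by rw [← Finset.sum_mul, hw.sum_one _ (by omega), one_mul]

/-- Agents hearing from an agent with a small error have a small error themselves. -/
lemma BeliefError.le_of_adj (hX : BeliefError w j X a) (hw : WeightAssumption G w h)
    (hh0 : 0 < h) (hh1 : h < 1) {t : ℕ} {m : ℝ} (hm0 : 0 ≤ m) (hm : ∀ l, X t l ≤ m) {k : ℕ}
    {i l₀ : ι} (hadj : (G (t + k + 1)).Adj i l₀ ∨ l₀ = i)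
    (hl : X (t + k) l₀ ≤ (1 - h ^ k) * m + ∑ s ∈ Finset.range k, a (t + s)) :
    X (t + (k + 1)) i ≤ (1 - h ^ (k + 1)) * m + ∑ s ∈ Finset.range (k + 1), a (t + s) := by
  have hs : ∀ k, 0 ≤ ∑ s ∈ Finset.range k, a (t + s) := fun k =>
    Finset.sum_nonneg fun s _ => hX.perturbation_nonneg _
  have hpow : ∀ k, 0 ≤ 1 - h ^ k := fun k => sub_nonneg.2 (pow_le_one₀ hh0.le hh1.le)
  -- The lower bound on the weights holds only for agents other than `j`, whose own error vanishes
  -- anyway.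
  by_cases hij : i = j
  · subst hij
    rw [hX.own]
    exact add_nonneg (mul_nonneg (hpow _) hm0) (hs _)
  · refine (hX.step (t + k) i).trans ?_
    have hak := hX.perturbation_nonneg (t + k)
    -- Agent `l₀` lies below the common bound by `h ^ k * m`; a weight of at least `h` passes on the
    -- fraction `h` of this gap.
    refine (sum_mul_le_sub (c := m + ∑ s ∈ Finset.range (k + 1), a (t + s)) (d := h ^ k * m)
      (h := h) (l₀ := l₀) (hw.nonneg hh0.le (by omega) i j) (hw.sum_one _ (by omega) i j)
      (fun l => ?_) (hw.lower _ (by omega) i j l₀ hij hadj) ?_ (by positivity)).trans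
      (le_of_eq ?_)
    · have := hX.le_add_sum hw hh0.le hm0 hm k l
      have := hs (k + 1)
      split_ifs
      · positivity
      · rw [Finset.sum_range_succ]; linarith
    · have := mul_nonneg (hpow k) hm0
      have := hs (k + 1)
      split_ifs
      · linarith
      · rw [Finset.sum_range_succ]; linarith
    · ring

/-- The error of `j` itself is zero, and this advantage moves along the walk away from `j`. Each
edge appears within `T` steps, and an agent that waits keeps its gap up to a factor `h` per step
because of its weight on itself. -/
lemma BeliefError.le_of_walk (hX : BeliefError w j X a) (hw : WeightAssumption G w h)
    (hh0 : 0 < h) (hh1 : h < 1) {t : ℕ} {m : ℝ} (hm0 : 0 ≤ m) (hm : ∀ l, X t l ≤ m) {T : ℕ}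
    (hT : ∀ i l, (limitGraph G).Adj i l → ∀ t, 1 ≤ t → ∃ τ < T, (G (t + τ)).Adj i l) {i : ι}
    (p : (limitGraph G).Walk i j) {k : ℕ} (hk : T * p.length ≤ k) :
    X (t + k) i ≤ (1 - h ^ k) * m + ∑ s ∈ Finset.range k, a (t + s) := by
  induction p generalizing k with
  | nil =>
    rw [hX.own]
    exact add_nonneg (mul_nonneg (sub_nonneg.2 (pow_le_one₀ hh0.le hh1.le)) hm0)
      (Finset.sum_nonneg fun s _ => hX.perturbation_nonneg _)
  | @cons i l _ hadj p ih =>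
    -- The edge is sought only after the bound for the rest of the walk is in force. The shift by
    -- one is due to the exchange leading from `s` to `s + 1` using the graph of time `s + 1`, which
    -- also keeps the time at least `1`.
    obtain ⟨τ, hτ, hG⟩ := hT i l hadj (t + T * p.length + 1) (by omega)
    rw [SimpleGraph.Walk.length_cons, mul_add, mul_one] at hk
    obtain ⟨r, rfl⟩ : ∃ r, k = T * p.length + τ + 1 + r :=
      ⟨k - (T * p.length + τ + 1), by omega⟩
    clear hk
    -- The first case is the step in which the edge is used; in all later steps the agent hears from
    -- itself.
    induction r with
    | zero =>
      refine hX.le_of_adj hw hh0 hh1 hm0 hm (l₀ := l) (Or.inl ?_) (ih hX (by omega))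
      rwa [show t + (T * p.length + τ) + 1 = t + T * p.length + 1 + τ by ring]
    | succ r ihr =>
      exact hX.le_of_adj hw hh0 hh1 hm0 hm (Or.inr rfl) ihr

/-- Over a window of fixed length the belief errors contract. -/
theorem ConnectedNetwork.exists_contraction (hG : ConnectedNetwork G)
    (hw : WeightAssumption G w h) (hh0 : 0 < h) (hh1 : h < 1) :
    ∃ W : ℕ, 0 < W ∧ ∀ (j : ι) (X : ℕ → ι → ℝ) (a : ℕ → ℝ), BeliefError w j X a →
      ∀ (t : ℕ) (m : ℝ), 0 ≤ m → (∀ l, X t l ≤ m) → ∀ i,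
        X (t + W) i ≤ (1 - h ^ W) * m + ∑ s ∈ Finset.range W, a (t + s) := by
  obtain ⟨T, -, hT⟩ := hG.bounded_gaps
  have hp : ∀ i j, Nonempty ((limitGraph G).Walk i j) := fun i j => hG.connected.preconnected i j
  -- The sum of the lengths of all chosen walks bounds each of them, which gives one window length
  -- for all pairs of agents; the added `1` makes it positive.
  refine ⟨T * (∑ i, ∑ j, (hp i j).some.length) + 1, by omega,
    fun j X a hX t m hm0 hm i => ?_⟩
  refine hX.le_of_walk hw hh0 hh1 hm0 hm hT (hp i j).some (le_trans ?_ (Nat.le_succ _))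
  refine Nat.mul_le_mul_left _ ?_
  exact (Finset.single_le_sum (f := fun j => (hp i j).some.length) (fun _ _ => Nat.zero_le _)
    (Finset.mem_univ j)).trans (Finset.single_le_sum
      (f := fun i => ∑ j, (hp i j).some.length) (fun _ _ => Nat.zero_le _) (Finset.mem_univ i))

end Contraction

/-! ### Perturbed contractions and power decay -/

section Decay

/-- A sequence that contracts over windows up to perturbations of size `v` decays like `v`. -/
theorem exists_le_mul_of_contraction {m v : ℕ → ℝ} {W : ℕ} {δ K : ℝ} (hW : 0 < W) (hδ0 : 0 < δ)
    (hδ1 : δ ≤ 1) (hK : 0 ≤ K) (hm0 : ∀ t, 0 ≤ m t) (hv : ∀ t, 0 < v t) (hanti : Antitone v)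
    (hlim : Tendsto v atTop (𝓝 0)) (hr : ∀ᶠ t in atTop, (1 - δ / 2) * v t ≤ v (t + W))
    (hm : ∀ t, m (t + W) ≤ (1 - δ) * m t
      + K * ∑ s ∈ Finset.range W, v (t + s) * (1 + m (t + s))) :
    ∃ D : ℝ, 0 ≤ D ∧ ∀ t, m t ≤ D * v t := by
  have hv1 : ∀ᶠ t in atTop, K * W * v t ≤ δ / 4 := by
    have : Tendsto (fun t => K * W * v t) atTop (𝓝 (K * W * 0)) := hlim.const_mul _
    rw [mul_zero] at this
    exact this.eventually_le_const (by positivity)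
  obtain ⟨t₀, ht₀⟩ := eventually_atTop.1 (hr.and hv1)
  -- The first summand makes the perturbation at most a quarter of the contraction; the second
  -- covers the finitely many initial times.
  set D := 4 * K * W / δ + ∑ s ∈ Finset.range (t₀ + W), m s / v s with hD
  have hterm : ∀ s, 0 ≤ m s / v s := fun s => div_nonneg (hm0 s) (hv s).le
  have hsum : 0 ≤ ∑ s ∈ Finset.range (t₀ + W), m s / v s := Finset.sum_nonneg fun s _ => hterm s
  have hD1 : 4 * K * W / δ ≤ D := by rw [hD]; linarith
  have hD0 : 0 ≤ D := le_trans (by positivity) hD1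
  refine ⟨D, hD0, fun t => ?_⟩
  induction t using Nat.strong_induction_on with
  | _ n ih =>
    by_cases hn : n < t₀ + W
    · rw [← div_le_iff₀ (hv n), hD]
      have := Finset.single_le_sum (f := fun s => m s / v s) (fun s _ => hterm s)
        (Finset.mem_range.2 hn)
      have : 0 ≤ 4 * K * W / δ := by positivity
      linarith
    · obtain ⟨t, rfl⟩ : ∃ t, n = t + W := ⟨n - W, by omega⟩
      obtain ⟨h1, h2⟩ := ht₀ t (by omega)
      have hvt := hv t
      have e1 : ∑ s ∈ Finset.range W, v (t + s) * (1 + m (t + s))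
          ≤ W * (v t * (1 + D * v t)) := by
        rw [← nsmul_eq_mul]
        refine (Finset.sum_le_card_nsmul _ _ (v t * (1 + D * v t)) fun s hs => ?_).trans_eq
          (by rw [Finset.card_range])
        have hs' := Finset.mem_range.1 hs
        have hle : v (t + s) ≤ v t := hanti (Nat.le_add_right t s)
        have := ih (t + s) (by omega)
        have : m (t + s) ≤ D * v t := this.trans (mul_le_mul_of_nonneg_left hle hD0)
        exact mul_le_mul hle (by linarith) (by linarith [hm0 (t + s)]) hvt.le
      have e2 : m t ≤ D * v t := ih t (by omega)
      have e3 : K * W ≤ D * (δ / 4) := by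
        rw [div_le_iff₀ hδ0] at hD1; linarith
      -- Half of the gain `δ` is spent: a quarter on the constant part of the perturbation, a
      -- quarter on its feedback through `m`. The other half pays for the decrease of `v` over the
      -- window.
      calc m (t + W) ≤ (1 - δ) * (D * v t) + K * (W * (v t * (1 + D * v t))) :=
            (hm t).trans (add_le_add (mul_le_mul_of_nonneg_left e2 (by linarith))
              (mul_le_mul_of_nonneg_left e1 hK))
        _ = (1 - δ) * (D * v t) + (K * W) * v t + (K * W * v t) * (D * v t) := by ring
        _ ≤ (1 - δ) * (D * v t) + (D * (δ / 4)) * v t + δ / 4 * (D * v t) := by gcongr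
        _ = D * ((1 - δ / 2) * v t) := by ring
        _ ≤ D * v (t + W) := mul_le_mul_of_nonneg_left h1 hD0

/-- The decay rate `(t + 1)^{-β}`. -/
def powerDecay (β : ℝ) (t : ℕ) : ℝ := ((t : ℝ) + 1) ^ (-β)

lemma powerDecay_pos (β : ℝ) (t : ℕ) : 0 < powerDecay β t :=
  Real.rpow_pos_of_pos (by positivity) _

variable {β : ℝ}

lemma antitone_powerDecay (hβ : 0 ≤ β) : Antitone (powerDecay β) := fun s t hst =>
  Real.rpow_le_rpow_of_nonpos (by positivity) (by gcongr) (by linarith)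

lemma tendsto_powerDecay (hβ : 0 < β) : Tendsto (powerDecay β) atTop (𝓝 0) :=
  (tendsto_rpow_neg_atTop hβ).comp (tendsto_atTop_add_const_right _ 1 tendsto_natCast_atTop_atTop)

/-- Over a window of fixed length the ratio of consecutive values tends to `1`, so a power
eventually decays slower than any given geometric rate. -/
lemma eventually_le_powerDecay_add (β : ℝ) (W : ℕ) {r : ℝ} (hr : r < 1) :
    ∀ᶠ t in atTop, r * powerDecay β t ≤ powerDecay β (t + W) := by
  have h1 : Tendsto (fun t : ℕ => (((t + W : ℕ) : ℝ) + 1) / ((t : ℝ) + 1)) atTop (𝓝 1) := by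
    have h0 : Tendsto (fun t : ℕ => 1 + (W : ℝ) / ((t : ℝ) + 1)) atTop (𝓝 (1 + 0)) :=
      (tendsto_const_nhds.div_atTop
        (tendsto_atTop_add_const_right _ 1 tendsto_natCast_atTop_atTop)).const_add 1
    rw [add_zero] at h0
    refine h0.congr fun t => ?_
    have : (t : ℝ) + 1 ≠ 0 := by positivity
    push_cast
    field_simp
    ring
  have h2 : Tendsto (fun t : ℕ => ((((t + W : ℕ) : ℝ) + 1) / ((t : ℝ) + 1)) ^ (-β)) atTop
      (𝓝 (1 ^ (-β))) := h1.rpow_const (Or.inl one_ne_zero)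
  rw [Real.one_rpow] at h2
  filter_upwards [h2.eventually_const_le hr] with t ht
  rw [Real.div_rpow (by positivity) (by positivity)] at ht
  exact (le_div_iff₀ (powerDecay_pos β t)).1 ht

/-- Two-sided bounds for the step sizes. -/
lemma exists_stepSize_bounds {α : ℕ → ℝ} (hα_pos : ∀ t, 1 ≤ t → 0 < α t)
    (hα : α =Θ[atTop] fun t : ℕ => (t : ℝ) ^ (-β)) :
    ∃ a A : ℝ, 0 < a ∧ 0 < A ∧ ∀ t, a * powerDecay β t ≤ α (t + 1) ∧
      α (t + 1) ≤ A * powerDecay β t := by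
  have hshift : Tendsto (fun t : ℕ => t + 1) atTop atTop := tendsto_add_atTop_nat 1
  have hpos : ∀ t, 0 < α (t + 1) := fun t => hα_pos _ (by omega)
  have hnorm : ∀ t, ‖(((t + 1 : ℕ) : ℝ)) ^ (-β)‖ = powerDecay β t := fun t => by
    rw [Real.norm_of_nonneg (by positivity), powerDecay]; push_cast; rfl
  -- An eventual bound between positive sequences becomes a bound at all times after adding the
  -- finitely many initial ratios to the constant.
  have hbound : ∀ {f g : ℕ → ℝ}, (∀ t, 0 < f t) → (∀ t, 0 < g t) →
      (∃ c, 0 < c ∧ ∀ᶠ t in atTop, f t ≤ c * g t) → ∃ C, 0 < C ∧ ∀ t, f t ≤ C * g t := by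
    rintro f g hf hg ⟨c, hc, hev⟩
    obtain ⟨t₀, ht₀⟩ := eventually_atTop.1 hev
    have hterm : ∀ s, 0 ≤ f s / g s := fun s => div_nonneg (hf s).le (hg s).le
    have hsum : 0 ≤ ∑ s ∈ Finset.range t₀, f s / g s := Finset.sum_nonneg fun s _ => hterm s
    refine ⟨c + ∑ s ∈ Finset.range t₀, f s / g s, by linarith, fun t => ?_⟩
    rcases le_or_gt t₀ t with h | h
    · refine (ht₀ t h).trans (mul_le_mul_of_nonneg_right (by linarith) (hg t).le)
    · rw [← div_le_iff₀ (hg t)]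
      have := Finset.single_le_sum (f := fun s => f s / g s) (fun s _ => hterm s)
        (Finset.mem_range.2 h)
      linarith
  obtain ⟨A, hA, hA'⟩ := hbound hpos (powerDecay_pos β) (by
    obtain ⟨c, hc, h⟩ := hα.1.exists_pos
    refine ⟨c, hc, ?_⟩
    filter_upwards [hshift.eventually h.bound] with t ht
    rwa [hnorm, Real.norm_of_nonneg (hpos t).le] at ht)
  obtain ⟨a, ha, ha'⟩ := hbound (powerDecay_pos β) hpos (by
    obtain ⟨c, hc, h⟩ := hα.2.exists_pos
    refine ⟨c, hc, ?_⟩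
    filter_upwards [hshift.eventually h.bound] with t ht
    rwa [hnorm, Real.norm_of_nonneg (hpos t).le] at ht)
  refine ⟨a⁻¹, A, inv_pos.2 ha, hA, fun t => ⟨?_, hA' t⟩⟩
  rw [inv_mul_le_iff₀ ha]
  exact ha' t

end Decay
end


noncomputable section

/-! ### From the descent inequality to the rate -/

section Rate

variable {β : ℝ}

/-- A bounded sequence that increases by `v_t f_t` up to `v_t²` forces `f` to be small. -/
theorem exists_le_of_descent {f U : ℕ → ℝ} {c C K : ℝ} (hβ0 : 0 < β) (hβ1 : β < 1) (hc : 0 < c)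
    (hC : 0 ≤ C) (hK : ∀ s t, U t - U s ≤ K)
    (hdesc : ∀ t, c * powerDecay β t * f t ≤ U (t + 1) - U t + C * powerDecay β t ^ 2) :
    ∃ D : ℝ, 0 < D ∧ ∀ T : ℕ, 1 ≤ T → ∃ τ < 2 * T, f τ ≤ D * (T : ℝ) ^ (-min (1 - β) β) := by
  have hK0 : 0 ≤ K := by simpa using hK 0 0
  set q := min (1 - β) β with hq
  have h3 : (0 : ℝ) < 3 ^ (-β) := Real.rpow_pos_of_pos three_pos _
  -- If `f` exceeded the bound throughout `[T, 2T)`, the sum of the ascents would exceed `K`. The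
  -- factor `3 ^ (-β)` comes from `t + 1 ≤ 2T ≤ 3T`, and the `+ 1` makes the contradiction strict.
  refine ⟨(K + C + 1) / (c * 3 ^ (-β)), by positivity, fun T hT => ?_⟩
  by_contra! hcon
  set x := (K + C + 1) / (c * 3 ^ (-β)) * (T : ℝ) ^ (-q) with hx
  have hT1 : (1 : ℝ) ≤ T := by exact_mod_cast hT
  have hT0 : (0 : ℝ) < T := by linarith
  have hx0 : 0 < x := by positivity
  have hvlow : ∀ t < 2 * T, 3 ^ (-β) * (T : ℝ) ^ (-β) ≤ powerDecay β t := fun t ht => by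
    rw [← Real.mul_rpow (by norm_num) hT0.le, powerDecay]
    have : (t : ℝ) + 1 ≤ 2 * T := by exact_mod_cast ht
    exact Real.rpow_le_rpow_of_nonpos (by positivity) (by linarith) (by linarith)
  have hvup : ∀ t, T ≤ t → powerDecay β t ≤ (T : ℝ) ^ (-β) := fun t ht => by
    have : (T : ℝ) ≤ t := by exact_mod_cast ht
    exact Real.rpow_le_rpow_of_nonpos hT0 (by linarith) (by linarith)
  have hstep : ∀ s ∈ Finset.range T, c * (3 ^ (-β) * (T : ℝ) ^ (-β)) * x
      ≤ (U (T + (s + 1)) - U (T + s)) + C * ((T : ℝ) ^ (-β)) ^ 2 := fun s hs => by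
    have hs' := Finset.mem_range.1 hs
    have h1 := hvlow (T + s) (by omega)
    have h2 := hvup (T + s) (by omega)
    have hv := powerDecay_pos β (T + s)
    calc c * (3 ^ (-β) * (T : ℝ) ^ (-β)) * x ≤ c * powerDecay β (T + s) * f (T + s) := by
          have := (hcon (T + s) (by omega)).le
          gcongr
      _ ≤ (U (T + s + 1) - U (T + s)) + C * powerDecay β (T + s) ^ 2 := hdesc (T + s)
      _ ≤ _ := by
          rw [← add_assoc]
          gcongr
  have hsum := Finset.sum_le_sum hstep
  rw [Finset.sum_add_distrib, Finset.sum_range_sub (fun s => U (T + s)), Finset.sum_const,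
    Finset.sum_const, Finset.card_range, nsmul_eq_mul, nsmul_eq_mul] at hsum
  have hU := hK (T + 0) (T + T)
  have hxe : c * (3 ^ (-β) * (T : ℝ) ^ (-β)) * x
      = (K + C + 1) * ((T : ℝ) ^ (-β) * (T : ℝ) ^ (-q)) := by
    rw [hx]; field_simp
  rw [hxe] at hsum
  -- The two arguments of the minimum are used here: `q ≤ 1 - β` keeps the gain of the window
  -- bounded below, and in `e2` the bound `q ≤ β` makes the variance terms comparable to it.
  have e1 : (1 : ℝ) ≤ T * ((T : ℝ) ^ (-β) * (T : ℝ) ^ (-q)) := by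
    rw [← Real.rpow_add hT0]
    nth_rewrite 1 [← Real.rpow_one (T : ℝ)]
    rw [← Real.rpow_add hT0]
    exact Real.one_le_rpow hT1 (by linarith [min_le_left (1 - β) β])
  have e2 : ((T : ℝ) ^ (-β)) ^ 2 ≤ (T : ℝ) ^ (-β) * (T : ℝ) ^ (-q) := by
    rw [sq]
    gcongr
    exact min_le_right _ _
  have e3 : C * (T * ((T : ℝ) ^ (-β)) ^ 2) ≤ C * (T * ((T : ℝ) ^ (-β) * (T : ℝ) ^ (-q))) := by
    gcongr
  nlinarith

lemma rpow_inv_bound {p D ε : ℝ} (hp : 0 < p) (hD : 0 < D) (hε : 0 < ε) {T : ℝ}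
    (hT : (D / ε) ^ (1 / p) ≤ T) : D * T ^ (-p) ≤ ε := by
  have h0 : 0 < (D / ε) ^ (1 / p) := Real.rpow_pos_of_pos (by positivity) _
  have hT0 : 0 < T := h0.trans_le hT
  have h1 : D / ε ≤ T ^ p := by
    calc D / ε = ((D / ε) ^ (1 / p)) ^ p := by
          rw [← Real.rpow_mul (by positivity), one_div_mul_cancel hp.ne', Real.rpow_one]
      _ ≤ T ^ p := Real.rpow_le_rpow h0.le hT hp.le
  rw [Real.rpow_neg hT0.le, ← div_eq_mul_inv, div_le_iff₀ (by positivity)]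
  rw [div_le_iff₀ hε] at h1
  linarith

/-- The first time at which the running minimum of `f` drops below `ε`. -/
theorem firstTime_isBigO {f : ℕ → ℝ} {p D : ℝ} (hp : 0 < p) (hD : 0 < D)
    (hf : ∀ T : ℕ, 1 ≤ T → ∃ τ < 2 * T, f τ ≤ D * (T : ℝ) ^ (-p)) {S : ℝ → Set ℕ}
    (hS : ∀ ε t, t ∈ S ε ↔ ∃ τ ≤ t, f τ ≤ ε) :
    (∀ ε, 0 < ε → (S ε).Nonempty) ∧
      (fun ε : ℝ => ((sInf (S ε) : ℕ) : ℝ)) =O[𝓝[>] (0 : ℝ)] fun ε : ℝ => ε ^ (-(1 / p)) := by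
  have hmem : ∀ ε, 0 < ε → 2 * (⌈(D / ε) ^ (1 / p)⌉₊ + 1) ∈ S ε := fun ε hε => by
    obtain ⟨τ, hτ, hle⟩ := hf (⌈(D / ε) ^ (1 / p)⌉₊ + 1) (by omega)
    refine (hS _ _).2 ⟨τ, hτ.le, hle.trans (rpow_inv_bound hp hD hε ?_)⟩
    push_cast
    linarith [Nat.le_ceil ((D / ε) ^ (1 / p))]
  refine ⟨fun ε hε => ⟨_, hmem ε hε⟩, ?_⟩
  -- The `4` collects rounding up and the added `1`, both doubled; for `ε ≤ 1` it is absorbed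
  -- because `ε ^ (-(1 / p)) ≥ 1`.
  refine IsBigO.of_bound (2 * D ^ (1 / p) + 4) ?_
  filter_upwards [Ioc_mem_nhdsGT (zero_lt_one' ℝ)] with ε hε
  have hε0 : 0 < ε := hε.1
  rw [Real.norm_of_nonneg (by positivity), Real.norm_of_nonneg (by positivity)]
  have h1 : ((sInf (S ε) : ℕ) : ℝ) ≤ (2 * (⌈(D / ε) ^ (1 / p)⌉₊ + 1) : ℕ) := by
    exact_mod_cast Nat.sInf_le (hmem ε hε0)
  have h2 := (Nat.ceil_lt_add_one (by positivity : 0 ≤ (D / ε) ^ (1 / p))).le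
  have h3 : (1 : ℝ) ≤ ε ^ (-(1 / p)) :=
    Real.one_le_rpow_of_pos_of_le_one_of_nonpos hε0 hε.2 (by
      have : 0 < 1 / p := by positivity
      linarith)
  have h4 : (D / ε) ^ (1 / p) = D ^ (1 / p) * ε ^ (-(1 / p)) := by
    rw [Real.div_rpow hD.le hε0.le, Real.rpow_neg hε0.le, div_eq_mul_inv]
  push_cast at h1
  rw [h4] at h2 h1
  nlinarith

end Rate
end


noncomputable section

/-! ### Conditioning on the past -/

section Conditioning

variable {Ω Y E : Type*} [MeasurableSpace Y] [MeasurableSpace E] {m mΩ : MeasurableSpace Ω}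
  {P : Measure Ω} [IsFiniteMeasure P] {η : Kernel Ω E} [IsMarkovKernel η] {X : Ω → Y} {e : Ω → E}

/-- `η` is the conditional law of `e` given `m`. -/
def HasConditionalLaw (m : MeasurableSpace Ω) {mΩ : MeasurableSpace Ω} (P : Measure Ω)
    (η : Kernel Ω E) (e : Ω → E) : Prop :=
  ∀ A : Set E, MeasurableSet A → ∀ F : Set Ω, MeasurableSet[m] F →
    P (F ∩ e ⁻¹' A) = ∫⁻ ω in F, η ω A ∂P

/-- Rectangles determine the joint law, and preimages under `X` are events of the past. Functions of
the past may therefore be treated as constants when integrating out `e`. -/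
lemma HasConditionalLaw.map_prodMk (h : HasConditionalLaw m P η e) (hm : m ≤ mΩ)
    (hX : Measurable[m] X) (he : Measurable e) :
    P.map (fun ω => (X ω, e ω)) = (P ⊗ₘ η).map (Prod.map X id) := by
  have hX' : Measurable X := hX.mono hm le_rfl
  have hpair : Measurable fun ω => (X ω, e ω) := hX'.prodMk he
  have hmap : Measurable (Prod.map X (id : E → E)) := hX'.prodMap measurable_id
  refine Measure.ext_prod fun {s t} hs ht => ?_
  rw [Measure.map_apply hpair (hs.prod ht), Measure.map_apply hmap (hs.prod ht)]
  have e1 : (fun ω => (X ω, e ω)) ⁻¹' s ×ˢ t = X ⁻¹' s ∩ e ⁻¹' t := rfl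
  have e2 : Prod.map X (id : E → E) ⁻¹' s ×ˢ t = (X ⁻¹' s) ×ˢ t := rfl
  rw [e1, e2, Measure.compProd_apply_prod (hX' hs) ht]
  exact h t ht _ (hX hs)

lemma HasConditionalLaw.lintegral_eq (h : HasConditionalLaw m P η e) (hm : m ≤ mΩ)
    (hX : Measurable[m] X) (he : Measurable e) {f : Y × E → ENNReal} (hf : Measurable f) :
    ∫⁻ ω, f (X ω, e ω) ∂P = ∫⁻ ω, ∫⁻ d, f (X ω, d) ∂(η ω) ∂P := by
  have hX' : Measurable X := hX.mono hm le_rfl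
  have hmap : Measurable (Prod.map X (id : E → E)) := hX'.prodMap measurable_id
  rw [← lintegral_map hf (hX'.prodMk he), h.map_prodMk hm hX he, lintegral_map hf hmap,
    Measure.lintegral_compProd (f := fun p => f (Prod.map X id p)) (hf.comp hmap)]
  rfl

lemma HasConditionalLaw.integral_eq (h : HasConditionalLaw m P η e) (hm : m ≤ mΩ)
    (hX : Measurable[m] X) (he : Measurable e) {f : Y × E → ℝ} (hf : Measurable f)
    (hi : Integrable (fun ω => f (X ω, e ω)) P) :
    Integrable (fun ω => ∫ d, f (X ω, d) ∂(η ω)) P ∧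
      ∫ ω, f (X ω, e ω) ∂P = ∫ ω, ∫ d, f (X ω, d) ∂(η ω) ∂P := by
  have hX' : Measurable X := hX.mono hm le_rfl
  have hmap : Measurable (Prod.map X (id : E → E)) := hX'.prodMap measurable_id
  have hpair := hX'.prodMk he
  have hi1 : Integrable f (P.map fun ω => (X ω, e ω)) :=
    (integrable_map_measure hf.aestronglyMeasurable hpair.aemeasurable).2 hi
  rw [h.map_prodMk hm hX he] at hi1
  have hi2 : Integrable (f ∘ Prod.map X id) (P ⊗ₘ η) :=
    (integrable_map_measure hf.aestronglyMeasurable hmap.aemeasurable).1 hi1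
  refine ⟨by
    rw [Measure.compProd] at hi2
    simpa using hi2.integral_compProd, ?_⟩
  rw [← integral_map hpair.aemeasurable hf.aestronglyMeasurable, h.map_prodMk hm hX he,
    integral_map hmap.aemeasurable hf.aestronglyMeasurable]
  exact Measure.integral_compProd hi2

end Conditioning

lemma PlayMode.measurable_acting {ι : Type*} {M : ι → ℕ} (mode : PlayMode) (i : ι) :
    Measurable fun b : ι → Param M => mode.acting b i := by
  cases mode with
  | joint => exact measurable_id
  | separate => exact measurable_pi_lambda _ fun _ => measurable_pi_apply i

/-! ### Beliefs, acting parameters and conditional means -/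

section Algorithm

variable {ι S A Ω : Type*} [Fintype ι] [MeasurableSpace S] [MeasurableSpace A]
  {mΩ : MeasurableSpace Ω} {M : ι → ℕ} {ν : Measure A}

/-- The total error of the beliefs `b` about the parameters `θ`. -/
def beliefError (b : ι → Param M) (θ : Param M) : ℝ := ∑ n, ∑ j, ‖b n j - θ j‖

lemma beliefError_nonneg (b : ι → Param M) (θ : Param M) : 0 ≤ beliefError b θ :=
  Finset.sum_nonneg fun _ _ => Finset.sum_nonneg fun _ _ => norm_nonneg _

lemma norm_sub_le_beliefError (b : ι → Param M) (θ : Param M) (n : ι) :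
    ‖b n - θ‖ ≤ beliefError b θ :=
  (Param.norm_le_sum _).trans (Finset.single_le_sum (f := fun n => ∑ j, ‖b n j - θ j‖)
    (fun _ _ => Finset.sum_nonneg fun _ _ => norm_nonneg _) (Finset.mem_univ n))

/-- In either mode the acting parameters are beliefs of some agents, so the rest of the proof does
not distinguish the modes. -/
lemma norm_acting_sub_le (mode : PlayMode) (b : ι → Param M) (θ : Param M) (i : ι) :
    ‖mode.acting b i - fun _ => θ‖ ≤ beliefError b θ := by
  refine (pi_norm_le_iff_of_nonneg (beliefError_nonneg b θ)).2 fun n => ?_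
  cases mode with
  | joint => exact norm_sub_le_beliefError b θ n
  | separate => exact norm_sub_le_beliefError b θ i

lemma norm_const_sub_acting_le (mode : PlayMode) (b : ι → Param M) (θ : Param M) (i : ι) :
    ‖(fun _ => b i) - mode.acting b i‖ ≤ 2 * beliefError b θ := by
  have h1 : ‖(fun _ : ι => b i) - fun _ => θ‖ ≤ beliefError b θ :=
    (pi_norm_le_iff_of_nonneg (beliefError_nonneg b θ)).2 fun n =>
      norm_sub_le_beliefError b θ i
  have h2 := norm_acting_sub_le mode b θ i
  rw [norm_sub_rev] at h2
  calc _ ≤ _ := norm_sub_le_norm_sub_add_norm_sub _ (fun _ => θ) _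
    _ ≤ _ := by linarith

variable [SigmaFinite ν] {Γ : MarkovGame ι S A} {π : ParamPolicy ι S A M ν}
  {mode : PlayMode} {est : ι → RewardEstimator} {c : ℝ} {α : ℕ → ℝ} {w : ℕ → ι → ι → ι → ℝ}
  {P : Measure Ω} {ℱ : Filtration ℕ mΩ} {θ : ℕ → Ω → Param M} {b : ℕ → ι → Ω → Param M}
  {ep : ℕ → ι → Ω → Episode ι S A} {B V L R : ℝ}

/-- Evaluating the scores at the beliefs instead of the acting parameters costs at most a
multiple of the belief error. -/
lemma NetworkedPolicyGradientPlay.norm_stochGradient_sub_le (h : ScoreAssumption π B V L) (hL : 0 ≤ L)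
    (hR : BoundedReward Γ R) (hR0 : 0 ≤ R) (hc : 0 ≤ c) (e : RewardEstimator) (i : ι)
    (b : ι → Param M) (θ : Param M) (d : Episode ι S A) :
    ‖stochGradient Γ π c e i (b i) d - actingGradient Γ π c e i (mode.acting b i) d‖
      ≤ 2 * (c * rewardBound Γ R * (Fintype.card ι * L)) * beliefError b θ := by
  have := rewardBound_nonneg Γ hR0
  rw [stochGradient_eq]
  calc _ ≤ c * rewardBound Γ R * (Fintype.card ι * L) * ‖(fun _ => b i) - mode.acting b i‖ :=
        norm_actingGradient_sub_le h hL hR hR0 hc e i _ _ d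
    _ ≤ c * rewardBound Γ R * (Fintype.card ι * L) * (2 * beliefError b θ) := by
        gcongr; exact norm_const_sub_acting_le mode b θ i
    _ = _ := by ring

variable [DecidableEq ι]

namespace NetworkedPolicyGradientPlay

lemma measurable_beliefs (halg : NetworkedPolicyGradientPlay Γ π mode est c α w P ℱ θ b ep)
    (t : ℕ) : Measurable[ℱ t] fun ω n => b t n ω :=
  @measurable_pi_lambda _ _ _ (ℱ t) _ _ fun n => halg.measurable_belief t n

/-- The parameters by which the actions in the episode of agent `i` are drawn. -/
lemma measurable_acting (halg : NetworkedPolicyGradientPlay Γ π mode est c α w P ℱ θ b ep)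
    (t : ℕ) (i : ι) : Measurable[ℱ t] fun ω => mode.acting (fun n => b t n ω) i :=
  (mode.measurable_acting i).comp (halg.measurable_beliefs t)

lemma hasConditionalLaw (halg : NetworkedPolicyGradientPlay Γ π mode est c α w P ℱ θ b ep)
    (t : ℕ) (i : ι) : HasConditionalLaw (ℱ t) P ((episodeLaw Γ π).comap
      (fun ω => mode.acting (fun n => b t n ω) i)
      ((halg.measurable_acting t i).mono (ℱ.le t) le_rfl)) (ep t i) := fun E hE F hF =>
  halg.episode_law t i E hE F hF

lemma measurable_ep (halg : NetworkedPolicyGradientPlay Γ π mode est c α w P ℱ θ b ep)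
    (t : ℕ) (i : ι) : Measurable (ep t i) :=
  (halg.measurable_episode t i).mono (ℱ.le _) le_rfl

lemma measurable_theta (halg : NetworkedPolicyGradientPlay Γ π mode est c α w P ℱ θ b ep)
    (t : ℕ) : Measurable (θ t) :=
  (halg.measurable_param t).mono (ℱ.le _) le_rfl

lemma measurable_b (halg : NetworkedPolicyGradientPlay Γ π mode est c α w P ℱ θ b ep)
    (t : ℕ) (i : ι) : Measurable (b t i) :=
  (halg.measurable_belief t i).mono (ℱ.le _) le_rfl

lemma measurable_actingGradient
    (halg : NetworkedPolicyGradientPlay Γ π mode est c α w P ℱ θ b ep) (t : ℕ) (i : ι) :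
    Measurable fun ω => actingGradient Γ π c (est i) i
      (mode.acting (fun n => b t n ω) i) (ep t i ω) := by
  have h1 : Measurable fun ω => (mode.acting (fun n => b t n ω) i, ep t i ω) :=
    ((halg.measurable_acting t i).mono (ℱ.le _) le_rfl).prodMk (halg.measurable_ep t i)
  have h2 := Measurable.comp (_root_.measurable_actingGradient Γ π c (est i) i) h1
  exact h2

lemma measurable_stochGradient
    (halg : NetworkedPolicyGradientPlay Γ π mode est c α w P ℱ θ b ep) (t : ℕ) (i : ι) :
    Measurable fun ω => stochGradient Γ π c (est i) i (b t i ω) (ep t i ω) := by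
  have h1 : Measurable fun ω => ((fun _ : ι => b t i ω), ep t i ω) :=
    (measurable_pi_lambda _ fun _ => halg.measurable_b t i).prodMk (halg.measurable_ep t i)
  have h2 := Measurable.comp (_root_.measurable_actingGradient Γ π c (est i) i) h1
  exact h2

variable [IsProbabilityMeasure P]

/-- The conditional second moment is bounded whatever the beliefs are, since scores and actions
refer to the same parameters; no control of the belief errors is needed. -/
lemma exists_integral_actingGradient_sq_le (h : ScoreAssumption π B V L)
    (hR : BoundedReward Γ R) (hR0 : 0 ≤ R) (hc : 0 ≤ c)
    (halg : NetworkedPolicyGradientPlay Γ π mode est c α w P ℱ θ b ep) :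
    ∃ C : ℝ, 0 ≤ C ∧ ∀ t i,
      Integrable (fun ω => ‖actingGradient Γ π c (est i) i
        (mode.acting (fun n => b t n ω) i) (ep t i ω)‖ ^ 2) P ∧
      ∫ ω, ‖actingGradient Γ π c (est i) i
        (mode.acting (fun n => b t n ω) i) (ep t i ω)‖ ^ 2 ∂P ≤ C := by
  obtain ⟨C, hC, hsq⟩ := exists_lintegral_actingGradient_sq_le (Γ := Γ) h hR hR0 hc
  refine ⟨C, hC, fun t i => integrable_sq_of_lintegral_le
    (halg.measurable_actingGradient t i) hC ?_⟩
  have hm : Measurable fun p : (ι → Param M) × Episode ι S A =>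
      ‖actingGradient Γ π c (est i) i p.1 p.2‖ₑ ^ 2 :=
    (_root_.measurable_actingGradient Γ π c (est i) i).enorm.pow_const 2
  have e1 := (halg.hasConditionalLaw t i).lintegral_eq (ℱ.le t) (halg.measurable_acting t i)
    (halg.measurable_ep t i) hm
  rw [e1]
  calc _ ≤ ∫⁻ _ω, ENNReal.ofReal C ∂P := lintegral_mono fun ω => by
        refine le_trans (le_of_eq (lintegral_congr fun d => ?_))
          (hsq (est i) i (mode.acting (fun n => b t n ω) i))
        rw [ENNReal.ofReal_pow (norm_nonneg _), ofReal_norm]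
    _ = _ := by simp

/-- The mean of the acting gradient is close to the gradient of the potential. -/
lemma exists_le_integral_inner {u : Param M → ℝ} (hu : IsPotential Γ π u)
    (h : ScoreAssumption π B V L) (hL : 0 ≤ L)
    (hR : BoundedReward Γ R) (hR0 : 0 ≤ R) (hc : 0 ≤ c)
    (halg : NetworkedPolicyGradientPlay Γ π mode est c α w P ℱ θ b ep) :
    ∃ C : ℝ, 0 ≤ C ∧ ∀ t i, Integrable (fun ω => beliefError (fun n => b t n ω) (θ t ω)) P →
      Integrable (fun ω => inner ℝ (gradient u (θ t ω) i) (actingGradient Γ π c (est i) i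
        (mode.acting (fun n => b t n ω) i) (ep t i ω))) P ∧
      c * (1 - Γ.discount) * ∫ ω, ‖gradient u (θ t ω) i‖ ^ 2 ∂P
        - C * ∫ ω, beliefError (fun n => b t n ω) (θ t ω) ∂P
      ≤ ∫ ω, inner ℝ (gradient u (θ t ω) i) (actingGradient Γ π c (est i) i
        (mode.acting (fun n => b t n ω) i) (ep t i ω)) ∂P := by
  obtain ⟨C₁, hC₁, hbias⟩ := exists_norm_integral_actingGradient_sub_le (Γ := Γ) h hL hR hR0 hc
    hu.differentiable_utility
  obtain ⟨C₂, hC₂, hlip⟩ := hu.exists_lipschitz_gradient h hL hR hR0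
  obtain ⟨C₃, hC₃, hbd⟩ := hu.exists_norm_gradient_le h hL hR hR0
  obtain ⟨C₄, hC₄, hsq⟩ := exists_integral_actingGradient_sq_le h hR hR0 hc halg
  have hcont : Continuous (gradient u) :=
    (LipschitzWith.of_dist_le_mul (K := ⟨C₂, hC₂⟩) fun x y => by
      rw [dist_eq_norm, dist_eq_norm]; exact hlip x y).continuous
  refine ⟨C₃ * C₁, by positivity, fun t i he => ?_⟩
  have hmi : Measurable fun x : Param M => gradient u x i := by
    have h1 : Measurable fun g : Param M => g i := by fun_prop
    exact h1.comp hcont.measurable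
  have hmg : Measurable fun ω => gradient u (θ t ω) i := hmi.comp (halg.measurable_theta t)
  have hbdi : ∀ x, ‖gradient u x i‖ ≤ C₃ := fun x => (Param.norm_apply_le _ i).trans (hbd x)
  have hint : Integrable (fun ω => inner ℝ (gradient u (θ t ω) i) (actingGradient Γ π c (est i) i
        (mode.acting (fun n => b t n ω) i) (ep t i ω))) P := by
    refine (((integrable_const (1 : ℝ)).add (hsq t i).1).const_mul C₃).mono'
      (hmg.inner (halg.measurable_actingGradient t i)).aestronglyMeasurable
      (ae_of_all _ fun ω => ?_)
    refine (norm_inner_le_norm _ _).trans (mul_le_mul (hbdi _) ?_ (norm_nonneg _) hC₃)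
    simp only [Pi.add_apply]
    set z := ‖actingGradient Γ π c (est i) i (mode.acting (fun n => b t n ω) i) (ep t i ω)‖
    nlinarith [sq_nonneg (z - 1)]
  refine ⟨hint, ?_⟩
  have hm2 : Measurable fun p : (Param M × (ι → Param M)) × Episode ι S A =>
      inner ℝ (gradient u p.1.1 i) (actingGradient Γ π c (est i) i p.1.2 p.2) := by
    have h1 : Measurable fun p : (Param M × (ι → Param M)) × Episode ι S A =>
      gradient u p.1.1 i := hmi.comp (measurable_fst.comp measurable_fst)
    have h2 : Measurable fun p : (Param M × (ι → Param M)) × Episode ι S A => (p.1.2, p.2) := by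
      fun_prop
    have h3 := Measurable.comp (_root_.measurable_actingGradient Γ π c (est i) i) h2
    exact h1.inner h3
  have hpair : Measurable[ℱ t] fun ω => (θ t ω, mode.acting (fun n => b t n ω) i) :=
    (halg.measurable_param t).prodMk (halg.measurable_acting t i)
  obtain ⟨hi1, hi2⟩ := (halg.hasConditionalLaw t i).integral_eq (ℱ.le t) hpair
    (halg.measurable_ep t i) hm2 hint
  rw [hi2]
  have hsqi : Integrable (fun ω => ‖gradient u (θ t ω) i‖ ^ 2) P :=
    integrable_of_abs_le (hmg.norm.pow_const 2) (C := C₃ ^ 2) fun ω => by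
      rw [abs_of_nonneg (by positivity)]
      exact pow_le_pow_left₀ (norm_nonneg _) (hbdi _) 2
  rw [← integral_const_mul, ← integral_const_mul,
    ← integral_sub (hsqi.const_mul _) (he.const_mul _)]
  refine integral_mono ((hsqi.const_mul _).sub (he.const_mul _)) hi1 fun ω => ?_
  simp only [Kernel.comap_apply]
  set φ := mode.acting (fun n => b t n ω) i with hφ
  rw [integral_inner (integrable_actingGradient h hR hR0 c (est i) i φ)]
  set m := ∫ d, actingGradient Γ π c (est i) i φ d ∂(episodeLaw Γ π φ) with hmdef
  have hb := hbias (est i) i φ (θ t ω)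
  -- The conditional mean is split into the true gradient, which contributes the square, and the
  -- bias, which is paired with a bounded gradient and so costs a multiple of the belief error.
  rw [hu.gradient_eq, ← hmdef] at hb
  have e1 : inner ℝ (gradient u (θ t ω) i) m
      = c * (1 - Γ.discount) * ‖gradient u (θ t ω) i‖ ^ 2
        + inner ℝ (gradient u (θ t ω) i)
          (m - (c * (1 - Γ.discount)) • gradient u (θ t ω) i) := by
    rw [inner_sub_right, real_inner_smul_right, real_inner_self_eq_norm_sq]
    ring
  have e2 : |inner ℝ (gradient u (θ t ω) i)
          (m - (c * (1 - Γ.discount)) • gradient u (θ t ω) i)|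
      ≤ C₃ * C₁ * beliefError (fun n => b t n ω) (θ t ω) := by
    refine (abs_real_inner_le_norm _ _).trans ?_
    rw [mul_assoc]
    refine mul_le_mul (hbdi _) (hb.trans ?_) (norm_nonneg _) hC₃
    exact mul_le_mul_of_nonneg_left (norm_acting_sub_le mode _ _ i) hC₁
  rw [e1]
  linarith [(abs_le.1 e2).1]

end NetworkedPolicyGradientPlay

end Algorithm
end


noncomputable section

/-! ### The expected belief errors decay like the step sizes -/

lemma EuclideanSpace.norm_le_sum_abs {n : Type*} [Fintype n] (x : EuclideanSpace ℝ n) :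
    ‖x‖ ≤ ∑ i, |x i| := by
  refine le_of_sq_le_sq ?_ (Finset.sum_nonneg fun i _ => abs_nonneg _)
  rw [EuclideanSpace.real_norm_sq_eq]
  simp_rw [← sq_abs (x.ofLp _)]
  exact Finset.sum_sq_le_sq_sum_of_nonneg fun i _ => abs_nonneg _

section BeliefDecay

variable {ι S A Ω : Type*} [Fintype ι] [DecidableEq ι] [MeasurableSpace S] [MeasurableSpace A]
  {mΩ : MeasurableSpace Ω} {M : ι → ℕ} {ν : Measure A} [SigmaFinite ν]
  {Γ : MarkovGame ι S A} {π : ParamPolicy ι S A M ν}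
  {mode : PlayMode} {est : ι → RewardEstimator} {c : ℝ} {α : ℕ → ℝ} {w : ℕ → ι → ι → ι → ℝ}
  {P : Measure Ω} {ℱ : Filtration ℕ mΩ} {θ : ℕ → Ω → Param M} {b : ℕ → ι → Ω → Param M}
  {ep : ℕ → ι → Ω → Episode ι S A} {B V L R h : ℝ} {G : ℕ → SimpleGraph ι}

namespace NetworkedPolicyGradientPlay

lemma own_belief (halg : NetworkedPolicyGradientPlay Γ π mode est c α w P ℱ θ b ep)
    (hw : WeightAssumption G w h) (t : ℕ) (j : ι) (ω : Ω) : b t j ω j = θ t ω j := by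
  cases t with
  | zero => exact halg.own_init j ω
  | succ t =>
    rw [halg.belief_step, Finset.sum_eq_single j]
    · rw [hw.own _ (by omega), one_smul, if_pos rfl]
    · intro l _ hl
      rw [hw.own_other _ (by omega) j l hl, zero_smul]
    · simp

/-- Errors are measured against the new parameter. The value received from `j` itself is already the
new one and contributes nothing; all other values are also off by the increment of `j`. -/
lemma norm_belief_step_le (halg : NetworkedPolicyGradientPlay Γ π mode est c α w P ℱ θ b ep)
    (hw : WeightAssumption G w h) (hh0 : 0 ≤ h) (hα : ∀ t, 1 ≤ t → 0 < α t) (t : ℕ) (i j : ι)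
    (ω : Ω) :
    ‖b (t + 1) i ω j - θ (t + 1) ω j‖ ≤ ∑ l, w (t + 1) i j l * if l = j then 0 else
      ‖b t l ω j - θ t ω j‖ + α (t + 1) * ‖stochGradient Γ π c (est j) j (b t j ω) (ep t j ω)‖ := by
  have e1 : b (t + 1) i ω j - θ (t + 1) ω j = ∑ l, w (t + 1) i j l •
      ((if l = j then θ (t + 1) ω j else b t l ω j) - θ (t + 1) ω j) := by
    simp only [smul_sub, Finset.sum_sub_distrib, ← Finset.sum_smul]
    rw [hw.sum_one _ (by omega), one_smul, halg.belief_step]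
  rw [e1]
  refine norm_sum_le_of_le _ fun l _ => ?_
  rw [norm_smul, Real.norm_of_nonneg (hw.nonneg hh0 (by omega) i j l)]
  refine mul_le_mul_of_nonneg_left ?_ (hw.nonneg hh0 (by omega) i j l)
  split_ifs with hl
  · simp
  · rw [halg.param_step, ← sub_sub]
    refine (norm_sub_le _ _).trans (le_of_eq ?_)
    rw [norm_smul, Real.norm_of_nonneg (hα _ (by omega)).le]

lemma measurable_belief_error
    (halg : NetworkedPolicyGradientPlay Γ π mode est c α w P ℱ θ b ep) (t : ℕ) (i j : ι) :
    Measurable fun ω => ‖b t i ω j - θ t ω j‖ := by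
  have h1 : Measurable fun g : Param M => g j := by fun_prop
  exact ((h1.comp (halg.measurable_b t i)).sub (h1.comp (halg.measurable_theta t))).norm

lemma integrable_initial_error
    (halg : NetworkedPolicyGradientPlay Γ π mode est c α w P ℱ θ b ep) {κ : ℝ}
    (hinit : InitialBeliefError P (θ 0) (b 0) κ) (i j : ι) :
    Integrable (fun ω => ‖b 0 i ω j - θ 0 ω j‖) P := by
  by_cases hij : i = j
  · subst hij
    simp [halg.own_init]
  · have hm : ∀ m : Fin (M j), Measurable fun ω => |b 0 i ω j m - θ 0 ω j m| := fun m => by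
      have h1 : Measurable fun g : Param M => g j m := by fun_prop
      exact ((h1.comp (halg.measurable_b 0 i)).sub (h1.comp (halg.measurable_theta 0))).abs
    have hi : ∀ m : Fin (M j), Integrable (fun ω => |b 0 i ω j m - θ 0 ω j m|) P := fun m =>
      (lintegral_ofReal_ne_top_iff_integrable (hm m).aestronglyMeasurable
        (ae_of_all _ fun ω => abs_nonneg _)).1
        ((hinit i j hij m).trans_lt ENNReal.ofReal_lt_top).ne
    refine (integrable_finsetSum Finset.univ fun m _ => hi m).mono'
      (halg.measurable_belief_error 0 i j).aestronglyMeasurable (ae_of_all _ fun ω => ?_)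
    rw [norm_norm]
    exact EuclideanSpace.norm_le_sum_abs _

variable [IsProbabilityMeasure P]

/-- The acting gradient has bounded second moments, and the correction to the belief of the agent is
linear in the belief error. The belief errors thus feed back into their own perturbations, which is
why the contraction argument admits a factor `1 + m`. -/
lemma exists_integral_stochGradient_le (hs : ScoreAssumption π B V L) (hL : 0 ≤ L)
    (hR : BoundedReward Γ R) (hR0 : 0 ≤ R) (hc : 0 ≤ c)
    (halg : NetworkedPolicyGradientPlay Γ π mode est c α w P ℱ θ b ep) :
    ∃ C : ℝ, 0 ≤ C ∧ ∀ t i, Integrable (fun ω => beliefError (fun n => b t n ω) (θ t ω)) P →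
      Integrable (fun ω => ‖stochGradient Γ π c (est i) i (b t i ω) (ep t i ω)‖) P ∧
      ∫ ω, ‖stochGradient Γ π c (est i) i (b t i ω) (ep t i ω)‖ ∂P
        ≤ C * (1 + ∫ ω, beliefError (fun n => b t n ω) (θ t ω) ∂P) := by
  obtain ⟨C₁, hC₁, hsq⟩ := exists_integral_actingGradient_sq_le hs hR hR0 hc halg
  have hrb := rewardBound_nonneg Γ hR0
  set C₂ := 2 * (c * rewardBound Γ R * (Fintype.card ι * L)) with hC₂
  have hC₂0 : 0 ≤ C₂ := by positivity
  refine ⟨1 + C₁ + C₂, by positivity, fun t i he => ?_⟩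
  have hsq1 : Integrable (fun ω => 1 + ‖actingGradient Γ π c (est i) i
      (mode.acting (fun n => b t n ω) i) (ep t i ω)‖ ^ 2) P := (integrable_const 1).add (hsq t i).1
  have hle : ∀ ω, ‖stochGradient Γ π c (est i) i (b t i ω) (ep t i ω)‖
      ≤ (1 + ‖actingGradient Γ π c (est i) i (mode.acting (fun n => b t n ω) i) (ep t i ω)‖ ^ 2)
        + C₂ * beliefError (fun n => b t n ω) (θ t ω) := fun ω => by
    have h1 := norm_stochGradient_sub_le (Γ := Γ) (mode := mode) hs hL hR hR0 hc (est i) i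
      (fun n => b t n ω) (θ t ω) (ep t i ω)
    have h2 := norm_sub_norm_le (stochGradient Γ π c (est i) i (b t i ω) (ep t i ω))
      (actingGradient Γ π c (est i) i (mode.acting (fun n => b t n ω) i) (ep t i ω))
    set z := ‖actingGradient Γ π c (est i) i (mode.acting (fun n => b t n ω) i) (ep t i ω)‖
    nlinarith [sq_nonneg (z - 1)]
  have hi : Integrable (fun ω => ‖stochGradient Γ π c (est i) i (b t i ω) (ep t i ω)‖) P :=
    (hsq1.add (he.const_mul C₂)).mono' (halg.measurable_stochGradient t i).norm.aestronglyMeasurable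
      (ae_of_all _ fun ω => by rw [norm_norm]; exact hle ω)
  refine ⟨hi, (integral_mono hi (hsq1.add (he.const_mul C₂)) hle).trans ?_⟩
  have e0 : 0 ≤ ∫ ω, beliefError (fun n => b t n ω) (θ t ω) ∂P :=
    integral_nonneg fun ω => beliefError_nonneg _ _
  have e1 := integral_add hsq1 (he.const_mul C₂)
  have e2 := integral_add (integrable_const (1 : ℝ)) (hsq t i).1
  simp only [Pi.add_apply] at e1 e2 ⊢
  rw [e1, e2, integral_const_mul, integral_const, probReal_univ, one_smul]
  nlinarith [(hsq t i).2]

/-- Induction on time over all pairs at once: integrability of the gradients at time `t` rests on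
that of all belief errors at time `t`. -/
lemma integrable_belief_error (hs : ScoreAssumption π B V L) (hL : 0 ≤ L)
    (hR : BoundedReward Γ R) (hR0 : 0 ≤ R) (hc : 0 ≤ c)
    (halg : NetworkedPolicyGradientPlay Γ π mode est c α w P ℱ θ b ep)
    (hw : WeightAssumption G w h) (hh0 : 0 ≤ h) (hα : ∀ t, 1 ≤ t → 0 < α t) {κ : ℝ}
    (hinit : InitialBeliefError P (θ 0) (b 0) κ) (t : ℕ) (i j : ι) :
    Integrable (fun ω => ‖b t i ω j - θ t ω j‖) P := by
  obtain ⟨C, -, hg⟩ := exists_integral_stochGradient_le hs hL hR hR0 hc halg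
  induction t generalizing i j with
  | zero => exact halg.integrable_initial_error hinit i j
  | succ t ih =>
    have he : Integrable (fun ω => beliefError (fun n => b t n ω) (θ t ω)) P :=
      integrable_finsetSum _ fun n _ => integrable_finsetSum _ fun j _ => ih n j
    have hsum : Integrable (fun ω => ∑ l, w (t + 1) i j l * if l = j then 0 else
        ‖b t l ω j - θ t ω j‖
          + α (t + 1) * ‖stochGradient Γ π c (est j) j (b t j ω) (ep t j ω)‖) P := by
      refine integrable_finsetSum _ fun l _ => Integrable.const_mul ?_ _
      split_ifs
      · exact integrable_zero _ _ _
      · exact (ih l j).add ((hg t j he).1.const_mul _)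
    refine hsum.mono' (halg.measurable_belief_error _ i j).aestronglyMeasurable
      (ae_of_all _ fun ω => ?_)
    rw [norm_norm]
    exact halg.norm_belief_step_le hw hh0 hα t i j ω

/-- The expected belief errors are of the order of the step sizes. -/
theorem exists_integral_beliefError_le (hs : ScoreAssumption π B V L) (hL : 0 ≤ L)
    (hR : BoundedReward Γ R) (hR0 : 0 ≤ R) (hc : 0 ≤ c)
    (halg : NetworkedPolicyGradientPlay Γ π mode est c α w P ℱ θ b ep)
    (hG : ConnectedNetwork G) (hw : WeightAssumption G w h) (hh0 : 0 < h) (hh1 : h < 1)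
    (hα : ∀ t, 1 ≤ t → 0 < α t) {A β : ℝ} (hA : 0 ≤ A) (hβ : 0 < β)
    (hαA : ∀ t, α (t + 1) ≤ A * powerDecay β t) {κ : ℝ}
    (hinit : InitialBeliefError P (θ 0) (b 0) κ) :
    (∀ t, Integrable (fun ω => beliefError (fun n => b t n ω) (θ t ω)) P) ∧
    ∃ D : ℝ, 0 ≤ D ∧ ∀ t, ∫ ω, beliefError (fun n => b t n ω) (θ t ω) ∂P
      ≤ D * powerDecay β t := by
  have hint := integrable_belief_error hs hL hR hR0 hc halg hw hh0.le hα hinit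
  have he : ∀ t, Integrable (fun ω => beliefError (fun n => b t n ω) (θ t ω)) P := fun t =>
    integrable_finsetSum _ fun n _ => integrable_finsetSum _ fun j _ => hint t n j
  refine ⟨he, ?_⟩
  obtain ⟨C, hC, hg⟩ := exists_integral_stochGradient_le hs hL hR hR0 hc halg
  obtain ⟨W, hW, hcontr⟩ := hG.exists_contraction hw hh0 hh1
  set N : ℝ := (Fintype.card ι : ℝ) with hN
  set X : ℕ → ι → ι → ℝ := fun t i j => ∫ ω, ‖b t i ω j - θ t ω j‖ ∂P with hX
  set m : ℕ → ℝ := fun t => ‖fun p : ι × ι => X t p.1 p.2‖ with hm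
  have hX0 : ∀ t i j, 0 ≤ X t i j := fun t i j => integral_nonneg fun ω => norm_nonneg _
  have hXm : ∀ t i j, X t i j ≤ m t := fun t i j =>
    (le_abs_self _).trans (norm_le_pi_norm (fun p : ι × ι => X t p.1 p.2) (i, j))
  have hm0 : ∀ t, 0 ≤ m t := fun t => norm_nonneg _
  have hem : ∀ t, ∫ ω, beliefError (fun n => b t n ω) (θ t ω) ∂P ≤ N * N * m t := fun t => by
    simp only [beliefError]
    rw [integral_finsetSum _ fun n _ => integrable_finsetSum _ fun j _ => hint t n j]
    calc _ = ∑ n, ∑ j, X t n j :=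
          Finset.sum_congr rfl fun n _ => integral_finsetSum _ fun j _ => hint t n j
      _ ≤ ∑ _n : ι, ∑ _j : ι, m t :=
          Finset.sum_le_sum fun n _ => Finset.sum_le_sum fun j _ => hXm t n j
      _ = _ := by simp [mul_assoc, hN]
  -- Taking expectations makes the recursion deterministic; the randomness enters only through the
  -- mean norm of the stochastic gradient.
  have hbe : ∀ j, BeliefError w j (fun t i => X t i j) fun t =>
      α (t + 1) * ∫ ω, ‖stochGradient Γ π c (est j) j (b t j ω) (ep t j ω)‖ ∂P := fun j =>
    { own := fun t => by simp [hX, halg.own_belief hw]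
      perturbation_nonneg := fun t => mul_nonneg (hα _ (by omega)).le
        (integral_nonneg fun ω => norm_nonneg _)
      step := fun t i => by
        have hterm : ∀ l, Integrable (fun ω => w (t + 1) i j l * if l = j then 0 else
            ‖b t l ω j - θ t ω j‖
              + α (t + 1) * ‖stochGradient Γ π c (est j) j (b t j ω) (ep t j ω)‖) P := fun l => by
          refine Integrable.const_mul ?_ _
          split_ifs
          · exact integrable_zero _ _ _
          · exact (hint t l j).add ((hg t j (he t)).1.const_mul _)
        refine (integral_mono (hint (t + 1) i j) (integrable_finsetSum _ fun l _ => hterm l)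
          fun ω => halg.norm_belief_step_le hw hh0.le hα t i j ω).trans (le_of_eq ?_)
        rw [integral_finsetSum _ fun l _ => hterm l]
        refine Finset.sum_congr rfl fun l _ => ?_
        rw [integral_const_mul]
        split_ifs
        · simp
        · rw [integral_add (hint t l j) ((hg t j (he t)).1.const_mul _), integral_const_mul] }
  set K := A * C * (1 + N * N) with hK
  have hNN : 0 ≤ N * N := by positivity
  have hhW : 0 < h ^ W := pow_pos hh0 W
  obtain ⟨D, hD, hmD⟩ := exists_le_mul_of_contraction (m := m) (v := powerDecay β) (W := W)
    (δ := h ^ W) (K := K) hW hhW (pow_le_one₀ hh0.le hh1.le) (by positivity) hm0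
    (powerDecay_pos β) (antitone_powerDecay hβ.le) (tendsto_powerDecay hβ)
    (eventually_le_powerDecay_add β W (by linarith)) (fun t => by
      have hv : ∀ s, 0 < powerDecay β (t + s) := fun s => powerDecay_pos β _
      have hh : 0 ≤ 1 - h ^ W := sub_nonneg.2 (pow_le_one₀ hh0.le hh1.le)
      have hsum0 : 0 ≤ ∑ s ∈ Finset.range W, powerDecay β (t + s) * (1 + m (t + s)) :=
        Finset.sum_nonneg fun s _ => mul_nonneg (hv s).le (by linarith [hm0 (t + s)])
      refine (pi_norm_le_iff_of_nonneg (by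
        have := hm0 t
        have hK0 : 0 ≤ K := by positivity
        positivity)).2 fun p => ?_
      rw [Real.norm_of_nonneg (hX0 _ _ _)]
      refine (hcontr p.2 _ _ (hbe p.2) t (m t) (hm0 t) (fun l => hXm t l p.2) p.1).trans ?_
      refine add_le_add le_rfl ?_
      rw [Finset.mul_sum]
      refine Finset.sum_le_sum fun s _ => ?_
      have h1 := (hg (t + s) p.2 (he (t + s))).2
      have h2 := hem (t + s)
      have h3 := hm0 (t + s)
      calc _ ≤ A * powerDecay β (t + s) * (C * (1 + N * N * m (t + s))) := by
            refine mul_le_mul (hαA (t + s)) (h1.trans ?_)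
              (integral_nonneg fun ω => norm_nonneg _) (mul_nonneg hA (hv s).le)
            gcongr
        _ ≤ A * powerDecay β (t + s) * (C * ((1 + N * N) * (1 + m (t + s)))) := by
            have := (hv s).le
            gcongr
            nlinarith
        _ = _ := by rw [hK]; ring)
  refine ⟨N * N * D, by positivity, fun t => (hem t).trans ?_⟩
  rw [mul_assoc (N * N)]
  exact mul_le_mul_of_nonneg_left (hmD t) hNN

end NetworkedPolicyGradientPlay

end BeliefDecay
end


noncomputable section

/-! ### Expected ascent of the potential -/

lemma mem_stationaryTimes {ι Ω : Type*} [Fintype ι] {mΩ : MeasurableSpace Ω} {M : ι → ℕ}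
    {P : Measure Ω} {u : Param M → ℝ} {θ : ℕ → Ω → Param M} {t : ℕ} {ε : ℝ} :
    t ∈ stationaryTimes P u θ ε ↔ ∃ τ ≤ t, ∫ ω, ‖gradient u (θ τ ω)‖ ^ 2 ∂P ≤ ε := by
  simp only [stationaryTimes, Set.mem_ofPred_eq, Finset.inf'_le_iff, Finset.mem_range,
    Nat.lt_succ_iff]

section Ascent

/-- One ascent step along `g`, compared with the step along `g'`. -/
lemma ascent_step {ι : Type*} [Fintype ι] {M : ι → ℕ} {u : Param M → ℝ} (hu : Differentiable ℝ u)
    {C K : ℝ} (hC : 0 ≤ C) (hK : 0 ≤ K)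
    (hlip : ∀ x y, ‖gradient u x - gradient u y‖ ≤ C * ‖x - y‖) (hbd : ∀ x, ‖gradient u x‖ ≤ K)
    {x y : Param M} {g g' : (i : ι) → EuclideanSpace ℝ (Fin (M i))} {a : ℝ} (ha : 0 ≤ a)
    (hy : ∀ i, y i = x i + a • g i) :
    a * ∑ i, inner ℝ (gradient u x i) (g' i) - C * a ^ 2 * ∑ i, ‖g' i‖ ^ 2
      - K * a * ∑ i, ‖g i - g' i‖ ≤ u y - u x := by
  -- The actual step is compared with the step along `g'`. The quadratic remainder then involves
  -- only `g'`, for which second moments exist. The deviation `g - g'` is of the size of the belief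
  -- error, known only in first moment, and is handled by the bounded gradient.
  set v : Param M := WithLp.toLp 2 g' with hv
  have h1 := abs_sub_sub_inner_gradient_le hu hC hlip x (x + a • v)
  have h2 := abs_sub_le_of_norm_gradient_le hu hbd (x + a • v) y
  have h3 : ‖y - (x + a • v)‖ ≤ a * ∑ i, ‖g i - g' i‖ := by
    refine (Param.norm_le_sum _).trans (le_of_eq ?_)
    rw [Finset.mul_sum]
    refine Finset.sum_congr rfl fun i _ => ?_
    have : (y - (x + a • v)) i = a • (g i - g' i) := by
      simp only [PiLp.sub_apply, PiLp.add_apply, PiLp.smul_apply, hy, hv, smul_sub]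
      abel
    rw [this, norm_smul, Real.norm_of_nonneg ha]
  have h4 : inner ℝ (gradient u x) (a • v) = a * ∑ i, inner ℝ (gradient u x i) (g' i) := by
    rw [real_inner_smul_right, PiLp.inner_apply]
  have h5 : ‖a • v‖ ^ 2 = a ^ 2 * ∑ i, ‖g' i‖ ^ 2 := by
    rw [norm_smul, mul_pow, Real.norm_of_nonneg ha, PiLp.norm_sq_eq_of_L2]
  rw [add_sub_cancel_left, h4, h5] at h1
  have h6 := h2.trans (mul_le_mul_of_nonneg_left h3 hK)
  linarith [(abs_le.1 h1).1, (abs_le.1 h6).1]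

variable {ι S A Ω : Type*} [Fintype ι] [DecidableEq ι] [MeasurableSpace S] [MeasurableSpace A]
  {mΩ : MeasurableSpace Ω} {M : ι → ℕ} {ν : Measure A} [SigmaFinite ν]
  {Γ : MarkovGame ι S A} {π : ParamPolicy ι S A M ν}
  {mode : PlayMode} {est : ι → RewardEstimator} {c : ℝ} {α : ℕ → ℝ} {w : ℕ → ι → ι → ι → ℝ}
  {P : Measure Ω} {ℱ : Filtration ℕ mΩ} {θ : ℕ → Ω → Param M} {b : ℕ → ι → Ω → Param M}
  {ep : ℕ → ι → Ω → Episode ι S A} {B V L R : ℝ} {u : Param M → ℝ}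

lemma IsPotential.continuous_gradient (hu : IsPotential Γ π u)
    (hs : ScoreAssumption π B V L) (hL : 0 ≤ L) (hR : BoundedReward Γ R) (hR0 : 0 ≤ R) :
    Continuous (gradient u) := by
  obtain ⟨C, hC, hlip⟩ := hu.exists_lipschitz_gradient hs hL hR hR0
  exact (LipschitzWith.of_dist_le_mul (K := ⟨C, hC⟩) fun x y => by
    rw [dist_eq_norm, dist_eq_norm]; exact hlip x y).continuous

variable [IsProbabilityMeasure P]

lemma IsPotential.integrable_comp (hu : IsPotential Γ π u) (hR : BoundedReward Γ R)
    {X : Ω → Param M} (hX : Measurable X) : Integrable (fun ω => u (X ω)) P := by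
  refine integrable_of_abs_le (hu.differentiable_potential.continuous.measurable.comp hX)
    (C := |u 0| + Fintype.card ι * (2 * (R / (1 - Γ.discount)))) fun ω => ?_
  have h1 := hu.abs_sub_le hR 0 (X ω)
  have h2 := abs_add_le (u 0) (u (X ω) - u 0)
  rw [add_sub_cancel] at h2
  linarith

lemma IsPotential.integrable_gradient_sq (hu : IsPotential Γ π u)
    (hs : ScoreAssumption π B V L) (hL : 0 ≤ L) (hR : BoundedReward Γ R) (hR0 : 0 ≤ R)
    {X : Ω → Param M} (hX : Measurable X) :
    Integrable (fun ω => ‖gradient u (X ω)‖ ^ 2) P ∧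
      ∀ i, Integrable (fun ω => ‖gradient u (X ω) i‖ ^ 2) P := by
  obtain ⟨C, hC, hbd⟩ := hu.exists_norm_gradient_le hs hL hR hR0
  have hm : Measurable fun ω => gradient u (X ω) :=
    (hu.continuous_gradient hs hL hR hR0).measurable.comp hX
  refine ⟨integrable_of_abs_le (hm.norm.pow_const 2) (C := C ^ 2) fun ω => ?_, fun i => ?_⟩
  · rw [abs_of_nonneg (by positivity)]
    exact pow_le_pow_left₀ (norm_nonneg _) (hbd _) 2
  · have h1 : Measurable fun g : Param M => g i := by fun_prop
    refine integrable_of_abs_le ((h1.comp hm).norm.pow_const 2) (C := C ^ 2) fun ω => ?_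
    rw [abs_of_nonneg (by positivity)]
    exact pow_le_pow_left₀ (norm_nonneg _) ((Param.norm_apply_le _ i).trans (hbd _)) 2

/-- The potential increases in expectation by a multiple of the squared gradient, up to the
variance of the stochastic gradients and the belief errors. -/
theorem NetworkedPolicyGradientPlay.exists_expected_ascent
    (halg : NetworkedPolicyGradientPlay Γ π mode est c α w P ℱ θ b ep)
    (hu : IsPotential Γ π u) (hs : ScoreAssumption π B V L) (hL : 0 ≤ L)
    (hR : BoundedReward Γ R) (hR0 : 0 ≤ R) (hc : 0 ≤ c) (hα : ∀ t, 1 ≤ t → 0 < α t)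
    (he : ∀ t, Integrable (fun ω => beliefError (fun n => b t n ω) (θ t ω)) P) :
    ∃ C₁ C₂ : ℝ, 0 ≤ C₁ ∧ 0 ≤ C₂ ∧ ∀ t,
      c * (1 - Γ.discount) * α (t + 1) * ∫ ω, ‖gradient u (θ t ω)‖ ^ 2 ∂P
        ≤ ∫ ω, u (θ (t + 1) ω) ∂P - ∫ ω, u (θ t ω) ∂P + C₁ * α (t + 1) ^ 2
          + C₂ * (α (t + 1) * ∫ ω, beliefError (fun n => b t n ω) (θ t ω) ∂P) := by
  obtain ⟨C, hC, hlip⟩ := hu.exists_lipschitz_gradient hs hL hR hR0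
  obtain ⟨K, hK, hbd⟩ := hu.exists_norm_gradient_le hs hL hR hR0
  obtain ⟨Q, hQ, hsq⟩ := exists_integral_actingGradient_sq_le hs hR hR0 hc halg
  obtain ⟨H, hH, hinner⟩ := exists_le_integral_inner hu hs hL hR hR0 hc halg
  have hrb := rewardBound_nonneg Γ hR0
  set N : ℝ := (Fintype.card ι : ℝ) with hN
  set D := 2 * (c * rewardBound Γ R * (N * L)) with hD
  have hD0 : 0 ≤ D := by positivity
  refine ⟨C * (N * Q), N * H + K * (N * D), by positivity, by positivity, fun t => ?_⟩
  set a := α (t + 1) with ha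
  have ha0 : 0 ≤ a := (hα _ (by omega)).le
  set g : ι → Ω → ℝ := fun i ω => inner ℝ (gradient u (θ t ω) i) (actingGradient Γ π c (est i) i
    (mode.acting (fun n => b t n ω) i) (ep t i ω)) with hg
  set q : ι → Ω → ℝ := fun i ω => ‖actingGradient Γ π c (est i) i
    (mode.acting (fun n => b t n ω) i) (ep t i ω)‖ ^ 2 with hq
  set e : Ω → ℝ := fun ω => beliefError (fun n => b t n ω) (θ t ω) with hedef
  -- The ascent holds pathwise; expectations are taken afterwards, and only the inner products need
  -- conditioning on the past.
  have hpt : ∀ ω, a * ∑ i, g i ω - C * a ^ 2 * ∑ i, q i ω - K * a * (N * D) * e ω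
      ≤ u (θ (t + 1) ω) - u (θ t ω) := fun ω => by
    have h1 := ascent_step hu.differentiable_potential hC hK hlip hbd
      (g' := fun i => actingGradient Γ π c (est i) i (mode.acting (fun n => b t n ω) i)
        (ep t i ω)) ha0 (fun i => halg.param_step t i ω)
    have h2 : ∑ i, ‖stochGradient Γ π c (est i) i (b t i ω) (ep t i ω)
        - actingGradient Γ π c (est i) i (mode.acting (fun n => b t n ω) i) (ep t i ω)‖
        ≤ N * (D * e ω) := by
      calc _ ≤ ∑ _i : ι, D * e ω := Finset.sum_le_sum fun i _ =>
            NetworkedPolicyGradientPlay.norm_stochGradient_sub_le (Γ := Γ) (mode := mode)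
              hs hL hR hR0 hc (est i) i (fun n => b t n ω) (θ t ω) (ep t i ω)
        _ = _ := by simp [hN]
    have h3 := mul_le_mul_of_nonneg_left h2 (mul_nonneg hK ha0)
    simp only [hg, hq]
    linarith
  have ig : ∀ i, Integrable (g i) P := fun i => (hinner t i (he t)).1
  have iq : ∀ i, Integrable (q i) P := fun i => (hsq t i).1
  have ig' : Integrable (fun ω => a * ∑ i, g i ω) P :=
    (integrable_finsetSum _ fun i _ => ig i).const_mul _
  have iq' : Integrable (fun ω => C * a ^ 2 * ∑ i, q i ω) P :=
    (integrable_finsetSum _ fun i _ => iq i).const_mul _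
  have ie' : Integrable (fun ω => K * a * (N * D) * e ω) P := (he t).const_mul _
  have igq : Integrable (fun ω => a * ∑ i, g i ω - C * a ^ 2 * ∑ i, q i ω) P := ig'.sub iq'
  have iu : ∀ s, Integrable (fun ω => u (θ s ω)) P := fun s =>
    hu.integrable_comp hR (halg.measurable_theta s)
  have hmono := integral_mono (igq.sub ie') ((iu (t + 1)).sub (iu t)) hpt
  simp only [Pi.sub_apply] at hmono
  rw [integral_sub (iu (t + 1)) (iu t), integral_sub igq ie', integral_sub ig' iq',
    integral_const_mul, integral_const_mul, integral_const_mul,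
    integral_finsetSum _ fun i _ => ig i, integral_finsetSum _ fun i _ => iq i] at hmono
  obtain ⟨-, hgi⟩ := hu.integrable_gradient_sq (P := P) hs hL hR hR0 (halg.measurable_theta t)
  have hgsq : ∫ ω, ‖gradient u (θ t ω)‖ ^ 2 ∂P = ∑ i, ∫ ω, ‖gradient u (θ t ω) i‖ ^ 2 ∂P := by
    rw [← integral_finsetSum _ fun i _ => hgi i]
    exact integral_congr_ae (ae_of_all _ fun ω => PiLp.norm_sq_eq_of_L2 _ _)
  have hsumg : c * (1 - Γ.discount) * ∫ ω, ‖gradient u (θ t ω)‖ ^ 2 ∂P - N * H * ∫ ω, e ω ∂P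
      ≤ ∑ i, ∫ ω, g i ω ∂P := by
    calc _ = ∑ i, (c * (1 - Γ.discount) * ∫ ω, ‖gradient u (θ t ω) i‖ ^ 2 ∂P
          - H * ∫ ω, e ω ∂P) := by
          rw [Finset.sum_sub_distrib, ← Finset.mul_sum, ← hgsq, Finset.sum_const,
            Finset.card_univ, nsmul_eq_mul]
          ring
      _ ≤ _ := Finset.sum_le_sum fun i _ => (hinner t i (he t)).2
  have hsumq : ∑ i, ∫ ω, q i ω ∂P ≤ N * Q := by
    calc _ ≤ ∑ _i : ι, Q := Finset.sum_le_sum fun i _ => (hsq t i).2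
      _ = _ := by simp [hN]
  have k1 := mul_le_mul_of_nonneg_left hsumg ha0
  have k2 := mul_le_mul_of_nonneg_left hsumq (by positivity : 0 ≤ C * a ^ 2)
  linarith

end Ascent
end

/-! ### Conclusion: ascent, belief decay and rate combined -/

theorem theorem2 {ι S A Ω : Type*} [Fintype ι] [DecidableEq ι]
    [MeasurableSpace S] [MeasurableSpace A] [mΩ : MeasurableSpace Ω] {M : ι → ℕ}
    (ν : Measure A) [SigmaFinite ν]
    -- the game, the policies and the potential
    (Γ : MarkovGame ι S A) (π : ParamPolicy ι S A M ν)
    (u : Param M → ℝ) (hu : IsPotential Γ π u)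
    -- communication network and weights
    (G : ℕ → SimpleGraph ι) (hG : ConnectedNetwork G)
    (w : ℕ → ι → ι → ι → ℝ) (h : ℝ) (hh0 : 0 < h) (hh1 : h < 1) (hw : WeightAssumption G w h)
    -- step sizes
    (α : ℕ → ℝ) (β : ℝ) (hβ0 : 0 < β) (hβ1 : β < 1) (hα_pos : ∀ t, 1 ≤ t → 0 < α t)
    (hα : α =Θ[atTop] fun t : ℕ => (t : ℝ) ^ (-β))
    -- rewards and scores
    (R : ℝ) (hR0 : 0 < R) (hR : BoundedReward Γ R)
    (B V L : ℝ) (hB : 0 ≤ B) (hV : 0 ≤ V) (hL : 0 ≤ L) (hscore : ScoreAssumption π B V L)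
    -- the sequence generated by the algorithm
    (P : Measure Ω) [IsProbabilityMeasure P] (ℱ : Filtration ℕ mΩ)
    (mode : PlayMode) (est : ι → RewardEstimator) (c : ℝ) (hc : 0 < c)
    (θ : ℕ → Ω → Param M) (b : ℕ → ι → Ω → Param M) (ep : ℕ → ι → Ω → Episode ι S A)
    (halg : NetworkedPolicyGradientPlay Γ π mode est c α w P ℱ θ b ep)
    (κ : ℝ) (hκ : 0 ≤ κ) (hinit : InitialBeliefError P (θ 0) (b 0) κ) :
    (∀ t, Integrable (fun ω => ‖gradient u (θ t ω)‖ ^ 2) P) ∧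
    (∀ ε : ℝ, 0 < ε → (stationaryTimes P u θ ε).Nonempty) ∧
    ((fun ε : ℝ => (stationaryTime P u θ ε : ℝ)) =O[𝓝[>] (0 : ℝ)]
      fun ε : ℝ => ε ^ (-(1 / min (1 - β) β))) ∧
    (β = 1 / 2 →
      (fun ε : ℝ => (stationaryTime P u θ ε : ℝ)) =O[𝓝[>] (0 : ℝ)] fun ε : ℝ => ε ^ (-2 : ℝ)) := by
  have hγ := Γ.one_sub_discount_pos
  obtain ⟨a, A, ha, hA, hαb⟩ := exists_stepSize_bounds hα_pos hα
  obtain ⟨he, D, hD, heD⟩ := halg.exists_integral_beliefError_le hscore hL hR hR0.le hc.le hG hw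
    hh0 hh1 hα_pos hA.le hβ0 (fun t => (hαb t).2) hinit
  obtain ⟨C₁, C₂, hC₁, hC₂, hasc⟩ := halg.exists_expected_ascent hu hscore hL hR hR0.le hc.le
    hα_pos he
  -- Both error terms are of second order in the decay rate: the variance carries the squared step
  -- size, and the bias carries the step size times a belief error of the same order.
  have hdesc : ∀ t, c * (1 - Γ.discount) * a * powerDecay β t
      * ∫ ω, ‖gradient u (θ t ω)‖ ^ 2 ∂P
      ≤ ∫ ω, u (θ (t + 1) ω) ∂P - ∫ ω, u (θ t ω) ∂P
        + (C₁ * A ^ 2 + C₂ * (A * D)) * powerDecay β t ^ 2 := fun t => by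
    have hv := powerDecay_pos β t
    have hα0 := hα_pos (t + 1) (by omega)
    have hf : 0 ≤ ∫ ω, ‖gradient u (θ t ω)‖ ^ 2 ∂P := integral_nonneg fun ω => sq_nonneg _
    have h1 : c * (1 - Γ.discount) * (a * powerDecay β t) * ∫ ω, ‖gradient u (θ t ω)‖ ^ 2 ∂P
        ≤ c * (1 - Γ.discount) * α (t + 1) * ∫ ω, ‖gradient u (θ t ω)‖ ^ 2 ∂P := by
      have := (hαb t).1
      gcongr
    have h2 : C₁ * α (t + 1) ^ 2 ≤ C₁ * (A * powerDecay β t) ^ 2 := by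
      have := (hαb t).2
      gcongr
    have h3 : C₂ * (α (t + 1) * ∫ ω, beliefError (fun n => b t n ω) (θ t ω) ∂P)
        ≤ C₂ * (A * powerDecay β t * (D * powerDecay β t)) := by
      have h4 := (hαb t).2
      have h5 := heD t
      have h6 : 0 ≤ ∫ ω, beliefError (fun n => b t n ω) (θ t ω) ∂P :=
        integral_nonneg fun ω => beliefError_nonneg _ _
      gcongr
    linarith [hasc t]
  have hbound : ∀ s t, ∫ ω, u (θ t ω) ∂P - ∫ ω, u (θ s ω) ∂P
      ≤ Fintype.card ι * (2 * (R / (1 - Γ.discount))) := fun s t => by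
    have hi := fun r => hu.integrable_comp (P := P) hR (halg.measurable_theta r)
    rw [← integral_sub (hi t) (hi s)]
    exact (le_abs_self _).trans (abs_integral_le_of_abs_le fun ω => hu.abs_sub_le hR _ _)
  obtain ⟨K, hK, hrate⟩ := exists_le_of_descent (β := β)
    (f := fun t => ∫ ω, ‖gradient u (θ t ω)‖ ^ 2 ∂P) (U := fun t => ∫ ω, u (θ t ω) ∂P)
    (c := c * (1 - Γ.discount) * a) (C := C₁ * A ^ 2 + C₂ * (A * D)) hβ0 hβ1 (by positivity)
    (by positivity) hbound hdesc
  have hmin : 0 < min (1 - β) β := lt_min (by linarith) hβ0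
  obtain ⟨hne, hO⟩ := firstTime_isBigO (S := stationaryTimes P u θ) hmin hK hrate
    fun ε t => mem_stationaryTimes
  refine ⟨fun t => (hu.integrable_gradient_sq hscore hL hR hR0.le (halg.measurable_theta t)).1,
    hne, hO, fun hβ => ?_⟩
  have hexp : -(1 / min (1 - β) β) = (-2 : ℝ) := by
    rw [hβ]; norm_num
  rw [hexp] at hO
  exact hO
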